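/- For an integral scheme $Y$, let $\mathrm{Pic}(Y)$ be the group of Cartier divisors on $Y$ modulo linear equivalence, and for a Cartier divisor $D$ let $H^0(Y,D)$ be the group of rational functions $f$ on $Y$ such that $f g_y$ is regular at $y$ for every $y\in Y$, where $g_y$ is a local equation of $D$ at $y$; a nonzero $f\in H^0(Y,D)$ has divisor of zeros $D+\mathrm{div}(f)$. If the Cartier divisors $D_1,\dots,D_r$ freely generate $\mathrm{Pic}(Y)$, the Cox ring of $Y$ (with respect to $D_1,\dots,D_r$) is the $\mathbb{Z}^r$-graded ring $$\mathrm{Cox}(Y)=\bigoplus_{(m_1,\dots,m_r)\in\mathbb{Z}^r}H^0(Y,\,m_1D_1+\dots+m_rD_r),$$ whose multiplication is induced by that of rational functions. **Proposition.** Let $X'$ be a projective variety (an integral projective scheme) over $\mathbb{C}$ with $\dim X'\ge 2$, let $p\in X'$ be a smooth closed point, and let $\pi\colon X\to X'$ be the blow-up of $p$, with exceptional divisor $E\subset X$ (the effective Cartier divisor defined by the ideal sheaf $\pi^{-1}\mathfrak{m}_p\cdot\mathcal{O}_X$). Let $D'_1,\dots,D'_{r'}$ be divisors that freely generate $\mathrm{Pic}(X')$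 and $D_1,\dots,D_r$ divisors that freely generate $\mathrm{Pic}(X)$, and form $\mathrm{Cox}(X')$ and $\mathrm{Cox}(X)$ with respect to them. Let $x_E\in H^0(X,m_1D_1+\dots+m_rD_r)\subset\mathrm{Cox}(X)$ be a section corresponding to $E$, that is, a nonzero homogeneous element whose divisor of zeros is $E$. Then there is an isomorphism of rings $$\mathrm{Cox}(X)_{x_E}\;\cong\;\mathrm{Cox}(X')[T,T^{-1}].$$ -/

import Mathlib

open AlgebraicGeometry CategoryTheory

noncomputable section

namespace CoxRing

universe u

/-! ### Projective varieties over `ℂ` and their smooth points -/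

/-- The grading of `ℂ[x₀, …, xₙ]` by degree. -/
instance (n : ℕ) : GradedRing (MvPolynomial.homogeneousSubmodule (Fin (n + 1)) ℂ) :=
  MvPolynomial.gradedAlgebra

/-- Projective `n`-space over `ℂ`, as `Proj ℂ[x₀, …, xₙ]`. -/
def ProjSpace (n : ℕ) : Scheme.{0} :=
  Proj (MvPolynomial.homogeneousSubmodule (Fin (n + 1)) ℂ)

/-- The structure morphism of projective space. -/
def ProjSpace.toSpec (n : ℕ) : ProjSpace n ⟶ Spec (.of ℂ) :=
  Proj.toSpecZero (MvPolynomial.homogeneousSubmodule (Fin (n + 1)) ℂ) ≫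
    Spec.map (CommRingCat.ofHom
      (algebraMap ℂ (MvPolynomial.homogeneousSubmodule (Fin (n + 1)) ℂ 0)))

/-- A scheme over `ℂ` is projective if it is isomorphic, over `ℂ`, to a closed subscheme of a
projective space. -/
def IsProjective {X : Scheme.{0}} (s : X ⟶ Spec (.of ℂ)) : Prop :=
  ∃ (n : ℕ) (i : X ⟶ ProjSpace n), IsClosedImmersion i ∧ i ≫ ProjSpace.toSpec n = s

/-- A smooth (that is, nonsingular) point of a complex variety: a closed point whose local
ring `R` is regular, i.e. `dim 𝔪/𝔪² = dim R`. -/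
structure IsSmoothPoint (X : Scheme.{u}) (p : X) : Prop where
  isClosed : IsClosed ({p} : Set X)
  isRegular : IsRegularLocalRing (X.presheaf.stalk p)

/-! ### Cartier divisors on an integral scheme -/

section Divisors

variable (X : Scheme.{u}) [IsIntegral X]

/-- The function field `K(X)` (a type synonym for Mathlib's, so that it carries a single ring
structure, the one underlying its field structure). -/
def FunField : Type u := X.functionField

instance : Field (FunField X) := inferInstanceAs (Field X.functionField)

/-- The inclusion of the local ring `𝒪_{X,x}` into `K(X)`. -/
instance (x : X) : Algebra (X.presheaf.stalk x) (FunField X) :=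
  inferInstanceAs (Algebra (X.presheaf.stalk x) X.functionField)

/-- The units of the local ring `𝒪_{X,x}`, as a subgroup of `K(X)ˣ`. -/
def unitsAt (x : X) : Subgroup (FunField X)ˣ :=
  (Units.map (algebraMap (X.presheaf.stalk x) (FunField X)).toMonoidHom).range

/-- Global sections of the sheaf `K(X)ˣ / 𝒪_Xˣ`: families of elements of the stalks
`K(X)ˣ / 𝒪_{X,x}ˣ` that are locally induced by one rational function. -/
def cartierSubgroup : Subgroup (∀ x : X, (FunField X)ˣ ⧸ unitsAt X x) where
  carrier := {D | ∀ x : X, ∃ U : X.Opens, x ∈ U ∧ ∃ g : (FunField X)ˣ,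
    ∀ y ∈ U, D y = QuotientGroup.mk g}
  one_mem' x := ⟨⊤, trivial, 1, fun _ _ => rfl⟩
  mul_mem' {D D'} hD hD' x := by
    obtain ⟨U, hxU, g, hg⟩ := hD x
    obtain ⟨V, hxV, h, hh⟩ := hD' x
    exact ⟨U ⊓ V, ⟨hxU, hxV⟩, g * h, fun y hy => by
      rw [Pi.mul_apply, hg y hy.1, hh y hy.2]; rfl⟩
  inv_mem' {D} hD x := by
    obtain ⟨U, hxU, g, hg⟩ := hD x
    exact ⟨U, hxU, g⁻¹, fun y hy => by rw [Pi.inv_apply, hg y hy]; rfl⟩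

/-- The group of Cartier divisors, written additively. -/
def CaDiv : Type u := Additive (cartierSubgroup X)

instance : AddCommGroup (CaDiv X) := inferInstanceAs (AddCommGroup (Additive (cartierSubgroup X)))

variable {X}

/-- The class in `K(X)ˣ / 𝒪_{X,x}ˣ` of the local equations of a Cartier divisor at `x`. -/
def CaDiv.germ (D : CaDiv X) (x : X) : (FunField X)ˣ ⧸ unitsAt X x :=
  (Additive.toMul (α := cartierSubgroup X) D).1 x

theorem CaDiv.germ_zero (x : X) : (0 : CaDiv X).germ x = 1 := rfl

theorem CaDiv.germ_add (D D' : CaDiv X) (x : X) : (D + D').germ x = D.germ x * D'.germ x := rfl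

/-- `g` is a local equation of the Cartier divisor `D` at the point `x`. -/
def IsLocalEq (D : CaDiv X) (x : X) (g : (FunField X)ˣ) : Prop :=
  D.germ x = QuotientGroup.mk g

variable (X)

/-- The principal divisor of a nonzero rational function. -/
def principal : Additive (FunField X)ˣ →+ CaDiv X where
  toFun f := Additive.ofMul (α := cartierSubgroup X)
    ⟨fun _ => QuotientGroup.mk f.toMul, fun _ => ⟨⊤, trivial, f.toMul, fun _ _ => rfl⟩⟩
  map_zero' := rfl
  map_add' _ _ := rfl

/-- The Picard group, as the group of Cartier divisors modulo linear equivalence. -/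
abbrev Pic : Type u := CaDiv X ⧸ (principal X).range

variable {X}

/-- The divisors `D₁, …, D_r` freely generate the Picard group. -/
def FreelyGeneratesPic {r : ℕ} (D : Fin r → CaDiv X) : Prop :=
  LinearIndependent ℤ (fun i => (QuotientAddGroup.mk (D i) : Pic X)) ∧
    Submodule.span ℤ (Set.range fun i => (QuotientAddGroup.mk (D i) : Pic X)) = ⊤

/-- `H⁰(X, D)`: the rational functions `f` such that `f g` is regular at `x` for every point `x`
and every local equation `g` of `D` at `x`. -/
def H0 (D : CaDiv X) : AddSubgroup (FunField X) where
  carrier := {f | ∀ (x : X) (g : (FunField X)ˣ), IsLocalEq D x g →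
    f * g ∈ (algebraMap (X.presheaf.stalk x) (FunField X)).range}
  zero_mem' x g _ := by rw [zero_mul]; exact zero_mem _
  add_mem' ha hb x g hg := by rw [add_mul]; exact add_mem (ha x g hg) (hb x g hg)
  neg_mem' ha x g hg := by rw [neg_mul]; exact neg_mem (ha x g hg)

/-- The divisor of zeros of a nonzero section `s ∈ H⁰(X, D)`, namely `D + div(s)`, equals `E`. -/
def HasZeroDivisor {D : CaDiv X} (s : H0 D) (E : CaDiv X) : Prop :=
  ∃ f : (FunField X)ˣ, (f : FunField X) = s ∧ D + principal X (Additive.ofMul f) = E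

/-! ### Cox rings -/

theorem one_mem_H0_zero : (1 : FunField X) ∈ H0 (0 : CaDiv X) := by
  intro x g hg
  have hg' : (QuotientGroup.mk 1 : (FunField X)ˣ ⧸ unitsAt X x) = QuotientGroup.mk g := hg
  rw [QuotientGroup.eq, inv_one, one_mul] at hg'
  obtain ⟨v, rfl⟩ := hg'
  exact ⟨v, by simp⟩

theorem mul_mem_H0_add {D D' : CaDiv X} {f f' : FunField X} (hf : f ∈ H0 D)
    (hf' : f' ∈ H0 D') : f * f' ∈ H0 (D + D') := by
  intro x g hg
  obtain ⟨h, hh⟩ := QuotientGroup.mk_surjective (D.germ x)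
  have hh' : IsLocalEq D' x (h⁻¹ * g) := by
    have : D.germ x * D'.germ x = QuotientGroup.mk g := hg
    rw [← hh] at this
    exact eq_inv_mul_of_mul_eq this
  have e : f * f' * g = (f * h) * (f' * (h⁻¹ * g : (FunField X)ˣ)) := by
    have : (h : FunField X) * ((h⁻¹ * g : (FunField X)ˣ) : FunField X) = g := by
      rw [← Units.val_mul, mul_inv_cancel_left]
    rw [mul_mul_mul_comm, this]
  rw [e]
  exact mul_mem (hf x h hh.symm) (hf' x _ hh')

/-- The graded piece `H⁰(X, m₁D₁ + … + m_rD_r)` of the Cox ring. -/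
def coxPiece {r : ℕ} (D : Fin r → CaDiv X) (m : Fin r → ℤ) : AddSubgroup (FunField X) :=
  H0 (∑ i, m i • D i)

instance {r : ℕ} (D : Fin r → CaDiv X) : SetLike.GradedMonoid (coxPiece D) where
  one_mem := by simpa [coxPiece] using one_mem_H0_zero
  mul_mem m n f f' hf hf' := by
    have := mul_mem_H0_add hf hf'
    simpa only [coxPiece, Pi.add_apply, add_smul, Finset.sum_add_distrib] using this

/-- The Cox ring `⨁_{m ∈ ℤʳ} H⁰(X, m₁D₁ + … + m_rD_r)` with respect to divisors `D₁, …, D_r`,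
multiplied as rational functions. -/
abbrev Cox {r : ℕ} (D : Fin r → CaDiv X) : Type u :=
  DirectSum (Fin r → ℤ) fun m => coxPiece D m

/-- A section of `m₁D₁ + … + m_rD_r`, as a homogeneous element of the Cox ring. -/
def Cox.ofSection {r : ℕ} (D : Fin r → CaDiv X) (m : Fin r → ℤ)
    (s : H0 (∑ i, m i • D i)) : Cox D :=
  DirectSum.of (fun m => coxPiece D m) m s

end Divisors

/-! ### Blow-ups -/

/-- An ideal sheaf is invertible (the ideal sheaf of an effective Cartier divisor) if it is
locally generated by a nonzerodivisor. -/
def IsInvertibleIdeal {X : Scheme.{u}} (I : X.IdealSheafData) : Prop :=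
  ∀ x : X, ∃ U : X.affineOpens, x ∈ U.1 ∧
    ∃ g ∈ nonZeroDivisors Γ(X, U), I.ideal U = Ideal.span {g}

/-- `π : X ⟶ Y` is the blow-up of `Y` along the ideal sheaf `I`: the inverse image ideal sheaf
`π⁻¹I · 𝒪_X` is invertible, and `π` is universal with this property. -/
structure IsBlowUp {X Y : Scheme.{u}} (I : Y.IdealSheafData) (π : X ⟶ Y) : Prop where
  isInvertible : IsInvertibleIdeal (I.comap π)
  existsUnique_lift : ∀ (T : Scheme.{u}) (f : T ⟶ Y), IsInvertibleIdeal (I.comap f) →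
    ∃! g : T ⟶ X, g ≫ π = f

/-- The ideal sheaf of a closed point with its reduced structure. -/
def pointIdeal {X : Scheme.{u}} (p : X) (hp : IsClosed ({p} : Set X)) : X.IdealSheafData :=
  Scheme.IdealSheafData.vanishingIdeal ⟨{p}, hp⟩

section

variable {X : Scheme.{u}} [IsIntegral X]

/-- The element of the function field given by a section over an open neighbourhood of `x`. -/
def toFunField {U : X.Opens} {x : X} (hx : x ∈ U) (g : Γ(X, U)) : FunField X :=
  algebraMap (X.presheaf.stalk x) (FunField X) (X.presheaf.germ U x hx g)

theorem toFunField_eq {U : X.Opens} {x y : X} (hx : x ∈ U) (hy : y ∈ U) (g : Γ(X, U)) :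
    toFunField hx g = toFunField hy g := by
  have : Nonempty U := ⟨⟨x, hx⟩⟩
  exact (Scheme.algebraMap_germ_eq_germToFunctionField X hx g).trans
    (Scheme.algebraMap_germ_eq_germToFunctionField X hy g).symm

theorem toFunField_ne_zero {U : X.Opens} {x : X} (hx : x ∈ U) {g : Γ(X, U)}
    (hg : g ∈ nonZeroDivisors Γ(X, U)) : toFunField hx g ≠ 0 := by
  have : Nonempty U := ⟨⟨x, hx⟩⟩
  have hg0 : g ≠ 0 := nonZeroDivisors.ne_zero hg
  intro h
  refine hg0 (X.germToFunctionField_injective U ?_)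
  rw [map_zero]
  exact (Scheme.algebraMap_germ_eq_germToFunctionField X hx g).symm.trans h

/-- `f` is, in `K(X)`, a generator of the ideal sheaf `I` over an affine neighbourhood of `x`. -/
def IsLocalGenerator (I : X.IdealSheafData) (x : X) (f : (FunField X)ˣ) : Prop :=
  ∃ (U : X.affineOpens) (hx : x ∈ U.1) (g : Γ(X, U)),
    I.ideal U = Ideal.span {g} ∧ (f : FunField X) = toFunField hx g

theorem exists_isLocalGenerator {I : X.IdealSheafData} (hI : IsInvertibleIdeal I) (x : X) :
    ∃ f, IsLocalGenerator I x f := by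
  obtain ⟨U, hx, g, hg, h⟩ := hI x
  exact ⟨Units.mk0 _ (toFunField_ne_zero hx hg), U, hx, g, h, rfl⟩

/-- Two local generators of an ideal sheaf at `x` differ by a unit of `𝒪_{X,x}`. -/
theorem IsLocalGenerator.mk_eq {I : X.IdealSheafData} {x : X} {f f' : (FunField X)ˣ}
    (hf : IsLocalGenerator I x f) (hf' : IsLocalGenerator I x f') :
    (QuotientGroup.mk f : (FunField X)ˣ ⧸ unitsAt X x) = QuotientGroup.mk f' := by
  obtain ⟨U, hU, g, hg, e⟩ := hf
  obtain ⟨V, hV, g', hg', e'⟩ := hf'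
  obtain ⟨_, ⟨W, hW, rfl⟩, hxW, hWUV⟩ := X.isBasis_affineOpens.exists_subset_of_mem_open
    (show x ∈ ((U.1 ⊓ V.1 : X.Opens) : Set X) from ⟨hU, hV⟩) (U.1 ⊓ V.1).isOpen
  have hWU : (⟨W, hW⟩ : X.affineOpens) ≤ U := fun y hy => (hWUV hy).1
  have hWV : (⟨W, hW⟩ : X.affineOpens) ≤ V := fun y hy => (hWUV hy).2
  have key : ∀ (A : X.affineOpens) (hA : x ∈ A.1) (h : (⟨W, hW⟩ : X.affineOpens) ≤ A)
      (a : Γ(X, A)), I.ideal A = Ideal.span {a} →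
      (I.ideal ⟨W, hW⟩).map (X.presheaf.germ W x hxW).hom =
        Ideal.span {X.presheaf.germ A.1 x hA a} := by
    intro A hA h a ha
    rw [← I.map_ideal h, ha, Ideal.map_map, Ideal.map_span, Set.image_singleton]
    congr 2
    exact X.presheaf.germ_res_apply (homOfLE h) x hxW a
  have hs := (key U hU hWU g hg).symm.trans (key V hV hWV g' hg')
  obtain ⟨v, hv⟩ := Ideal.span_singleton_eq_span_singleton.mp hs
  rw [QuotientGroup.eq]
  refine ⟨v, ?_⟩
  rw [eq_inv_mul_iff_mul_eq]
  ext
  rw [Units.val_mul, e, e', toFunField, toFunField, ← hv, map_mul]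
  rfl

/-- The effective Cartier divisor defined by an invertible ideal sheaf: its local equations are
the local generators of the ideal sheaf. -/
def divisorOfIdeal (I : X.IdealSheafData) (hI : IsInvertibleIdeal I) : CaDiv X :=
  Additive.ofMul (α := cartierSubgroup X)
    ⟨fun x => QuotientGroup.mk (exists_isLocalGenerator hI x).choose, fun x => by
      obtain ⟨U, hx, g, hg, h⟩ := hI x
      refine ⟨U.1, hx, Units.mk0 _ (toFunField_ne_zero hx hg), fun y hy => ?_⟩
      exact (exists_isLocalGenerator hI y).choose_spec.mk_eq
        ⟨U, hy, g, h, toFunField_eq hx hy g⟩⟩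

/-- The exceptional divisor of a blow-up, defined by the ideal sheaf `π⁻¹I · 𝒪_X`. -/
def exceptionalDivisor {Y : Scheme.{u}} {I : Y.IdealSheafData} {π : X ⟶ Y}
    (h : IsBlowUp I π) : CaDiv X :=
  divisorOfIdeal (I.comap π) h.isInvertible

end

end CoxRing

end

/-! The order of vanishing at `p` is a valuation, since the local ring at `p` is regular; carried
over to the function field of `X` it is the order `v` of vanishing along `E`, and its centre is
the generic point of `E`. Away from `E` the blow-up is an isomorphism. A divisor on `X' ∖ {p}`
extends over `p`, because divisors on the punctured spectrum of a regular local ring of dimension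
at least two are principal, and units and regular functions extend as well. Hence every divisor on
`X` is `π*D' + kE` for a unique divisor `D'` on `X'` and a unique integer `k`, so that `Pic X =
Pic X' ⊕ ℤE`, and `H⁰(X, π*D' + kE) ⊆ H⁰(X', D')`, with equality for `k ≥ 0`. Recording `k` as the
exponent of `T` embeds `Cox(X)` into `Cox(X')[T, T⁻¹]`, with image containing `Cox(X')[T]` and
`x_E` going to a unit times `T`; inverting `x_E` gives everything. -/

noncomputable section

namespace CoxRing

universe u

/-! ### Regular local rings -/

section RegularSystem

open IsLocalRing

/-- A regular system of parameters of a local ring: a family of (at most, hence exactly) `dim A`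
generators of the maximal ideal. -/
structure IsRegularSystem {A ι : Type*} [CommRing A] [IsLocalRing A] (x : ι → A) : Prop where
  span_range : Ideal.span (Set.range x) = maximalIdeal A
  card_le : (Nat.card ι : WithBot ℕ∞) ≤ ringKrullDim A

theorem exists_isRegularSystem (A : Type*) [CommRing A] [IsRegularLocalRing A] :
    ∃ (n : ℕ) (x : Fin n → A), IsRegularSystem x := by
  have hfg := (maximalIdeal A).fg_of_isNoetherianRing
  have : Finite (maximalIdeal A).generators := Submodule.FG.finite_generators hfg
  let e := Finite.equivFinOfCardEq (Submodule.FG.generators_ncard hfg)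
  refine ⟨(maximalIdeal A).spanFinrank, fun i ↦ e.symm i, ?_, ?_⟩
  · rw [Set.range_comp' Subtype.val e.symm, e.symm.range_eq_univ, Set.image_univ,
      Subtype.range_coe]
    exact (maximalIdeal A).span_generators
  · rw [Nat.card_fin, IsRegularLocalRing.spanFinrank_maximalIdeal]

variable {A ι : Type*} [CommRing A] [IsLocalRing A]

theorem exists_isPrime_ringKrullDim_le_quotient [IsNoetherianRing A] :
    ∃ Q : Ideal A, Q.IsPrime ∧ ringKrullDim A ≤ ringKrullDim (A ⧸ Q) := by
  let l := LTSeries.longestOf (PrimeSpectrum A)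
  refine ⟨l.head.asIdeal, l.head.isPrime, ?_⟩
  rw [ringKrullDim_quotient, ringKrullDim, Order.krullDim_eq_length_of_finiteDimensionalOrder,
    Order.le_krullDim_iff]
  exact ⟨⟨l.length, fun i ↦ ⟨l i, l.head_le i⟩, l.step⟩, rfl⟩

theorem isDomain_of_isPrime_span_singleton [IsNoetherianRing A] {x : A} (hx : x ∈ maximalIdeal A)
    [hprime : (Ideal.span {x}).IsPrime]
    (hdim : ringKrullDim (A ⧸ Ideal.span {x}) < ringKrullDim A) : IsDomain A := by
  obtain ⟨Q, hQ, hQdim⟩ := exists_isPrime_ringKrullDim_le_quotient (A := A)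
  have hxQ : x ∉ Q := fun h ↦ (hQdim.trans (ringKrullDim_le_of_surjective
    (Ideal.Quotient.factor ((Ideal.span_singleton_le_iff_mem Q).mpr h))
    (Ideal.Quotient.factor_surjective _))).not_gt hdim
  have hQx : Q ≤ Ideal.span {x} := fun q hq ↦ by
    by_contra hqx
    have hlower : ringKrullDim (A ⧸ Q) ≤ ringKrullDim (A ⧸ Q ⊔ Ideal.span {x}) + 1 := by
      have : IsLocalRing (A ⧸ Q) := .of_surjective' _ Ideal.Quotient.mk_surjective
      have h := ringKrullDim_le_ringKrullDim_quotient_add_card {Ideal.Quotient.mk Q x} (by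
        rw [ringJacobson_eq_maximalIdeal, ← map_maximalIdeal_of_surjective _
          Ideal.Quotient.mk_surjective]
        simpa using Ideal.mem_map_of_mem (Ideal.Quotient.mk Q) hx)
      rwa [Finset.card_singleton, Finset.coe_singleton, ← Set.image_singleton, ← Ideal.map_span,
        ringKrullDim_eq_of_ringEquiv (DoubleQuot.quotQuotEquivQuotSup Q _), Nat.cast_one] at h
    have hupper : ringKrullDim (A ⧸ Q ⊔ Ideal.span {x}) + 1 ≤
        ringKrullDim (A ⧸ Ideal.span {x}) := by
      refine le_trans ?_ (ringKrullDim_quotient_succ_le_of_nonZeroDivisor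
        (mem_nonZeroDivisors_of_ne_zero (mt Ideal.Quotient.eq_zero_iff_mem.mp hqx)))
      rw [← Set.image_singleton, ← Ideal.map_span,
        ringKrullDim_eq_of_ringEquiv (DoubleQuot.quotQuotEquivQuotSup (Ideal.span {x}) _)]
      gcongr
      refine ringKrullDim_le_of_surjective (Ideal.Quotient.factor ?_)
        (Ideal.Quotient.factor_surjective _)
      rw [sup_comm]
      exact sup_le_sup_right ((Ideal.span_singleton_le_iff_mem Q).mpr hq) _
    exact (hQdim.trans (hlower.trans hupper)).not_gt hdim
  have hQ_le_smul : Q ≤ Ideal.span {x} • Q := fun q hq ↦ by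
    obtain ⟨a, rfl⟩ := Ideal.mem_span_singleton.mp (hQx hq)
    exact Ideal.mul_mem_mul (Ideal.mem_span_singleton_self x) ((hQ.mem_or_mem hq).resolve_left hxQ)
  obtain rfl : Q = ⊥ := Submodule.eq_bot_of_le_smul_of_le_jacobson_bot _ _
    Q.fg_of_isNoetherianRing hQ_le_smul <| by
      rwa [jacobson_eq_maximalIdeal _ bot_ne_top, Ideal.span_singleton_le_iff_mem]
  exact .of_bot_isPrime A

namespace IsRegularSystem

variable {x : ι → A}

theorem mem_maximalIdeal (hx : IsRegularSystem x) (i : ι) : x i ∈ maximalIdeal A :=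
  hx.span_range ▸ Ideal.subset_span ⟨i, rfl⟩

theorem span_image_le (hx : IsRegularSystem x) (t : Set ι) :
    Ideal.span (x '' t) ≤ maximalIdeal A :=
  hx.span_range ▸ Ideal.span_mono (Set.image_subset_range x t)

theorem isLocalRing_quotient (hx : IsRegularSystem x) (t : Set ι) :
    IsLocalRing (A ⧸ Ideal.span (x '' t)) :=
  have : Nontrivial (A ⧸ Ideal.span (x '' t)) := Ideal.Quotient.nontrivial_iff.mpr fun h ↦
    (maximalIdeal.isMaximal A).ne_top (top_le_iff.mp (h ▸ hx.span_image_le t))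
  .of_surjective' _ Ideal.Quotient.mk_surjective

variable [Finite ι] [IsNoetherianRing A]

theorem ringKrullDim_eq (hx : IsRegularSystem x) : ringKrullDim A = Nat.card ι := by
  refine le_antisymm ((ringKrullDim_le_spanFinrank_maximalIdeal A).trans ?_) hx.card_le
  rw [← hx.span_range]
  exact_mod_cast (Submodule.spanFinrank_span_le_ncard_of_finite (Set.finite_range x)).trans
    (Set.image_univ ▸ Set.ncard_univ ι ▸ Set.ncard_image_le)

theorem quotient (hx : IsRegularSystem x) (t : Set ι) [IsLocalRing (A ⧸ Ideal.span (x '' t))] :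
    IsRegularSystem fun i : (tᶜ : Set ι) ↦ Ideal.Quotient.mk (Ideal.span (x '' t)) (x i) where
  span_range := by
    rw [← map_maximalIdeal_of_surjective _ Ideal.Quotient.mk_surjective, ← hx.span_range,
      Ideal.map_span]
    refine le_antisymm (Ideal.span_mono ?_) (Ideal.span_le.mpr ?_)
    · exact Set.range_subset_iff.mpr fun i ↦ ⟨x i, ⟨i, rfl⟩, rfl⟩
    · rintro _ ⟨_, ⟨i, rfl⟩, rfl⟩
      by_cases hi : i ∈ t
      · rw [Ideal.Quotient.eq_zero_iff_mem.mpr (Ideal.subset_span (Set.mem_image_of_mem x hi))]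
        exact zero_mem _
      · exact Ideal.subset_span ⟨⟨i, hi⟩, rfl⟩
  card_le := by
    have hdim := ringKrullDim_le_ringKrullDim_quotient_add_encard (x '' t) (by
      rw [ringJacobson_eq_maximalIdeal]
      exact Set.image_subset_iff.mpr fun i _ ↦ hx.mem_maximalIdeal i)
    have hcard : (x '' t).encard ≤ (t.ncard : ℕ∞) :=
      (Set.encard_image_le x t).trans t.toFinite.cast_ncard_eq.ge
    rw [hx.ringKrullDim_eq, ← Set.ncard_add_ncard_compl t, add_comm, Nat.cast_add] at hdim
    exact ENat.WithBot.add_le_add_natCast_right_iff.mp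
      (hdim.trans (add_le_add_right (WithBot.coe_le_coe.mpr hcard) _))

theorem isDomain {x : ι → A} (hx : IsRegularSystem x) : IsDomain A := by
  induction hn : Nat.card ι generalizing A ι with
  | zero =>
    have : IsEmpty ι := (Finite.card_eq_zero_iff).mp hn
    have hbot : maximalIdeal A = ⊥ := by
      rw [← hx.span_range, Set.range_eq_empty, Ideal.span_empty]
    exact (isField_iff_maximalIdeal_eq.mpr hbot).isDomain
  | succ n ih =>
    obtain ⟨i⟩ : Nonempty ι := (Nat.card_pos_iff.mp (hn ▸ n.succ_pos)).1
    have := hx.isLocalRing_quotient {i}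
    have hcard : Nat.card ({i}ᶜ : Set ι) = n := by
      rw [Nat.card_coe_set_eq, Set.ncard_compl, Set.ncard_singleton, hn, Nat.add_sub_cancel]
    have := ih (hx.quotient {i}) hcard
    have hdim := (hx.quotient {i}).ringKrullDim_eq
    rw [Set.image_singleton] at *
    have : (Ideal.span {x i}).IsPrime := (Ideal.Quotient.isDomain_iff_prime _).mp this
    refine isDomain_of_isPrime_span_singleton (hx.mem_maximalIdeal i) ?_
    rw [hdim, hx.ringKrullDim_eq, hcard, hn]
    exact_mod_cast n.lt_succ_self

theorem isPrime_span_image (hx : IsRegularSystem x) (t : Set ι) :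
    (Ideal.span (x '' t)).IsPrime :=
  have := hx.isLocalRing_quotient t
  (Ideal.Quotient.isDomain_iff_prime _).mp (hx.quotient t).isDomain

theorem notMem_span_image (hx : IsRegularSystem x) {t : Set ι} {i : ι} (hi : i ∉ t) :
    x i ∉ Ideal.span (x '' t) := by
  intro hmem
  have := hx.isLocalRing_quotient t
  have := hx.isLocalRing_quotient (insert i t)
  have hspan : Ideal.span (x '' insert i t) = Ideal.span (x '' t) := by
    rw [Set.image_insert_eq]
    exact Submodule.span_insert_eq_span hmem
  have hdim := (hx.quotient t).ringKrullDim_eq.symm.trans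
    ((ringKrullDim_eq_of_ringEquiv (Ideal.quotEquivOfEq hspan)).symm.trans
      (hx.quotient (insert i t)).ringKrullDim_eq)
  have hlt : (insert i t)ᶜ.ncard < tᶜ.ncard :=
    Set.ncard_lt_ncard (compl_lt_compl_iff_lt.mpr (Set.ssubset_insert hi))
  exact hlt.ne' (by exact_mod_cast hdim)

theorem exists_mem_notMem_maximalIdeal_sq [Nonempty ι] (hx : IsRegularSystem x) :
    ∃ a ∈ maximalIdeal A, a ∉ maximalIdeal A ^ 2 := by
  by_contra! hsq
  obtain ⟨i⟩ := ‹Nonempty ι›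
  have hbot : maximalIdeal A = ⊥ := Submodule.eq_bot_of_le_smul_of_le_jacobson_bot _ _
    (maximalIdeal A).fg_of_isNoetherianRing (fun a ha ↦ (sq (maximalIdeal A)).le (hsq a ha))
    (jacobson_eq_maximalIdeal _ bot_ne_top).ge
  refine hx.notMem_span_image (Set.notMem_empty i) ?_
  rw [Set.image_empty, Ideal.span_empty, ← hbot]
  exact hx.mem_maximalIdeal i

end IsRegularSystem

end RegularSystem

section OrderOfVanishing

open IsLocalRing WithZero

theorem sup_span_singleton_pow_succ_le {A : Type*} [CommRing A] (J : Ideal A) (y : A) (k : ℕ) :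
    (J ⊔ Ideal.span {y}) ^ (k + 1) ≤ J ^ (k + 1) ⊔ Ideal.span {y} * (J ⊔ Ideal.span {y}) ^ k := by
  induction k with
  | zero => simp
  | succ k ih =>
    rw [pow_succ _ (k + 1), Ideal.mul_sup]
    refine sup_le ((Ideal.mul_mono_left ih).trans ?_) ?_
    · rw [Ideal.sup_mul, ← pow_succ, mul_assoc]
      refine sup_le_sup_left (Ideal.mul_mono_right ?_) _
      exact (Ideal.mul_mono_right le_sup_left).trans_eq (pow_succ _ k).symm
    · exact (mul_comm _ _).le.trans le_sup_right

theorem mem_sup_pow_sup_of_mul_mem {A : Type*} [CommRing A] {J L : Ideal A} {y c : A} {k : ℕ}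
    (hreg : ∀ a, y * a ∈ J ^ (k + 1) ⊔ L → a ∈ J ^ (k + 1) ⊔ L)
    (hc : y * c ∈ (J ⊔ Ideal.span {y}) ^ (k + 1) ⊔ L) : c ∈ (J ⊔ Ideal.span {y}) ^ k ⊔ L := by
  obtain ⟨_, hb, d, hd, hsum⟩ := Submodule.mem_sup.mp hc
  obtain ⟨b, hJ, _, hc', rfl⟩ :=
    Submodule.mem_sup.mp (sup_span_singleton_pow_succ_le J y k hb)
  obtain ⟨c', hk, rfl⟩ := Ideal.mem_span_singleton_mul.mp hc'
  have hdiff : c - c' ∈ J ^ (k + 1) ⊔ L := hreg _ <| by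
    rw [show y * (c - c') = b + d by linear_combination -hsum]
    exact Submodule.add_mem_sup hJ hd
  rw [← sub_add_cancel c c']
  refine add_mem (sup_le_sup_right ?_ L hdiff) (Submodule.mem_sup_left hk)
  exact (Ideal.pow_le_pow_right k.le_succ).trans (Ideal.pow_right_mono le_sup_left k)

theorem mem_pow_succ_sup_of_mul_mem {A : Type*} [CommRing A] {J L : Ideal A} {y r a : A} {k : ℕ}
    (hy : ∀ c, y * c ∈ (J ⊔ Ideal.span {y}) ^ (k + 1) ⊔ L → c ∈ (J ⊔ Ideal.span {y}) ^ k ⊔ L)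
    (hr : ∀ c, r * c ∈ (J ⊔ Ideal.span {y}) ^ k ⊔ L → c ∈ (J ⊔ Ideal.span {y}) ^ k ⊔ L)
    (ha : a ∈ J ^ (k + 1) ⊔ (L ⊔ Ideal.span {y}))
    (hra : r * a ∈ (J ⊔ Ideal.span {y}) ^ (k + 1) ⊔ L) :
    a ∈ (J ⊔ Ideal.span {y}) ^ (k + 1) ⊔ L := by
  obtain ⟨b, hb, _, hd, rfl⟩ := Submodule.mem_sup.mp ha
  obtain ⟨d, hdL, _, hc, rfl⟩ := Submodule.mem_sup.mp hd
  obtain ⟨c, rfl⟩ := Ideal.mem_span_singleton.mp hc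
  have hbd : b + d ∈ (J ⊔ Ideal.span {y}) ^ (k + 1) ⊔ L :=
    Submodule.add_mem_sup (Ideal.pow_right_mono le_sup_left _ hb) hdL
  have hc : c ∈ (J ⊔ Ideal.span {y}) ^ k ⊔ L := hr _ <| hy _ <| by
    rw [show y * (r * c) = r * (b + (d + y * c)) - r * (b + d) by ring]
    exact sub_mem hra (Ideal.mul_mem_left _ _ hbd)
  obtain ⟨c₁, hc₁, c₂, hc₂, rfl⟩ := Submodule.mem_sup.mp hc
  rw [show b + (d + y * (c₁ + c₂)) = b + d + (y * c₁ + y * c₂) by ring]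
  refine add_mem hbd (Submodule.add_mem_sup ?_ (Ideal.mul_mem_left _ _ hc₂))
  rw [pow_succ']
  exact Ideal.mul_mem_mul (Submodule.mem_sup_right (Ideal.mem_span_singleton_self _)) hc₁

theorem mul_mem_pow_add_sup {A : Type*} [CommRing A] {I L : Ideal A} {i j : ℕ} {a b : A}
    (ha : a ∈ I ^ i ⊔ L) (hb : b ∈ I ^ j ⊔ L) : a * b ∈ I ^ (i + j) ⊔ L := by
  obtain ⟨a, haI, c, hc, rfl⟩ := Submodule.mem_sup.mp ha
  rw [add_mul]
  refine add_mem ?_ (Submodule.mem_sup_right (L.mul_mem_right b hc))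
  obtain ⟨b, hbI, d, hd, rfl⟩ := Submodule.mem_sup.mp hb
  rw [mul_add, pow_add]
  exact Submodule.add_mem_sup (Ideal.mul_mem_mul haI hbI) (L.mul_mem_left a hd)

theorem sup_pow_sup_right {A : Type*} [CommRing A] (I L : Ideal A) (k : ℕ) :
    (I ⊔ L) ^ k ⊔ L = I ^ k ⊔ L := by
  refine le_antisymm (sup_le ?_ le_sup_right)
    (sup_le_sup_right (Ideal.pow_right_mono (le_sup_left : I ≤ I ⊔ L) k) L)
  induction k with
  | zero => simp
  | succ k ih =>
    rw [pow_succ]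
    exact Ideal.mul_le.mpr fun a ha b hb ↦ mul_mem_pow_add_sup (ih ha) (by rwa [pow_one])

namespace IsRegularSystem

variable {A ι : Type*} [CommRing A] [IsLocalRing A] [IsNoetherianRing A] [Finite ι] {x : ι → A}

theorem mem_pow_sup_of_mul_mem (hx : IsRegularSystem x) {t u : Set ι} (htu : Disjoint t u) {i : ι}
    (hit : i ∉ t) (hiu : i ∉ u) {k : ℕ} {a : A}
    (ha : x i * a ∈ Ideal.span (x '' t) ^ k ⊔ Ideal.span (x '' u)) :
    a ∈ Ideal.span (x '' t) ^ k ⊔ Ideal.span (x '' u) := by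
  induction t, t.toFinite using Set.Finite.induction_on generalizing u i k a with
  | empty =>
    cases k with
    | zero => simp
    | succ k =>
      rw [Set.image_empty, Ideal.span_empty, Ideal.bot_pow k.succ_ne_zero, bot_sup_eq] at ha ⊢
      exact ((hx.isPrime_span_image u).mem_or_mem ha).resolve_left (hx.notMem_span_image hiu)
  | @insert j t hjt _ ih =>
    obtain ⟨hju, htu⟩ := Set.disjoint_insert_left.mp htu
    have hij : i ≠ j := fun h ↦ hit (h ▸ Set.mem_insert _ _)
    have hit : i ∉ t := fun h ↦ hit (Set.mem_insert_of_mem _ h)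
    set J := Ideal.span (x '' t) with hJ
    set L := Ideal.span (x '' u) with hL
    have hins : ∀ s : Set ι, Ideal.span (x '' insert j s) =
        Ideal.span (x '' s) ⊔ Ideal.span {x j} := fun s ↦ by
      rw [Set.image_insert_eq, Ideal.span_insert, sup_comm]
    rw [hins, ← hJ] at ha ⊢
    induction k generalizing a with
    | zero => simp
    | succ k ihk =>
      have hcancel : ∀ c, x j * c ∈ (J ⊔ Ideal.span {x j}) ^ (k + 1) ⊔ L →
          c ∈ (J ⊔ Ideal.span {x j}) ^ k ⊔ L := fun c ↦
        mem_sup_pow_sup_of_mul_mem fun a ↦ ih htu hjt hju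
      have hmod : a ∈ J ^ (k + 1) ⊔ Ideal.span (x '' insert j u) := by
        refine ih (Set.disjoint_insert_right.mpr ⟨hjt, htu⟩) hit
          (by simp [hij, hiu]) ?_
        rw [hins, ← hL, sup_comm L, ← sup_assoc]
        refine sup_le_sup_right ?_ L ha
        exact (sup_span_singleton_pow_succ_le J _ k).trans (sup_le_sup_left Ideal.mul_le_left _)
      rw [hins, ← hL] at hmod
      exact mem_pow_succ_sup_of_mul_mem hcancel (fun c ↦ ihk) hmod ha

theorem mem_maximalIdeal_pow_sup_of_mul_mem (hx : IsRegularSystem x) {u : Set ι} {i : ι}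
    (hi : i ∉ u) {k : ℕ} {c : A}
    (hc : x i * c ∈ maximalIdeal A ^ (k + 1) ⊔ Ideal.span (x '' u)) :
    c ∈ maximalIdeal A ^ k ⊔ Ideal.span (x '' u) := by
  set J := Ideal.span (x '' (insert i u)ᶜ)
  set L := Ideal.span (x '' u)
  have hm : maximalIdeal A = J ⊔ Ideal.span {x i} ⊔ L := by
    rw [sup_assoc, ← hx.span_range, ← Set.image_univ, ← Set.compl_union_self (insert i u),
      Set.image_union, Ideal.span_union, Set.image_insert_eq, Ideal.span_insert]
  rw [hm, sup_pow_sup_right] at hc ⊢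
  refine mem_sup_pow_sup_of_mul_mem (fun a ha ↦ hx.mem_pow_sup_of_mul_mem ?_ ?_ hi ha) hc
  · exact Set.disjoint_left.mpr fun j hj hju ↦ hj (Set.mem_insert_of_mem _ hju)
  · exact fun h ↦ h (Set.mem_insert _ _)

theorem mem_pow_succ_sup_or_of_insert (hx : IsRegularSystem x) {u : Set ι} {l : ι} (hl : l ∉ u)
    {i j : ℕ} {a b : A}
    (ih : ∀ i' < i, ∀ c ∈ maximalIdeal A ^ i' ⊔ Ideal.span (x '' u),
      c * b ∈ maximalIdeal A ^ (i' + j + 1) ⊔ Ideal.span (x '' u) →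
        c ∈ maximalIdeal A ^ (i' + 1) ⊔ Ideal.span (x '' u) ∨
          b ∈ maximalIdeal A ^ (j + 1) ⊔ Ideal.span (x '' u))
    (ha : a ∈ maximalIdeal A ^ i ⊔ Ideal.span (x '' u))
    (hb : b ∈ maximalIdeal A ^ j ⊔ Ideal.span (x '' u))
    (hab : a * b ∈ maximalIdeal A ^ (i + j + 1) ⊔ Ideal.span (x '' u))
    (hal : a ∈ maximalIdeal A ^ (i + 1) ⊔ Ideal.span (x '' insert l u)) :
    a ∈ maximalIdeal A ^ (i + 1) ⊔ Ideal.span (x '' u) ∨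
      b ∈ maximalIdeal A ^ (j + 1) ⊔ Ideal.span (x '' u) := by
  set L := Ideal.span (x '' u)
  rw [Set.image_insert_eq, Ideal.span_insert, sup_comm (Ideal.span {x l}), ← sup_assoc] at hal
  obtain ⟨a', ha', _, hc, rfl⟩ := Submodule.mem_sup.mp hal
  obtain ⟨c, rfl⟩ := Ideal.mem_span_singleton.mp hc
  cases i with
  | zero =>
    refine .inl (add_mem ha' (Submodule.mem_sup_left ?_))
    simpa using Ideal.mul_mem_right c _ (hx.mem_maximalIdeal l)
  | succ i =>
    have hc : c ∈ maximalIdeal A ^ i ⊔ L := hx.mem_maximalIdeal_pow_sup_of_mul_mem hl <| by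
      rw [← add_sub_cancel_left a' (x l * c)]
      exact sub_mem ha (sup_le_sup_right (Ideal.pow_le_pow_right (Nat.le_succ _)) L ha')
    have ha'b : a' * b ∈ maximalIdeal A ^ (i + 1 + j + 1) ⊔ L := by
      rw [add_right_comm]
      exact mul_mem_pow_add_sup ha' hb
    have hcb : c * b ∈ maximalIdeal A ^ (i + j + 1) ⊔ L :=
      hx.mem_maximalIdeal_pow_sup_of_mul_mem hl <| by
        rw [show i + j + 1 + 1 = i + 1 + j + 1 by ring,
          show x l * (c * b) = (a' + x l * c) * b - a' * b by ring]
        exact sub_mem hab ha'b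
    refine (ih i i.lt_succ_self c hc hcb).imp_left fun hc ↦ add_mem ha' ?_
    rw [add_comm]
    exact mul_mem_pow_add_sup (Submodule.mem_sup_left (by simpa using hx.mem_maximalIdeal l)) hc

theorem mem_pow_succ_sup_or_of_mul_mem (hx : IsRegularSystem x) (u : Set ι) {i j : ℕ} {a b : A}
    (ha : a ∈ maximalIdeal A ^ i ⊔ Ideal.span (x '' u))
    (hb : b ∈ maximalIdeal A ^ j ⊔ Ideal.span (x '' u))
    (hab : a * b ∈ maximalIdeal A ^ (i + j + 1) ⊔ Ideal.span (x '' u)) :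
    a ∈ maximalIdeal A ^ (i + 1) ⊔ Ideal.span (x '' u) ∨
      b ∈ maximalIdeal A ^ (j + 1) ⊔ Ideal.span (x '' u) := by
  induction hn : uᶜ.ncard generalizing u i j a b with
  | zero =>
    have hu : Ideal.span (x '' u) = maximalIdeal A := by
      rw [compl_eq_bot.mp ((Set.ncard_eq_zero).mp hn), Set.top_eq_univ, Set.image_univ,
        hx.span_range]
    have hm : ∀ k, maximalIdeal A ^ (k + 1) ⊔ Ideal.span (x '' u) = maximalIdeal A := fun k ↦ by
      rw [hu, sup_eq_right]
      exact Ideal.pow_le_self k.succ_ne_zero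
    rw [hm] at hab
    rw [hm, hm]
    exact Ideal.IsPrime.mem_or_mem inferInstance hab
  | succ n ihn =>
    obtain ⟨l, hl⟩ : uᶜ.Nonempty := Set.nonempty_of_ncard_ne_zero (hn ▸ n.succ_ne_zero)
    have hmono : Ideal.span (x '' u) ≤ Ideal.span (x '' insert l u) :=
      Ideal.span_mono (Set.image_mono (Set.subset_insert l u))
    have hcard : (insert l u)ᶜ.ncard = n := by
      rw [Set.ncard_compl] at hn ⊢
      rw [Set.ncard_insert_of_notMem hl]
      omega
    induction hij : i + j using Nat.strong_induction_on generalizing i j a b with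
    | _ s ihs =>
    rcases ihn (insert l u) (sup_le_sup_left hmono _ ha) (sup_le_sup_left hmono _ hb)
      (sup_le_sup_left hmono _ hab) hcard with hal | hbl
    · exact hx.mem_pow_succ_sup_or_of_insert hl
        (fun i' hi' c hc hcb ↦ ihs _ (by omega) hc hb hcb rfl) ha hb hab hal
    · rw [mul_comm, add_comm i] at hab
      exact (hx.mem_pow_succ_sup_or_of_insert hl
        (fun j' hj' c hc hca ↦ ihs _ (by omega) hc ha hca rfl) hb ha hab hbl).symm

end IsRegularSystem

theorem exists_mem_pow_notMem_pow_succ {A : Type*} [CommRing A] [IsLocalRing A]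
    [IsNoetherianRing A] {y : A} (hy : y ≠ 0) :
    ∃ i, y ∈ maximalIdeal A ^ i ∧ y ∉ maximalIdeal A ^ (i + 1) := by
  by_contra! h
  have hmem : ∀ i, y ∈ maximalIdeal A ^ i := Nat.rec (by simp) h
  refine hy ((Submodule.mem_bot A).mp ?_)
  rw [← Ideal.iInf_pow_eq_bot_of_isLocalRing _ (maximalIdeal.isMaximal A).ne_top]
  exact Submodule.mem_iInf _ |>.mpr hmem

open Classical in
/-- The order of vanishing of `y` at the closed point, in multiplicative notation: `exp (-i)` if
`y` lies in the `i`-th but not in the next power of the maximal ideal, and `0` if there is no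
such `i`. -/
def expNegOrder {A : Type*} [CommRing A] [IsLocalRing A] (y : A) : ℤᵐ⁰ :=
  if h : ∃ i : ℕ, y ∈ maximalIdeal A ^ i ∧ y ∉ maximalIdeal A ^ (i + 1) then exp (-(h.choose : ℤ))
  else 0

section ExpNegOrder

variable {A : Type*} [CommRing A] [IsLocalRing A]

theorem expNegOrder_eq {y : A} {i : ℕ} (hi : y ∈ maximalIdeal A ^ i)
    (hi' : y ∉ maximalIdeal A ^ (i + 1)) : expNegOrder y = exp (-(i : ℤ)) := by
  have h : ∃ i : ℕ, y ∈ maximalIdeal A ^ i ∧ y ∉ maximalIdeal A ^ (i + 1) := ⟨i, hi, hi'⟩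
  obtain ⟨hj, hj'⟩ := h.choose_spec
  rw [expNegOrder, dif_pos h]
  congr 3
  exact le_antisymm (not_lt.mp fun hlt ↦ hi' (Ideal.pow_le_pow_right hlt hj))
    (not_lt.mp fun hlt ↦ hj' (Ideal.pow_le_pow_right hlt hi))

theorem expNegOrder_zero : expNegOrder (0 : A) = 0 := by simp [expNegOrder]

theorem expNegOrder_one : expNegOrder (1 : A) = 1 := by
  rw [expNegOrder_eq (i := 0) (by simp) (by simp)]
  simp

variable [IsNoetherianRing A]

theorem expNegOrder_le_iff {y : A} {i : ℕ} :
    expNegOrder y ≤ exp (-(i : ℤ)) ↔ y ∈ maximalIdeal A ^ i := by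
  rcases eq_or_ne y 0 with rfl | hy
  · simp [expNegOrder_zero]
  obtain ⟨j, hj, hj'⟩ := exists_mem_pow_notMem_pow_succ hy
  rw [expNegOrder_eq hj hj', exp_le_exp, neg_le_neg_iff, Nat.cast_le]
  exact ⟨fun hij ↦ Ideal.pow_le_pow_right hij hj, fun hi ↦ not_lt.mp fun hlt ↦
    hj' (Ideal.pow_le_pow_right hlt hi)⟩

theorem expNegOrder_add_le_max (a b : A) :
    expNegOrder (a + b) ≤ max (expNegOrder a) (expNegOrder b) := by
  rcases eq_or_ne a 0 with rfl | ha
  · simp [expNegOrder_zero]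
  rcases eq_or_ne b 0 with rfl | hb
  · simp [expNegOrder_zero]
  obtain ⟨i, hi, hi'⟩ := exists_mem_pow_notMem_pow_succ ha
  obtain ⟨j, hj, hj'⟩ := exists_mem_pow_notMem_pow_succ hb
  rw [expNegOrder_eq hi hi', expNegOrder_eq hj hj']
  rcases le_total i j with hij | hji
  · exact le_max_of_le_left (expNegOrder_le_iff.mpr
      (add_mem hi (Ideal.pow_le_pow_right hij hj)))
  · exact le_max_of_le_right (expNegOrder_le_iff.mpr
      (add_mem (Ideal.pow_le_pow_right hji hi) hj))

end ExpNegOrder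

/-- The valuation `v` extends, along `ψ`, the order of vanishing at the closed point of `Spec A`,
written multiplicatively (so that elements of `𝔪ⁱ` have value at most `exp (-i)`). -/
def ExtendsAdicOrder {A O : Type*} [CommRing A] [IsLocalRing A] [CommRing O] (ψ : A →+* O)
    (v : Valuation O ℤᵐ⁰) : Prop :=
  ∀ (a : A) (i : ℕ), v (ψ a) ≤ exp (-(i : ℤ)) ↔ a ∈ maximalIdeal A ^ i

namespace IsRegularSystem

variable {A ι : Type*} [CommRing A] [IsLocalRing A] [IsNoetherianRing A] [Finite ι] {x : ι → A}

theorem expNegOrder_mul (hx : IsRegularSystem x) (a b : A) :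
    expNegOrder (a * b) = expNegOrder a * expNegOrder b := by
  rcases eq_or_ne a 0 with rfl | ha
  · simp [expNegOrder_zero]
  rcases eq_or_ne b 0 with rfl | hb
  · simp [expNegOrder_zero]
  obtain ⟨i, hi, hi'⟩ := exists_mem_pow_notMem_pow_succ ha
  obtain ⟨j, hj, hj'⟩ := exists_mem_pow_notMem_pow_succ hb
  have hab : a * b ∈ maximalIdeal A ^ (i + j) := by
    rw [pow_add]
    exact Ideal.mul_mem_mul hi hj
  have hab' : a * b ∉ maximalIdeal A ^ (i + j + 1) := fun h ↦ by
    have := hx.mem_pow_succ_sup_or_of_mul_mem ∅ (i := i) (j := j) (a := a) (b := b)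
    simp only [Set.image_empty, Ideal.span_empty, sup_bot_eq] at this
    exact (this hi hj h).elim hi' hj'
  rw [expNegOrder_eq hi hi', expNegOrder_eq hj hj', expNegOrder_eq hab hab', ← exp_add,
    Nat.cast_add, neg_add]

/-- The order of vanishing at the closed point of a regular local ring, as a valuation. -/
def orderValuation (hx : IsRegularSystem x) : Valuation A ℤᵐ⁰ where
  toFun := expNegOrder
  map_zero' := expNegOrder_zero
  map_one' := expNegOrder_one
  map_mul' := hx.expNegOrder_mul
  map_add_le_max' := expNegOrder_add_le_max

theorem exists_extendsAdicOrder (hx : IsRegularSystem x) (K : Type*) [Field K] [Algebra A K]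
    [IsFractionRing A K] : ∃ v : Valuation K ℤᵐ⁰, ExtendsAdicOrder (algebraMap A K) v := by
  have := hx.isDomain
  have hsupp : nonZeroDivisors A ≤ hx.orderValuation.supp.primeCompl := fun a ha ha0 ↦ by
    obtain ⟨i, hi, hi'⟩ := exists_mem_pow_notMem_pow_succ (nonZeroDivisors.ne_zero ha)
    exact exp_ne_zero ((expNegOrder_eq hi hi').symm.trans ha0)
  exact ⟨hx.orderValuation.extendToLocalization hsupp K, fun y i ↦ by
    rw [Valuation.extendToLocalization_apply_map_apply]
    exact expNegOrder_le_iff⟩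

end IsRegularSystem

end OrderOfVanishing

/-! ### Divisors on the punctured spectrum of a regular local ring -/

section FreeResolution

/-- `M` has a resolution of length `k` by finite free modules. -/
def HasFreeResolution (R : Type u) [CommRing R] :
    ℕ → ∀ (M : Type u) [AddCommGroup M] [Module R M], Prop
  | 0, M, _, _ => Module.Free R M ∧ Module.Finite R M
  | k + 1, M, _, _ => ∃ (n : ℕ) (f : (Fin n → R) →ₗ[R] M), Function.Surjective f ∧
      HasFreeResolution R k (LinearMap.ker f)

section QuotSMulTop

open Pointwise QuotSMulTop

variable {R : Type*} [CommRing R] {x : R} {P N : Type*} [AddCommGroup P] [Module R P]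
  [AddCommGroup N] [Module R N]

theorem exists_surjective_quotSMulTop_map_eq [Module.Projective R P] [Module.Finite R N]
    (hx : x ∈ (⊥ : Ideal R).jacobson) {f : QuotSMulTop x P →ₗ[R] QuotSMulTop x N}
    (hf : Function.Surjective f) :
    ∃ g : P →ₗ[R] N, Function.Surjective g ∧ QuotSMulTop.map x g = f := by
  obtain ⟨g, hg⟩ := Module.projective_lifting_property (Submodule.mkQ (x • ⊤ : Submodule R N))
    (f ∘ₗ Submodule.mkQ _) (Submodule.mkQ_surjective _)
  refine ⟨g, ?_, ?_⟩
  · refine g.surjective_of_surjective_comp_mkQ (Ideal.span {x}) (by simpa using hx) ?_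
    rw [Submodule.ideal_span_singleton_smul x ⊤, hg]
    exact hf.comp (Submodule.mkQ_surjective _)
  · exact Submodule.linearMap_qext _ ((map_comp_mkQ x g).trans hg)

open Function in
theorem nonempty_quotSMulTop_ker_equiv {g : P →ₗ[R] N} (hg : Surjective g)
    (hx : IsSMulRegular N x) :
    Nonempty (QuotSMulTop x (LinearMap.ker g) ≃ₗ[R] LinearMap.ker (QuotSMulTop.map x g)) := by
  have hzero : Exact (0 : Unit →ₗ[R] LinearMap.ker g) (LinearMap.ker g).subtype :=
    (LinearMap.exact_zero_iff_injective _ _).mpr Subtype.val_injective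
  have hinj : Injective (QuotSMulTop.map x (LinearMap.ker g).subtype) := by
    have h := map_first_exact_on_four_term_exact_of_isSMulRegular_last hzero
      g.exact_subtype_ker_map hx
    rwa [map_zero, LinearMap.exact_zero_iff_injective] at h
  exact ⟨(LinearEquiv.ofInjective _ hinj).trans (LinearEquiv.ofEq _ _
    (map_exact x g.exact_subtype_ker_map hg).linearMap_ker_eq.symm)⟩

end QuotSMulTop

namespace HasFreeResolution

variable {R : Type u} [CommRing R] {k : ℕ}

theorem congr {M N : Type u} [AddCommGroup M] [Module R M] [AddCommGroup N] [Module R N]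
    (e : M ≃ₗ[R] N) (h : HasFreeResolution R k M) : HasFreeResolution R k N := by
  cases k with
  | zero =>
    obtain ⟨_, _⟩ := h
    exact ⟨.of_equiv e, .equiv e⟩
  | succ k =>
    obtain ⟨n, f, hf, h⟩ := h
    refine ⟨n, e.toLinearMap ∘ₗ f, e.surjective.comp hf, ?_⟩
    rwa [LinearEquiv.ker_comp]

theorem of_quotSMulTop [IsNoetherianRing R] {x : R} (hx : x ∈ (⊥ : Ideal R).jacobson)
    (hxR : IsSMulRegular R x) {N : Type u} [AddCommGroup N] [Module R N] [Module.Finite R N]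
    (hxN : IsSMulRegular N x)
    (h : HasFreeResolution (R ⧸ Ideal.span {x}) k (QuotSMulTop x N)) :
    HasFreeResolution R k N := by
  induction k generalizing N with
  | zero =>
    have : Module.FinitePresentation R N := Module.finitePresentation_of_finite R N
    exact ⟨(Module.free_quotSMulTop_iff_free R N hx hxN).mp h.1, inferInstance⟩
  | succ k ih =>
    obtain ⟨n, f, hf, h⟩ := h
    let e : QuotSMulTop x (Fin n → R) ≃ₗ[R] (Fin n → R ⧸ Ideal.span {x}) :=
      (QuotSMulTop.equivQuotTensor x _).trans (TensorProduct.piScalarRight R R _ _)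
    obtain ⟨g, hg, hgf⟩ := exists_surjective_quotSMulTop_map_eq hx
      (f := f.restrictScalars R ∘ₗ e.toLinearMap) (hf.comp e.surjective)
    obtain ⟨ρ⟩ := nonempty_quotSMulTop_ker_equiv hg hxN
    let e' : QuotSMulTop x (LinearMap.ker g) ≃ₗ[R] LinearMap.ker f :=
      ρ.trans (e.ofSubmodules _ (LinearMap.ker (f.restrictScalars R)) (by
        rw [hgf, LinearMap.ker_comp]
        exact Submodule.map_comap_eq_of_surjective e.surjective _))
    refine ⟨n, g, hg, ih (fun v w hvw ↦ ?_)
      (h.congr (e'.extendScalarsOfSurjective Ideal.Quotient.mk_surjective).symm)⟩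
    exact Subtype.ext (funext fun i ↦ hxR (congrFun (congrArg Subtype.val hvw) i))

theorem localize {R' : Type u} [CommRing R'] [Algebra R R'] (S : Submonoid R)
    [IsLocalization S R'] {M N : Type u} [AddCommGroup M] [Module R M] [AddCommGroup N]
    [Module R N] [Module R' N] [IsScalarTower R R' N] (f : M →ₗ[R] N) [IsLocalizedModule S f]
    (h : HasFreeResolution R k M) : HasFreeResolution R' k N := by
  induction k generalizing M N with
  | zero =>
    obtain ⟨_, _⟩ := h
    exact ⟨Module.free_of_isLocalizedModule S f, .of_isLocalizedModule S f⟩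
  | succ k ih =>
    obtain ⟨n, φ, hφ, h⟩ := h
    let ι : (Fin n → R) →ₗ[R] (Fin n → R') :=
      LinearMap.pi fun i ↦ Algebra.linearMap R R' ∘ₗ LinearMap.proj i
    let ψ := IsLocalizedModule.mapExtendScalars S ι f R' φ
    let κ : LinearMap.ker φ →ₗ[R] LinearMap.ker ψ := LinearMap.toKerIsLocalized S ι f φ
    have : IsLocalizedModule S κ := LinearMap.toKerLocalized_isLocalizedModule R' S ι f φ
    exact ⟨n, ψ, IsLocalizedModule.map_surjective S ι f φ hφ, ih κ h⟩

theorem isStablyFree {M : Type u} [AddCommGroup M] [Module R M] [Module.Projective R M]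
    (h : HasFreeResolution R k M) : Module.IsStablyFree R M := by
  induction k generalizing M with
  | zero =>
    have := h.1
    infer_instance
  | succ k ih =>
    obtain ⟨n, f, hf, h⟩ := h
    obtain ⟨σ, hσ⟩ := Module.projective_lifting_property f LinearMap.id hf
    obtain ⟨e, -⟩ := f.exact_subtype_ker_map.splitSurjectiveEquiv Subtype.val_injective ⟨σ, hσ⟩
    have : Module.Projective R (LinearMap.ker f) :=
      .of_split (e.symm.toLinearMap ∘ₗ LinearMap.inl R _ M) (LinearMap.fst R _ M ∘ₗ e.toLinearMap)
        (by ext; simp)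
    have : Module.Finite R (LinearMap.ker f) :=
      .of_surjective (LinearMap.fst R _ M ∘ₗ e.toLinearMap)
        (Prod.fst_surjective.comp e.surjective)
    obtain ⟨N, _, _, _, _, _⟩ := (ih h).exist_free_prod
    have : Module.Free R (M × LinearMap.ker f × N) :=
      .of_equiv (((e.trans (.prodComm R _ M)).prodCongr (.refl R N)).trans (.prodAssoc R M _ N))
    exact .of_free_prod R M (LinearMap.ker f × N)

end HasFreeResolution

open IsLocalRing in
theorem IsRegularSystem.hasFreeResolution {A : Type u} {ι : Type*} [CommRing A] [IsLocalRing A]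
    [IsNoetherianRing A] [Finite ι] {x : ι → A} (hx : IsRegularSystem x)
    (M : Type u) [AddCommGroup M] [Module A M] [Module.Finite A M] :
    HasFreeResolution A (Nat.card ι) M := by
  induction hn : Nat.card ι generalizing A ι M with
  | zero =>
    have : IsEmpty ι := Finite.card_eq_zero_iff.mp hn
    have hm : maximalIdeal A = ⊥ := by
      rw [← hx.span_range, Set.range_eq_empty, Ideal.span_empty]
    let : Field A := (isField_iff_maximalIdeal_eq.mpr hm).toField
    exact ⟨Module.Free.of_divisionRing A M, inferInstance⟩
  | succ n ih =>
    obtain ⟨i⟩ : Nonempty ι := (Nat.card_pos_iff.mp (hn ▸ n.succ_pos)).1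
    have := hx.isDomain
    have := hx.isLocalRing_quotient {i}
    have hcard : Nat.card ({i}ᶜ : Set ι) = n := by
      rw [Nat.card_coe_set_eq, Set.ncard_compl, Set.ncard_singleton, hn, Nat.add_sub_cancel]
    have hreg : IsSMulRegular A (x i) := fun a b ↦ mul_left_cancel₀ fun h0 ↦
      hx.notMem_span_image (Set.notMem_empty i) (h0 ▸ zero_mem _)
    obtain ⟨k, f, hf⟩ := Module.Finite.exists_fin' A M
    have ih' : ∀ (N : Type u) [AddCommGroup N] [Module (A ⧸ Ideal.span (x '' {i})) N]
        [Module.Finite (A ⧸ Ideal.span (x '' {i})) N], HasFreeResolution _ n N := fun N ↦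
      ih (hx.quotient {i}) N hcard
    rw [Set.image_singleton] at ih'
    have : Module.Finite (A ⧸ Ideal.span {x i}) (QuotSMulTop (x i) (LinearMap.ker f)) :=
      .of_restrictScalars_finite A _ _
    refine ⟨k, f, hf, .of_quotSMulTop (x := x i) ?_ hreg (fun v w hvw ↦ ?_) (ih' _)⟩
    · exact jacobson_eq_maximalIdeal (⊥ : Ideal A) bot_ne_top ▸ hx.mem_maximalIdeal i
    · exact Subtype.ext (funext fun j ↦ hreg (congrFun (congrArg Subtype.val hvw) j))

end FreeResolution

section LocalSubalgebra

variable {A : Type*} (K : Type*) [CommRing A] [Field K] [Algebra A K]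

/-- The local ring of `Spec A` at `q`, as a subring of the fraction field `K` of `A`. -/
def localSubalgebra (q : PrimeSpectrum A) : Subalgebra A K where
  carrier := {h | ∃ s ∉ q.asIdeal, s • h ∈ (1 : Submodule A K)}
  algebraMap_mem' a := ⟨1, q.2.one_notMem, by simp [Submodule.mem_one]⟩
  add_mem' := by
    rintro h h' ⟨s, hs, hsh⟩ ⟨t, ht, hth⟩
    refine ⟨s * t, q.2.mul_notMem hs ht, ?_⟩
    rw [show (s * t) • (h + h') = t • s • h + s • t • h' by
      rw [smul_add, mul_smul, smul_comm, mul_smul]]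
    exact add_mem (Submodule.smul_mem _ _ hsh) (Submodule.smul_mem _ _ hth)
  mul_mem' := by
    rintro h h' ⟨s, hs, hsh⟩ ⟨t, ht, hth⟩
    exact ⟨s * t, q.2.mul_notMem hs ht, by
      rw [← smul_mul_smul_comm, ← one_mul (1 : Submodule A K)]
      exact Submodule.mul_mem_mul hsh hth⟩

/-- The units of the local ring of `Spec A` at `q`, as a subgroup of `Kˣ`. -/
abbrev localUnits (q : PrimeSpectrum A) : Subgroup Kˣ :=
  (localSubalgebra K q).toSubmonoid.units

variable {K} {q q' : PrimeSpectrum A}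

theorem mem_localSubalgebra_of_smul_mem {s : A} (hs : s ∉ q.asIdeal) {h : K}
    (hh : s • h ∈ localSubalgebra K q) : h ∈ localSubalgebra K q := by
  obtain ⟨t, ht, e⟩ := hh
  exact ⟨t * s, q.2.mul_notMem ht hs, by rwa [mul_smul]⟩

theorem localSubalgebra_mono (h : q' ≤ q) : localSubalgebra K q ≤ localSubalgebra K q' :=
  fun _ ⟨s, hs, e⟩ ↦ ⟨s, fun hs' ↦ hs (h hs'), e⟩

theorem localUnits_mono (h : q' ≤ q) : localUnits K q ≤ localUnits K q' :=
  Submonoid.units_mono (localSubalgebra_mono h)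

theorem units_mem_localUnits {s : A} (hs : s ∉ q.asIdeal) {u : Kˣ} (hu : algebraMap A K s = u) :
    u ∈ localUnits K q :=
  ⟨show u.1 ∈ _ from hu ▸ (localSubalgebra K q).algebraMap_mem s,
    mem_localSubalgebra_of_smul_mem hs (by simp [Algebra.smul_def, hu])⟩

theorem mul_mem_localSubalgebra_iff {h : K} {u : Kˣ} (hu : u ∈ localUnits K q) :
    h * u ∈ localSubalgebra K q ↔ h ∈ localSubalgebra K q :=
  ⟨fun hh ↦ by simpa using mul_mem hh hu.2, fun hh ↦ mul_mem hh hu.1⟩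

theorem exists_smul_mem_of_forall_prime {M : Type*} [AddCommGroup M] [Module A M]
    (P : Submodule A M) (S : Submonoid A) (m : M)
    (H : ∀ q : PrimeSpectrum A, Disjoint (q.asIdeal : Set A) S → ∃ s ∉ q.asIdeal, s • m ∈ P) :
    ∃ t ∈ S, t • m ∈ P := by
  by_contra! hcon
  obtain ⟨q, hq, hle, hqS⟩ := Ideal.exists_le_prime_disjoint
    (P.comap (LinearMap.toSpanSingleton A M m)) S (Set.disjoint_right.mpr hcon)
  obtain ⟨s, hs, hm⟩ := H ⟨q, hq⟩ hqS
  exact hs (hle hm)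

theorem exists_pow_smul_mem_of_forall_prime {M : Type*} [AddCommGroup M] [Module A M]
    (P : Submodule A M) (x : A) (m : M)
    (H : ∀ q : PrimeSpectrum A, x ∉ q.asIdeal → ∃ s ∉ q.asIdeal, s • m ∈ P) :
    ∃ N, x ^ N • m ∈ P := by
  obtain ⟨_, ⟨N, rfl⟩, hN⟩ := exists_smul_mem_of_forall_prime P (Submonoid.powers x) m
    fun q hq ↦ H q fun hx ↦ Set.disjoint_left.mp hq hx (Submonoid.mem_powers x)
  exact ⟨N, hN⟩

end LocalSubalgebra

section CartierOn

variable {A K : Type*} [CommRing A] [Field K] [Algebra A K] {U : Set (PrimeSpectrum A)}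
  {g : PrimeSpectrum A → Kˣ}

/-- The family `g` consists of local equations, at the points of `U`, of a Cartier divisor on the
subspace `U` of `Spec A`. -/
def IsCartierOn (U : Set (PrimeSpectrum A)) (g : PrimeSpectrum A → Kˣ) : Prop :=
  ∀ q ∈ U, ∃ s ∉ q.asIdeal, ∀ q' ∈ U, s ∉ q'.asIdeal → g q / g q' ∈ localUnits K q'

namespace IsCartierOn

theorem mono {V : Set (PrimeSpectrum A)} (hg : IsCartierOn U g) (h : V ⊆ U) : IsCartierOn V g :=
  fun q hq ↦ (hg q (h hq)).imp fun _ hs ↦ ⟨hs.1, fun q' hq' ↦ hs.2 q' (h hq')⟩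

theorem inv (hg : IsCartierOn U g) : IsCartierOn U g⁻¹ :=
  fun q hq ↦ (hg q hq).imp fun s hs ↦ ⟨hs.1, fun q' hq' hsq' ↦ by
    simpa [div_eq_mul_inv, mul_comm] using inv_mem (hs.2 q' hq' hsq')⟩

theorem div_mem_of_le (hg : IsCartierOn U g) {q q' : PrimeSpectrum A} (hq : q ∈ U) (hq' : q' ∈ U)
    (hle : q' ≤ q) : g q / g q' ∈ localUnits K q' :=
  let ⟨_, hs, h⟩ := hg q hq
  h q' hq' fun hs' ↦ hs (hle hs')

theorem mul_mem_iff {q q' : PrimeSpectrum A} (h : g q / g q' ∈ localUnits K q') (k : K) :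
    k * g q ∈ localSubalgebra K q' ↔ k * g q' ∈ localSubalgebra K q' := by
  rw [← mul_mem_localSubalgebra_iff (h := k * g q') h, mul_assoc, ← Units.val_mul,
    mul_div_cancel]

variable {x : A}

open PrimeSpectrum

theorem exists_pow_smul_mul_mem_near (hg : IsCartierOn (basicOpen x) g) {k : K} {s : A}
    (hk : ∀ q ∈ basicOpen x, s ∉ q.asIdeal → k * g q ∈ localSubalgebra K q)
    {q : PrimeSpectrum A} (hq : q ∈ basicOpen x) :
    ∃ N, ∃ t ∉ q.asIdeal, ∀ q' ∈ basicOpen x, t ∉ q'.asIdeal →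
      s ^ N • k * g q' ∈ localSubalgebra K q' := by
  obtain ⟨t, ht, h⟩ := hg q hq
  obtain ⟨N, hN⟩ := exists_pow_smul_mem_of_forall_prime (1 : Submodule A K) (s * (x * t))
    (k * g q) fun q' hq' ↦ by
      have hx : q' ∈ basicOpen x := fun hx ↦ hq' (Ideal.mul_mem_left _ _
        (Ideal.mul_mem_right _ _ hx))
      have ht : t ∉ q'.asIdeal := fun ht ↦ hq' (Ideal.mul_mem_left _ _
        (Ideal.mul_mem_left _ _ ht))
      exact (mul_mem_iff (h q' hx ht) k).mpr (hk q' hx fun hs ↦ hq' (Ideal.mul_mem_right _ _ hs))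
  refine ⟨N, t, ht, fun q' hx ht ↦ (mul_mem_iff (h q' hx ht) _).mp ?_⟩
  refine mem_localSubalgebra_of_smul_mem (s := (x * t) ^ N)
    (fun h ↦ q'.2.mul_notMem hx ht (q'.2.mem_of_pow_mem N h)) ⟨1, q'.2.one_notMem, ?_⟩
  rwa [one_smul, smul_mul_assoc, smul_smul, mul_comm, ← mul_pow]

theorem exists_pow_smul_mul_mem (hg : IsCartierOn (basicOpen x) g) {k : K} {s : A}
    (hk : ∀ q ∈ basicOpen x, s ∉ q.asIdeal → k * g q ∈ localSubalgebra K q) :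
    ∃ N, ∀ q ∈ basicOpen x, s ^ N • k * g q ∈ localSubalgebra K q := by
  choose! N t ht h using fun q hq ↦ hg.exists_pow_smul_mul_mem_near hk (q := q) hq
  obtain ⟨T, hT⟩ := (isCompact_basicOpen x).elim_finite_subcover
    (fun q : basicOpen x ↦ (basicOpen (t q) : Set (PrimeSpectrum A)))
    (fun q ↦ (basicOpen _).isOpen) (fun q hq ↦ Set.mem_iUnion.mpr ⟨⟨q, hq⟩, ht q hq⟩)
  refine ⟨T.sup fun q ↦ N q, fun q hq ↦ ?_⟩
  obtain ⟨p, hp, hpq⟩ : ∃ p ∈ T, t p ∉ q.asIdeal := by simpa using hT hq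
  rw [← Nat.sub_add_cancel (Finset.le_sup (f := fun q : basicOpen x ↦ N q) hp), pow_add, mul_smul,
    smul_mul_assoc]
  exact (localSubalgebra K q).smul_mem (h p p.2 q hq hpq) _

theorem exists_smul_inv_mul_mem (hg : IsCartierOn (basicOpen x) g) {q : PrimeSpectrum A}
    (hq : q ∈ basicOpen x) :
    ∃ s ∉ q.asIdeal, ∀ q' ∈ basicOpen x,
      s • ((g q)⁻¹ : Kˣ).val * g q' ∈ localSubalgebra K q' := by
  obtain ⟨s, hs, h⟩ := hg q hq
  obtain ⟨N, hN⟩ := hg.exists_pow_smul_mul_mem (k := ((g q)⁻¹ : Kˣ).val) (s := s)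
    fun q' hq' hs' ↦ by simpa [div_eq_mul_inv, mul_comm] using (h q' hq' hs').2
  exact ⟨s ^ N, fun h ↦ hs (q.2.mem_of_pow_mem N h), hN⟩

end IsCartierOn

end CartierOn

section Sections

open PrimeSpectrum

variable {A K : Type*} [CommRing A] [Field K] [Algebra A K] {x : A} {B : Type*} [CommRing B]
  [Algebra A B] [Algebra B K] [IsScalarTower A B K] [IsLocalization.Away x B]

theorem algebraMap_mem_localSubalgebra (b : B) {q : PrimeSpectrum A} (hq : q ∈ basicOpen x) :
    algebraMap B K b ∈ localSubalgebra K q := by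
  obtain ⟨N, a, h⟩ := IsLocalization.Away.surj x b
  refine ⟨x ^ N, fun h ↦ hq (q.2.mem_of_pow_mem N h), Submodule.mem_one.mpr ⟨a, ?_⟩⟩
  rw [IsScalarTower.algebraMap_apply A B K, ← h, Algebra.smul_def, map_mul,
    IsScalarTower.algebraMap_apply A B K, map_pow (algebraMap A B), mul_comm]

theorem mem_of_pow_smul_mem (P : Submodule B K) {k : K} {N : ℕ}
    (h : x ^ N • k ∈ P.restrictScalars A) : k ∈ P := by
  rw [Submodule.restrictScalars_mem, ← algebraMap_smul B, map_pow] at h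
  exact (Submodule.smul_mem_iff_of_isUnit P
    ((IsLocalization.Away.algebraMap_isUnit x).pow N)).mp h

theorem mem_one_iff_forall_mem_localSubalgebra {k : K} :
    k ∈ (1 : Submodule B K) ↔ ∀ q ∈ basicOpen x, k ∈ localSubalgebra K q := by
  refine ⟨?_, fun h ↦ ?_⟩
  · rw [Submodule.mem_one]
    rintro ⟨b, rfl⟩ q hq
    exact algebraMap_mem_localSubalgebra b hq
  · obtain ⟨N, hN⟩ := exists_pow_smul_mem_of_forall_prime (1 : Submodule A K) x k h
    refine mem_of_pow_smul_mem (A := A) (x := x) (N := N) 1 ?_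
    obtain ⟨a, ha⟩ := Submodule.mem_one.mp hN
    exact Submodule.mem_one.mpr ⟨algebraMap A B a, by
      rw [← IsScalarTower.algebraMap_apply, ha]⟩

variable (x B) in
/-- The sections over the basic open set `D(x)` of the sheaf of a Cartier divisor with local
equations `g`, as a module over `B = A[1/x]`. -/
def cartierSections (g : PrimeSpectrum A → Kˣ) : Submodule B K where
  carrier := {k | ∀ q ∈ basicOpen x, k * g q ∈ localSubalgebra K q}
  zero_mem' q _ := by rw [zero_mul]; exact zero_mem _
  add_mem' ha hb q hq := by rw [add_mul]; exact add_mem (ha q hq) (hb q hq)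
  smul_mem' b k hk q hq := by
    rw [Algebra.smul_def, mul_assoc]
    exact mul_mem (algebraMap_mem_localSubalgebra b hq) (hk q hq)

theorem IsCartierOn.cartierSections_mul_cartierSections_inv {g : PrimeSpectrum A → Kˣ}
    (hg : IsCartierOn (basicOpen x) g) :
    cartierSections x B g * cartierSections x B g⁻¹ = 1 := by
  refine le_antisymm (Submodule.mul_le.mpr fun k hk l hl ↦ ?_) (Submodule.one_le.mpr ?_)
  · refine (mem_one_iff_forall_mem_localSubalgebra (x := x)).mpr fun q hq ↦ ?_
    simpa [mul_mul_mul_comm] using mul_mem (hk q hq) (hl q hq)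
  · obtain ⟨N, hN⟩ := exists_pow_smul_mem_of_forall_prime
      ((cartierSections x B g * cartierSections x B g⁻¹).restrictScalars A) x 1 fun q hq ↦ by
        obtain ⟨s, hs, h⟩ := hg.exists_smul_inv_mul_mem hq
        obtain ⟨t, ht, h'⟩ := hg.inv.exists_smul_inv_mul_mem hq
        refine ⟨s * t, q.2.mul_notMem hs ht, ?_⟩
        simpa [mul_comm s t, mul_smul] using Submodule.mul_mem_mul
          (M := cartierSections x B g) (N := cartierSections x B g⁻¹) h h'
    exact mem_of_pow_smul_mem _ hN

theorem IsCartierOn.mul_mem_localUnits_of_span_eq {g : PrimeSpectrum A → Kˣ}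
    (hg : IsCartierOn (basicOpen x) g) {d : Kˣ} (hd : cartierSections x B g = B ∙ (d : K))
    {q : PrimeSpectrum A} (hq : q ∈ basicOpen x) : d * g q ∈ localUnits K q := by
  have hdJ : (d : K) ∈ cartierSections x B g := hd ▸ Submodule.mem_span_singleton_self _
  obtain ⟨s, hs, h⟩ := hg.exists_smul_inv_mul_mem hq
  obtain ⟨b, hb⟩ := Submodule.mem_span_singleton.mp
    (hd ▸ (show s • ((g q)⁻¹ : Kˣ).val ∈ cartierSections x B g from h))
  refine ⟨hdJ q hq, mem_localSubalgebra_of_smul_mem hs ?_⟩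
  have hsb : s • ((d * g q)⁻¹ : Kˣ).val = algebraMap B K b := by
    rw [mul_inv, Units.val_mul, mul_comm, ← smul_mul_assoc, ← hb, Algebra.smul_def, mul_assoc,
      Units.mul_inv, mul_one]
  exact hsb ▸ algebraMap_mem_localSubalgebra b hq

end Sections

section ComplementOfParameter

open PrimeSpectrum

theorem HasFreeResolution.of_isLocalization {A B K : Type u} [CommRing A] [CommRing B] [Field K]
    [Algebra A B] [Algebra B K] [Algebra A K] [IsScalarTower A B K] (S : Submonoid A)
    [IsLocalization S B] {n : ℕ}
    (hA : ∀ (M : Type u) [AddCommGroup M] [Module A M] [Module.Finite A M],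
      HasFreeResolution A n M) {J : Submodule B K} (hJ : J.FG) : HasFreeResolution B n J := by
  obtain ⟨T, rfl⟩ := hJ
  have := isLocalizedModule_id S K B
  have : Module.Finite A (Submodule.span A (T : Set K)) :=
    Module.Finite.span_of_finite A T.finite_toSet
  refine ((hA (Submodule.span A (T : Set K))).localize (R' := B) S
    ((Submodule.span A (T : Set K)).toLocalized' B S LinearMap.id)).congr (LinearEquiv.ofEq _ _ ?_)
  simp [Submodule.localized'_span]

theorem IsCartierOn.exists_mul_mem_localUnits_of_hasFreeResolution {A K : Type u} [CommRing A]
    [Field K] [Algebra A K] [IsFractionRing A K] {n : ℕ}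
    (hA : ∀ (M : Type u) [AddCommGroup M] [Module A M] [Module.Finite A M],
      HasFreeResolution A n M) {x : A} (hx : x ≠ 0) {g : PrimeSpectrum A → Kˣ}
    (hg : IsCartierOn (basicOpen x) g) :
    ∃ f : Kˣ, ∀ q ∈ basicOpen x, f * g q ∈ localUnits K q := by
  have : IsDomain A := (IsFractionRing.injective A K).isDomain (algebraMap A K)
  let B := Localization.subalgebra.ofField K (Submonoid.powers x)
    (powers_le_nonZeroDivisors_of_noZeroDivisors hx)
  have : IsLocalization.Away x B := Localization.subalgebra.isLocalization_ofField _ _ _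
  let J : (Submodule B K)ˣ := Units.mkOfMulEqOne _ _
    (hg.cartierSections_mul_cartierSections_inv (B := B))
  have := (HasFreeResolution.of_isLocalization (Submonoid.powers x) hA
    (Submodule.fg_unit J)).isStablyFree
  have : Module.Free B (J : Submodule B K) := Module.free_of_isStablyFree_of_invertible B _
  obtain ⟨d, hd⟩ := (Submodule.mulExact_unitsMap_spanSingleton_unitsToPic B K J).mp
    (CommRing.Pic.mk_eq_one B J)
  exact ⟨d, fun q hq ↦ hg.mul_mem_localUnits_of_span_eq (congrArg Units.val hd).symm hq⟩

end ComplementOfParameter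

section PrimeElement

variable {A K : Type*} [CommRing A] [Field K] [Algebra A K] {x : A} {y : PrimeSpectrum A}

theorem exists_pow_mul_smul_mem_one {k : K}
    (hk : ∀ q ≤ y, x ∉ q.asIdeal → k ∈ localSubalgebra K q) :
    ∃ N, ∃ t ∉ y.asIdeal, (x ^ N * t) • k ∈ (1 : Submodule A K) := by
  obtain ⟨r, hr, hr'⟩ := exists_smul_mem_of_forall_prime (1 : Submodule A K)
    (Submonoid.powers x ⊔ y.asIdeal.primeCompl) k fun q hq ↦ by
      have hq' := Set.disjoint_left.mp hq
      exact hk q (fun a ha ↦ not_not.mp fun hay ↦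
          hq' ha (SetLike.le_def.mp le_sup_right (show a ∈ y.asIdeal.primeCompl from hay)))
        fun hxq ↦ hq' hxq (SetLike.le_def.mp le_sup_left (Submonoid.mem_powers x))
  obtain ⟨_, ⟨N, rfl⟩, t, ht, rfl⟩ := Submonoid.mem_sup.mp hr
  exact ⟨N, t, ht, hr'⟩

variable [IsFractionRing A K] {ϖ : Kˣ}

theorem exists_zpow_mul_mem_localUnits (hx : Prime x) (hϖ : algebraMap A K x = ϖ) {h : Kˣ}
    (hh : ∀ q ≤ y, x ∉ q.asIdeal → h ∈ localUnits K q) :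
    ∃ j : ℤ, h * ϖ ^ j ∈ localUnits K y := by
  have : IsDomain A := (IsFractionRing.injective A K).isDomain (algebraMap A K)
  obtain ⟨N, t, ht, hN⟩ := exists_pow_mul_smul_mem_one (k := (h : K)) fun q h1 h2 ↦
    (hh q h1 h2).1
  obtain ⟨M, u, hu, hM⟩ := exists_pow_mul_smul_mem_one (k := (h⁻¹ : Kˣ).val)
    fun q h1 h2 ↦ (hh q h1 h2).2
  obtain ⟨a, ha⟩ := Submodule.mem_one.mp hN
  obtain ⟨b, hb⟩ := Submodule.mem_one.mp hM
  have hab : a * b = t * u * x ^ (N + M) := IsFractionRing.injective A K <| by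
    rw [map_mul, ha, hb, smul_mul_smul_comm, Units.mul_inv, Algebra.algebraMap_eq_smul_one]
    ring_nf
  obtain ⟨i, j, c, d, -, hcd, rfl, rfl⟩ := mul_eq_mul_prime_pow hx hab
  have hc : c ∉ y.asIdeal := fun h' ↦
    y.2.mul_notMem ht hu (by rw [hcd]; exact Ideal.mul_mem_right _ _ h')
  have htK := IsLocalization.map_units K (⟨t, y.asIdeal.primeCompl_le_nonZeroDivisors ht⟩ :
    nonZeroDivisors A)
  have hcK := IsLocalization.map_units K (⟨c, y.asIdeal.primeCompl_le_nonZeroDivisors hc⟩ :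
    nonZeroDivisors A)
  have heq : h * ϖ ^ ((N : ℤ) - i) = hcK.unit / htK.unit := by
    rw [eq_div_iff_mul_eq', zpow_sub, zpow_natCast, zpow_natCast, ← mul_assoc, ← div_eq_mul_inv,
      div_mul_eq_mul_div, div_eq_iff_eq_mul]
    ext
    simp only [Units.val_mul, Units.val_pow_eq_pow_val, ← hϖ, IsUnit.unit_spec, ← map_pow,
      ← map_mul, ha, Algebra.smul_def]
    simp only [map_mul]
    ring
  exact ⟨N - i, heq ▸ div_mem (units_mem_localUnits hc rfl) (units_mem_localUnits ht rfl)⟩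

theorem eq_zero_of_zpow_mem_localUnits (hϖ : algebraMap A K x = ϖ) (hxy : x ∈ y.asIdeal) {j : ℤ}
    (hj : ϖ ^ j ∈ localUnits K y) : j = 0 := by
  wlog hj0 : 0 ≤ j generalizing j
  · simpa using this (j := -j) (by simpa using hj) (by lia)
  lift j to ℕ using hj0
  obtain ⟨s, hs, hsj⟩ : ((ϖ ^ (j : ℤ))⁻¹ : Kˣ).val ∈ localSubalgebra K y := hj.2
  obtain ⟨a, ha⟩ := Submodule.mem_one.mp hsj
  have hsa : s = a * x ^ j := IsFractionRing.injective A K <| by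
    rw [map_mul, map_pow, ha, hϖ, Algebra.smul_def, zpow_natCast, mul_assoc,
      ← Units.val_pow_eq_pow_val, Units.inv_mul, mul_one]
  by_contra hj
  exact hs (hsa ▸ Ideal.mul_mem_left _ a (Ideal.pow_mem_of_mem _ hxy j (by lia)))

end PrimeElement

section RegularPuncturedSpectrum

open IsLocalRing PrimeSpectrum

namespace IsRegularSystem

variable {A : Type u} {ι : Type*} [CommRing A] [IsLocalRing A] [IsNoetherianRing A] [Finite ι]
  {x : ι → A} {K : Type u} [Field K] [Algebra A K] [IsFractionRing A K]

theorem prime (hx : IsRegularSystem x) (i : ι) : Prime (x i) := by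
  have hi : x i ≠ 0 := fun h ↦ hx.notMem_span_image (Set.notMem_empty i) (h ▸ zero_mem _)
  simpa [Ideal.span_singleton_prime hi] using hx.isPrime_span_image {i}

/-- The point of `Spec A` cut out by a member of a regular system of parameters. -/
def primeOf (hx : IsRegularSystem x) (i : ι) : PrimeSpectrum A :=
  ⟨Ideal.span {x i}, (Ideal.span_singleton_prime (hx.prime i).ne_zero).mpr (hx.prime i)⟩

theorem primeOf_ne_closedPoint (hx : IsRegularSystem x) {i j : ι} (hij : i ≠ j) :
    hx.primeOf i ≠ closedPoint A := by
  intro h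
  refine hx.notMem_span_image (t := {i}) (i := j) hij.symm ?_
  rw [Set.image_singleton, show Ideal.span {x i} = maximalIdeal A from
    congrArg PrimeSpectrum.asIdeal h]
  exact hx.mem_maximalIdeal j

omit [IsNoetherianRing A] [Finite ι] in
theorem ne_closedPoint_of_notMem (hx : IsRegularSystem x) {i : ι} {q : PrimeSpectrum A}
    (hq : x i ∉ q.asIdeal) : q ≠ closedPoint A := by
  rintro rfl
  exact hq (hx.mem_maximalIdeal i)

theorem mem_one_of_forall_mem_localSubalgebra [Nontrivial ι] (hx : IsRegularSystem x) {h : K}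
    (hh : ∀ q ≠ closedPoint A, h ∈ localSubalgebra K q) : h ∈ (1 : Submodule A K) := by
  obtain ⟨i, j, hij⟩ := exists_pair_ne ι
  obtain ⟨N, hN⟩ := exists_pow_smul_mem_of_forall_prime (1 : Submodule A K) (x i) h
    fun q hq ↦ hh q (hx.ne_closedPoint_of_notMem hq)
  induction N with
  | zero => simpa using hN
  | succ N ih =>
    refine ih ?_
    obtain ⟨a, ha⟩ := Submodule.mem_one.mp hN
    obtain ⟨s, hs, hsh⟩ := hh _ (hx.primeOf_ne_closedPoint hij)
    obtain ⟨b, hb⟩ := Submodule.mem_one.mp hsh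
    have hsa : s * a = x i * (x i ^ N * b) := IsFractionRing.injective A K <| by
      rw [← mul_assoc, ← pow_succ', map_mul, map_mul, ha, hb, ← Algebra.smul_def,
        ← Algebra.smul_def, smul_comm]
    obtain ⟨c, rfl⟩ := ((hx.prime i).dvd_or_dvd ⟨_, hsa⟩).resolve_left fun h ↦
      hs (Ideal.mem_span_singleton.mpr h)
    refine Submodule.mem_one.mpr ⟨c, ?_⟩
    have hi : algebraMap A K (x i) ≠ 0 := by simpa using (hx.prime i).ne_zero
    refine mul_left_cancel₀ hi ?_
    rw [← map_mul, ha, pow_succ', mul_smul, Algebra.smul_def]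

theorem exists_zpow_mul_mem_localUnits (hx : IsRegularSystem x) {g : PrimeSpectrum A → Kˣ}
    (hg : IsCartierOn {closedPoint A}ᶜ g) {i : ι} {ϖ f : Kˣ} (hϖ : algebraMap A K (x i) = ϖ)
    (hf : ∀ q ∈ basicOpen (x i), f * g q ∈ localUnits K q) {y : PrimeSpectrum A}
    (hy : y ≠ closedPoint A) : ∃ j : ℤ, f * g y * ϖ ^ j ∈ localUnits K y := by
  refine CoxRing.exists_zpow_mul_mem_localUnits (hx.prime i) hϖ fun q hq hxq ↦ ?_
  rw [← mul_div_cancel_right (f * g y) (g q), mul_right_comm, mul_div_assoc]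
  exact mul_mem (hf q hxq) (hg.div_mem_of_le hy (hx.ne_closedPoint_of_notMem hxq) hq)

-- The divisor is principal on `D(x i)`; along `x i = 0` the trivialisation has constant order,
-- because any point of it off the closed point specialises from the generic one.
theorem exists_mul_mem_localUnits [Nontrivial ι] (hx : IsRegularSystem x)
    {g : PrimeSpectrum A → Kˣ} (hg : IsCartierOn {closedPoint A}ᶜ g) :
    ∃ f : Kˣ, ∀ q ≠ closedPoint A, f * g q ∈ localUnits K q := by
  obtain ⟨i, j, hij⟩ := exists_pair_ne ι
  have := hx.isDomain
  obtain ⟨ϖ, hϖ⟩ : ∃ ϖ : Kˣ, algebraMap A K (x i) = ϖ :=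
    ⟨Units.mk0 _ (by simpa using (hx.prime i).ne_zero), rfl⟩
  obtain ⟨f, hf⟩ := IsCartierOn.exists_mul_mem_localUnits_of_hasFreeResolution (K := K)
    (fun M _ _ _ ↦ hx.hasFreeResolution M) (hx.prime i).ne_zero
    (hg.mono fun q hq ↦ hx.ne_closedPoint_of_notMem hq)
  have hη := hx.primeOf_ne_closedPoint hij
  set η := hx.primeOf i
  obtain ⟨n, hn⟩ := hx.exists_zpow_mul_mem_localUnits hg hϖ hf hη
  refine ⟨f * ϖ ^ n, fun y hy ↦ ?_⟩
  rw [mul_right_comm]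
  by_cases hxy : x i ∈ y.asIdeal
  · obtain ⟨m, hm⟩ := hx.exists_zpow_mul_mem_localUnits hg hϖ hf hy
    have hle : η ≤ y := (Ideal.span_singleton_le_iff_mem _).mpr hxy
    have hηn : f * g y * ϖ ^ n ∈ localUnits K η := by
      have := mul_mem hn (hg.div_mem_of_le hy hη hle)
      rwa [mul_right_comm, mul_assoc f, mul_div_cancel] at this
    have hdiv : ϖ ^ (m - n) ∈ localUnits K η := by
      have := div_mem (localUnits_mono hle hm) hηn
      rwa [mul_div_mul_left_eq_div, div_eq_mul_inv, ← zpow_sub] at this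
    rwa [← sub_eq_zero.mp (eq_zero_of_zpow_mem_localUnits hϖ (Ideal.mem_span_singleton_self _)
      hdiv)]
  · exact mul_mem (hf y hxy) (zpow_mem (units_mem_localUnits hxy hϖ) _)

end IsRegularSystem

end RegularPuncturedSpectrum

/-! ### The blow-up of a regular point -/

theorem exists_affine_mem_le {X : Scheme.{u}} {x : X} {U : X.Opens} (hx : x ∈ U) :
    ∃ W : X.Opens, IsAffineOpen W ∧ x ∈ W ∧ W ≤ U := by
  obtain ⟨_, ⟨W, hW, rfl⟩, hxW, hWU⟩ := X.isBasis_affineOpens.exists_subset_of_mem_open hx U.2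
  exact ⟨W, hW, hxW, hWU⟩

section Specialization

variable {X : Scheme.{u}}

/-- The prime ideal of the local ring at `x` that corresponds to a generization `y` of `x`. -/
def primeOfSpecializes {x y : X} (h : y ⤳ x) : PrimeSpectrum (X.presheaf.stalk x) :=
  PrimeSpectrum.comap (X.presheaf.stalkSpecializes h).hom
    (IsLocalRing.closedPoint (X.presheaf.stalk y))

theorem notMem_primeOfSpecializes {x y : X} (h : y ⤳ x) (a : X.presheaf.stalk x) :
    a ∉ (primeOfSpecializes h).asIdeal ↔ IsUnit (X.presheaf.stalkSpecializes h a) := by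
  change ¬ (X.presheaf.stalkSpecializes h a ∈ IsLocalRing.maximalIdeal _) ↔ _
  rw [IsLocalRing.mem_maximalIdeal, mem_nonunits_iff, not_not]

theorem fromSpecStalk_primeOfSpecializes {x y : X} (h : y ⤳ x) :
    X.fromSpecStalk x (primeOfSpecializes h) = y := by
  have := Scheme.fromSpecStalk_closedPoint (x := y)
  rwa [← Scheme.SpecMap_stalkSpecializes_fromSpecStalk h] at this

theorem fromSpecStalk_specializes (x : X) (q : PrimeSpectrum (X.presheaf.stalk x)) :
    X.fromSpecStalk x q ⤳ x := by
  have : X.fromSpecStalk x q ∈ Set.range (X.fromSpecStalk x) := ⟨q, rfl⟩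
  rwa [Scheme.range_fromSpecStalk] at this

theorem primeOfSpecializes_fromSpecStalk (x : X) (q : PrimeSpectrum (X.presheaf.stalk x)) :
    primeOfSpecializes (fromSpecStalk_specializes x q) = q :=
  (X.fromSpecStalk x).isEmbedding.injective (fromSpecStalk_primeOfSpecializes _)

theorem primeOfSpecializes_eq_closedPoint_iff {x y : X} (h : y ⤳ x) :
    primeOfSpecializes h = IsLocalRing.closedPoint _ ↔ y = x := by
  refine (X.fromSpecStalk x).isEmbedding.injective.eq_iff.symm.trans ?_
  rw [fromSpecStalk_primeOfSpecializes, Scheme.fromSpecStalk_closedPoint]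

theorem exists_mul_stalkSpecializes_eq {x y : X} (h : y ⤳ x) (a : X.presheaf.stalk y) :
    ∃ b, ∃ s ∉ (primeOfSpecializes h).asIdeal,
      a * X.presheaf.stalkSpecializes h s = X.presheaf.stalkSpecializes h b := by
  obtain ⟨U, hU, hxU, -⟩ := exists_affine_mem_le (show x ∈ (⊤ : X.Opens) from trivial)
  have hyU : y ∈ U := h.mem_open U.2 hxU
  have hspec (c) : X.presheaf.stalkSpecializes h (X.presheaf.germ U x hxU c) =
      X.presheaf.germ U y hyU c := X.presheaf.germ_stalkSpecializes_apply hxU h c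
  let := TopCat.Presheaf.algebra_section_stalk X.presheaf (⟨y, hyU⟩ : U)
  have := hU.isLocalization_stalk ⟨y, hyU⟩
  obtain ⟨⟨b, s⟩, hbs⟩ := IsLocalization.surj (hU.primeIdealOf ⟨y, hyU⟩).asIdeal.primeCompl a
  refine ⟨X.presheaf.germ U x hxU b, X.presheaf.germ U x hxU s.1, ?_, ?_⟩
  · rw [notMem_primeOfSpecializes, hspec]
    exact IsLocalization.map_units (X.presheaf.stalk y) s
  · rw [hspec, hspec]
    exact hbs

end Specialization

section StalkRange

variable {X : Scheme.{u}} [IsIntegral X]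

instance (x : X) : IsFractionRing (X.presheaf.stalk x) (FunField X) :=
  inferInstanceAs (IsFractionRing (X.presheaf.stalk x) X.functionField)

/-- The local ring at `x`, as a subring of the function field. -/
abbrev stalkRange (x : X) : Subring (FunField X) :=
  (algebraMap (X.presheaf.stalk x) (FunField X)).range

theorem mem_unitsAt {x : X} {u : (FunField X)ˣ} :
    u ∈ unitsAt X x ↔ (u : FunField X) ∈ stalkRange x ∧ ((u⁻¹ : (FunField X)ˣ) : FunField X) ∈
      stalkRange x := by
  constructor
  · rintro ⟨v, rfl⟩
    exact ⟨⟨v, rfl⟩, ⟨(v⁻¹ : (X.presheaf.stalk x)ˣ), rfl⟩⟩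
  · rintro ⟨⟨a, ha⟩, ⟨b, hb⟩⟩
    have hab : a * b = 1 := by
      apply IsFractionRing.injective (X.presheaf.stalk x) (FunField X)
      rw [map_mul, ha, hb, map_one, Units.mul_inv]
    exact ⟨Units.mkOfMulEqOne a b hab, Units.ext ha⟩

theorem algebraMap_stalkSpecializes {x y : X} (h : y ⤳ x) (a : X.presheaf.stalk x) :
    algebraMap (X.presheaf.stalk y) (FunField X) (X.presheaf.stalkSpecializes h a) =
      algebraMap (X.presheaf.stalk x) (FunField X) a := by
  change (X.presheaf.stalkSpecializes h ≫ X.presheaf.stalkSpecializes _) a = _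
  rw [TopCat.Presheaf.stalkSpecializes_comp]
  rfl

theorem exists_open_forall_mem_stalkRange {x : X} {f : FunField X} (hf : f ∈ stalkRange x) :
    ∃ U : X.Opens, x ∈ U ∧ ∀ y ∈ U, f ∈ stalkRange y := by
  obtain ⟨a, rfl⟩ := hf
  obtain ⟨U, hxU, s, rfl⟩ := X.presheaf.exists_germ_eq a
  exact ⟨U, hxU, fun y hy ↦ ⟨_, toFunField_eq hy hxU s⟩⟩

theorem mem_localSubalgebra_primeOfSpecializes {x y : X} (h : y ⤳ x) {f : FunField X} :
    f ∈ localSubalgebra (FunField X) (primeOfSpecializes h) ↔ f ∈ stalkRange y := by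
  constructor
  · rintro ⟨s, hs, hsf⟩
    obtain ⟨a, ha⟩ := Submodule.mem_one.mp hsf
    obtain ⟨v, hv⟩ := (notMem_primeOfSpecializes h s).mp hs
    refine ⟨↑v⁻¹ * X.presheaf.stalkSpecializes h a, ?_⟩
    rw [map_mul, algebraMap_stalkSpecializes, ha, Algebra.smul_def,
      ← algebraMap_stalkSpecializes h s, ← hv, ← mul_assoc, ← map_mul, Units.inv_mul, map_one,
      one_mul]
  · rintro ⟨a, rfl⟩
    obtain ⟨b, s, hs, hbs⟩ := exists_mul_stalkSpecializes_eq h a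
    refine ⟨s, hs, Submodule.mem_one.mpr ⟨b, ?_⟩⟩
    rw [Algebra.smul_def, ← algebraMap_stalkSpecializes h, ← algebraMap_stalkSpecializes h, ← hbs,
      map_mul, mul_comm]

theorem mem_localUnits_primeOfSpecializes {x y : X} (h : y ⤳ x) {u : (FunField X)ˣ} :
    u ∈ localUnits (FunField X) (primeOfSpecializes h) ↔ u ∈ unitsAt X y := by
  rw [mem_unitsAt, ← mem_localSubalgebra_primeOfSpecializes h,
    ← mem_localSubalgebra_primeOfSpecializes h]
  rfl

theorem exists_pow_mul_mem_stalkRange {x : X} {e : FunField X} (he : e ∈ stalkRange x)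
    {h : FunField X} (H : ∀ y : X, y ⤳ x → e⁻¹ ∈ stalkRange y → h ∈ stalkRange y) :
    ∃ N, e ^ N * h ∈ stalkRange x := by
  obtain ⟨s, rfl⟩ := he
  obtain ⟨N, hN⟩ := exists_pow_smul_mem_of_forall_prime (1 : Submodule _ (FunField X)) s h
    fun q hq ↦ by
      rw [← primeOfSpecializes_fromSpecStalk x q] at hq ⊢
      have hy := fromSpecStalk_specializes x q
      refine (mem_localSubalgebra_primeOfSpecializes hy).mpr (H _ hy ?_)
      obtain ⟨v, hv⟩ := (notMem_primeOfSpecializes hy s).mp hq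
      refine ⟨↑v⁻¹, ?_⟩
      rw [← algebraMap_stalkSpecializes hy, ← hv]
      exact map_units_inv (algebraMap _ (FunField X)) v
  obtain ⟨a, ha⟩ := Submodule.mem_one.mp hN
  exact ⟨N, a, by rw [ha, Algebra.smul_def, map_pow]⟩

end StalkRange

section Comap

open Scheme.IdealSheafData

variable {X Y : Scheme.{u}}

theorem ideal_comap_of_isAffine [IsAffine X] [IsAffine Y] (I : Y.IdealSheafData) (f : X ⟶ Y) :
    (I.comap f).ideal ⟨⊤, isAffineOpen_top X⟩ =
      (I.ideal ⟨⊤, isAffineOpen_top Y⟩).map f.appTop.hom := by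
  apply le_antisymm
  · let J : X.IdealSheafData := ofIdealTop ((I.ideal ⟨⊤, isAffineOpen_top Y⟩).map f.appTop.hom)
    have hJ : J.ideal ⟨⊤, isAffineOpen_top X⟩ =
        (I.ideal ⟨⊤, isAffineOpen_top Y⟩).map f.appTop.hom := by simp [J]
    have h : I.comap f ≤ J := by
      rw [← le_map_iff_comap_le]
      apply le_of_isAffine
      rw [ideal_map_of_isAffineHom]
      exact Ideal.map_le_iff_le_comap.mp hJ.ge
    exact (h _).trans hJ.le
  · rw [Ideal.map_le_iff_le_comap]
    have := le_map_comap I f ⟨⊤, isAffineOpen_top Y⟩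
    rwa [ideal_map_of_isAffineHom] at this

theorem ideal_comap_of_isOpenImmersion_of_le (I : Y.IdealSheafData) (f : X ⟶ Y)
    [IsOpenImmersion f] {V : Y.Opens} (hV : IsAffineOpen V) {W : X.Opens} (hW : IsAffineOpen W)
    (h : W ≤ f ⁻¹ᵁ V) :
    (I.comap f).ideal ⟨W, hW⟩ = (I.ideal ⟨V, hV⟩).map (f.appLE V W h).hom := by
  have hle : f ''ᵁ W ≤ V := by
    rintro _ ⟨y, hy, rfl⟩
    exact h hy
  have h0 := I.map_ideal (V := ⟨V, hV⟩) (U := ⟨f ''ᵁ W, hW.image_of_isOpenImmersion f⟩) hle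
  refine (ideal_comap_of_isOpenImmersion I f ⟨W, hW⟩).trans ?_
  have h1 : ∀ J : Ideal Γ(Y, f ''ᵁ W), J.comap (f.appIso W).inv.hom =
      J.map (f.appIso W).hom.hom :=
    fun J ↦ (Ideal.map_comap_of_equiv (f.appIso W).commRingCatIsoToRingEquiv).symm
  refine (h1 _).trans ?_
  refine (congrArg (Ideal.map (f.appIso W).hom.hom) h0.symm).trans ?_
  rw [Ideal.map_map, ← CommRingCat.hom_comp, Scheme.Hom.appIso_hom']
  congr 2
  exact Scheme.Hom.map_appLE _ _ _

theorem isIso_ι_appLE_top (W : X.Opens) (h : (⊤ : W.toScheme.Opens) ≤ W.ι ⁻¹ᵁ W) :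
    IsIso (W.ι.appLE W ⊤ h) := by
  have : W.ι.appLE W ⊤ h = W.topIso.inv := by
    simp [Scheme.Opens.topIso]
    rfl
  rw [this]
  infer_instance

theorem ideal_map_injective_of_isIso {R S : CommRingCat.{u}} (f : R ⟶ S) [IsIso f] :
    Function.Injective (Ideal.map f.hom) := by
  have : Function.LeftInverse (Ideal.map (inv f).hom) (Ideal.map f.hom) := by
    intro J
    rw [Ideal.map_map, ← CommRingCat.hom_comp, IsIso.hom_inv_id]
    exact Ideal.map_id J
  exact this.injective

theorem appLE_resLE_appTop (f : X ⟶ Y) {V : Y.Opens} {W : X.Opens} (h : W ≤ f ⁻¹ᵁ V)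
    (hW : (⊤ : W.toScheme.Opens) ≤ W.ι ⁻¹ᵁ W) (hV : (⊤ : V.toScheme.Opens) ≤ V.ι ⁻¹ᵁ V) :
    V.ι.appLE V ⊤ hV ≫ (f.resLE V W h).appTop = f.appLE V W h ≫ W.ι.appLE W ⊤ hW := by
  have : (f.resLE V W h).appTop = (f.resLE V W h).appLE ⊤ ⊤ (le_of_eq rfl) := by
    simp [Scheme.Hom.appTop, Scheme.Hom.app_eq_appLE]
  rw [this, Scheme.Hom.appLE_comp_appLE, Scheme.Hom.appLE_comp_appLE]
  simp only [Scheme.Hom.resLE_comp_ι]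

theorem ideal_comap_of_le (I : Y.IdealSheafData) (f : X ⟶ Y) {V : Y.Opens} (hV : IsAffineOpen V)
    {W : X.Opens} (hW : IsAffineOpen W) (h : W ≤ f ⁻¹ᵁ V) :
    (I.comap f).ideal ⟨W, hW⟩ = (I.ideal ⟨V, hV⟩).map (f.appLE V W h).hom := by
  have : IsAffine W := hW
  have : IsAffine V := hV
  have hWι : (⊤ : W.toScheme.Opens) ≤ W.ι ⁻¹ᵁ W := by simp
  have hVι : (⊤ : V.toScheme.Opens) ≤ V.ι ⁻¹ᵁ V := by simp
  have := isIso_ι_appLE_top W hWι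
  apply ideal_map_injective_of_isIso (W.ι.appLE W ⊤ hWι)
  rw [Ideal.map_map, ← CommRingCat.hom_comp, ← appLE_resLE_appTop f h hWι hVι,
    CommRingCat.hom_comp, ← Ideal.map_map,
    ← ideal_comap_of_isOpenImmersion_of_le (I.comap f) W.ι hW (isAffineOpen_top _) hWι,
    ← ideal_comap_of_isOpenImmersion_of_le I V.ι hV (isAffineOpen_top _) hVι,
    ← ideal_comap_of_isAffine, ← comap_comp, ← comap_comp, Scheme.Hom.resLE_comp_ι]

theorem comap_eq_top_of_forall_notMem (I : Y.IdealSheafData) (f : X ⟶ Y)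
    (h : ∀ x : X, f x ∉ I.support) : I.comap f = ⊤ := by
  rw [← support_eq_bot_iff, support_comap]
  ext x
  simpa using h x

theorem isInvertibleIdeal_top : IsInvertibleIdeal (⊤ : X.IdealSheafData) := by
  intro x
  obtain ⟨U, hU, hxU, -⟩ := exists_affine_mem_le (show x ∈ (⊤ : X.Opens) from trivial)
  exact ⟨⟨U, hU⟩, hxU, 1, one_mem _, by simp⟩

end Comap

section PointIdeal

variable {X Y : Scheme.{u}} {p : Y} (hp : IsClosed ({p} : Set Y))

theorem mem_support_pointIdeal {y : Y} : y ∈ (pointIdeal p hp).support ↔ y = p := by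
  change y ∈ ((Scheme.IdealSheafData.vanishingIdeal ⟨{p}, hp⟩).support : Set Y) ↔ _
  rw [Scheme.IdealSheafData.coe_support_vanishingIdeal]
  rfl

theorem map_germ_ideal_pointIdeal {V : Y.Opens} (hV : IsAffineOpen V) (hpV : p ∈ V) :
    ((pointIdeal p hp).ideal ⟨V, hV⟩).map (Y.presheaf.germ V p hpV).hom =
      IsLocalRing.maximalIdeal (Y.presheaf.stalk p) := by
  let q := hV.primeIdealOf ⟨p, hpV⟩
  have h1 : (pointIdeal p hp).ideal ⟨V, hV⟩ = q.asIdeal := by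
    rw [pointIdeal, Scheme.IdealSheafData.vanishingIdeal_ideal]
    have : hV.fromSpec ⁻¹' ({p} : Set Y) = {q} := by
      ext z
      change hV.fromSpec z = p ↔ z = q
      have hq : hV.fromSpec q = p := hV.fromSpec_primeIdealOf ⟨p, hpV⟩
      constructor
      · intro hz
        exact hV.fromSpec.isOpenEmbedding.injective (hz.trans hq.symm)
      · rintro rfl
        exact hq
    exact (congrArg PrimeSpectrum.vanishingIdeal this).trans
      (PrimeSpectrum.vanishingIdeal_singleton q)
  rw [h1]
  let := TopCat.Presheaf.algebra_section_stalk Y.presheaf (⟨p, hpV⟩ : V)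
  have := hV.isLocalization_stalk ⟨p, hpV⟩
  exact IsLocalization.AtPrime.map_eq_maximalIdeal q.asIdeal (Y.presheaf.stalk p)

theorem map_germ_ideal_of_le (I : X.IdealSheafData) {V W : X.Opens} (hV : IsAffineOpen V)
    (hW : IsAffineOpen W) {x : X} (hx : x ∈ W) (h : W ≤ V) :
    (I.ideal ⟨V, hV⟩).map (X.presheaf.germ V x (h hx)).hom =
      (I.ideal ⟨W, hW⟩).map (X.presheaf.germ W x hx).hom := by
  have h0 := I.map_ideal (V := ⟨V, hV⟩) (U := ⟨W, hW⟩) h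
  rw [← h0, Ideal.map_map, ← CommRingCat.hom_comp]
  congr 2
  exact (X.presheaf.germ_res (homOfLE h) x hx).symm

theorem map_stalkMap_maximalIdeal (f : X ⟶ Y) {x : X} (hp : IsClosed ({f x} : Set Y))
    {W : X.Opens} (hW : IsAffineOpen W) (hx : x ∈ W) :
    (IsLocalRing.maximalIdeal (Y.presheaf.stalk (f x))).map (f.stalkMap x).hom =
      (((pointIdeal (f x) hp).comap f).ideal ⟨W, hW⟩).map (X.presheaf.germ W x hx).hom := by
  obtain ⟨V, hV, hxV, -⟩ := exists_affine_mem_le (show f x ∈ (⊤ : Y.Opens) from trivial)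
  obtain ⟨W', hW', hxW', hWV⟩ := exists_affine_mem_le (show x ∈ W ⊓ f ⁻¹ᵁ V from ⟨hx, hxV⟩)
  obtain ⟨hle, hle'⟩ := le_inf_iff.mp hWV
  refine Eq.trans ?_ (map_germ_ideal_of_le _ hW hW' hxW' hle).symm
  rw [ideal_comap_of_le _ f hV hW' hle', Ideal.map_map,
    ← map_germ_ideal_pointIdeal hp hV hxV, Ideal.map_map, ← CommRingCat.hom_comp,
    ← CommRingCat.hom_comp, Scheme.Hom.germ_stalkMap, Scheme.Hom.appLE, Category.assoc,
    TopCat.Presheaf.germ_res]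

theorem fromSpecStalk_appLE {V : Y.Opens} (hpV : p ∈ V)
    (h : (⊤ : (Spec (Y.presheaf.stalk p)).Opens) ≤ Y.fromSpecStalk p ⁻¹ᵁ V) :
    (Y.fromSpecStalk p).appLE V ⊤ h =
      Y.presheaf.germ V p hpV ≫ (Scheme.ΓSpecIso (Y.presheaf.stalk p)).inv := by
  rw [Scheme.Hom.appLE, Scheme.fromSpecStalk_app hpV, Category.assoc, Category.assoc,
    ← Functor.map_comp]
  congr 1

theorem SpecMap_appLE_top {B C : CommRingCat.{u}} (φ : B ⟶ C)
    (h : (⊤ : (Spec C).Opens) ≤ Spec.map φ ⁻¹ᵁ ⊤) :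
    (Spec.map φ).appLE ⊤ ⊤ h = (Spec.map φ).appTop := by
  simp [Scheme.Hom.appTop, Scheme.Hom.app_eq_appLE]

theorem top_le_fromSpecStalk_preimage {V : Y.Opens} (hpV : p ∈ V) :
    (⊤ : (Spec (Y.presheaf.stalk p)).Opens) ≤ Y.fromSpecStalk p ⁻¹ᵁ V :=
  fun t _ ↦ (fromSpecStalk_specializes p t).mem_open V.2 hpV

theorem SpecMap_fromSpecStalk_appLE {B : CommRingCat.{u}} (φ : Y.presheaf.stalk p ⟶ B)
    {V : Y.Opens} (hpV : p ∈ V)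
    (h : (⊤ : (Spec B).Opens) ≤ (Spec.map φ ≫ Y.fromSpecStalk p) ⁻¹ᵁ V) :
    (Spec.map φ ≫ Y.fromSpecStalk p).appLE V ⊤ h =
      Y.presheaf.germ V p hpV ≫ φ ≫ (Scheme.ΓSpecIso B).inv := by
  rw [← Scheme.Hom.appLE_comp_appLE _ _ V ⊤ ⊤ (top_le_fromSpecStalk_preimage hpV)
    (le_of_eq rfl), SpecMap_appLE_top, fromSpecStalk_appLE hpV, Category.assoc,
    ← Scheme.ΓSpecIso_inv_naturality]

theorem isInvertibleIdeal_comap_Spec {B : CommRingCat.{u}} [IsDomain B]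
    (φ : Y.presheaf.stalk p ⟶ B) {b : B} (hb : b ≠ 0)
    (h : (IsLocalRing.maximalIdeal (Y.presheaf.stalk p)).map φ.hom = Ideal.span {b}) :
    IsInvertibleIdeal ((pointIdeal p hp).comap (Spec.map φ ≫ Y.fromSpecStalk p)) := by
  obtain ⟨V, hV, hpV, -⟩ := exists_affine_mem_le (show p ∈ (⊤ : Y.Opens) from trivial)
  let e : B ≃+* Γ(Spec B, ⊤) := (Scheme.ΓSpecIso B).symm.commRingCatIsoToRingEquiv
  refine fun t ↦ ⟨⟨⊤, isAffineOpen_top _⟩, trivial, e b, ?_, ?_⟩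
  · have : IsDomain Γ(Spec B, ⊤) := e.isDomain_iff.mp inferInstance
    exact mem_nonZeroDivisors_of_ne_zero ((map_ne_zero_iff e e.injective).mpr hb)
  · have hle : (⊤ : (Spec B).Opens) ≤ (Spec.map φ ≫ Y.fromSpecStalk p) ⁻¹ᵁ V :=
      fun t _ ↦ top_le_fromSpecStalk_preimage hpV (trivial : Spec.map φ t ∈ ⊤)
    rw [ideal_comap_of_le _ _ hV (isAffineOpen_top _) hle,
      SpecMap_fromSpecStalk_appLE φ hpV, CommRingCat.hom_comp,
      CommRingCat.hom_comp, ← Ideal.map_map, ← Ideal.map_map,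
      map_germ_ideal_pointIdeal hp hV hpV, h, Ideal.map_span, Set.image_singleton]
    rfl

end PointIdeal

section OffCentre

variable {X Y : Scheme.{u}} {p : Y} {hp : IsClosed ({p} : Set Y)} {π : X ⟶ Y}

/-- The complement of a closed point, as an open subscheme. -/
def complPoint (p : Y) (hp : IsClosed ({p} : Set Y)) : Y.Opens := ⟨{p}ᶜ, hp.isOpen_compl⟩

theorem isInvertibleIdeal_comap_of_forall_ne {T : Scheme.{u}} (f : T ⟶ Y) (h : ∀ t, f t ≠ p) :
    IsInvertibleIdeal ((pointIdeal p hp).comap f) := by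
  rw [comap_eq_top_of_forall_notMem _ _ fun t ht ↦ h t ((mem_support_pointIdeal hp).mp ht)]
  exact isInvertibleIdeal_top

theorem IsBlowUp.isIso_morphismRestrict (hπ : IsBlowUp (pointIdeal p hp) π) :
    IsIso (π ∣_ complPoint p hp) := by
  let U := complPoint p hp
  have hU : ∀ t, U.ι t ≠ p := fun t ↦ t.2
  obtain ⟨σ, hσ, -⟩ := hπ.existsUnique_lift U U.ι (isInvertibleIdeal_comap_of_forall_ne _ hU)
  have hV : ∀ t, ((π ⁻¹ᵁ U).ι ≫ π) t ≠ p := fun t ↦ t.2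
  have h1 : (π ∣_ U) ≫ σ = (π ⁻¹ᵁ U).ι := by
    refine (hπ.existsUnique_lift _ ((π ⁻¹ᵁ U).ι ≫ π)
      (isInvertibleIdeal_comap_of_forall_ne _ hV)).unique ?_ rfl
    rw [Category.assoc, hσ, morphismRestrict_ι]
  have hr : Set.range σ ⊆ Set.range (π ⁻¹ᵁ U).ι := by
    rintro _ ⟨t, rfl⟩
    rw [Scheme.Opens.range_ι]
    change π (σ t) ∈ U
    rw [← Scheme.Hom.comp_apply, hσ]
    exact t.2
  refine ⟨IsOpenImmersion.lift (π ⁻¹ᵁ U).ι σ hr, ?_, ?_⟩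
  · rw [← cancel_mono (π ⁻¹ᵁ U).ι, Category.assoc, IsOpenImmersion.lift_fac, h1, Category.id_comp]
  · rw [← cancel_mono U.ι, Category.assoc, morphismRestrict_ι, IsOpenImmersion.lift_fac_assoc, hσ,
      Category.id_comp]

theorem IsBlowUp.isIso_stalkMap (hπ : IsBlowUp (pointIdeal p hp) π) {x : X} (hx : π x ≠ p) :
    IsIso (π.stalkMap x) := by
  have := hπ.isIso_morphismRestrict
  let z : (π ⁻¹ᵁ complPoint p hp).toScheme := ⟨x, hx⟩
  have h : IsIso ((π ∣_ complPoint p hp).stalkMap z) := inferInstance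
  exact ((MorphismProperty.isomorphisms _).arrow_mk_iso_iff
    (morphismRestrictStalkMap π (complPoint p hp) z)).mp h

theorem IsBlowUp.exists_eq (hπ : IsBlowUp (pointIdeal p hp) π) {y : Y} (hy : y ≠ p) :
    ∃ x, π x = y := by
  have := hπ.isIso_morphismRestrict
  obtain ⟨x, hx⟩ := (π ∣_ complPoint p hp).homeomorph.surjective ⟨y, hy⟩
  exact ⟨x.1, (morphismRestrict_base_coe π _ x).symm.trans (congrArg Subtype.val hx)⟩

theorem IsBlowUp.exists_preimage_le (hπ : IsBlowUp (pointIdeal p hp) π) {x : X} (hx : π x ≠ p)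
    {W : X.Opens} (hxW : x ∈ W) :
    ∃ V : Y.Opens, π x ∈ V ∧ p ∉ V ∧ π ⁻¹ᵁ V ≤ W := by
  have := hπ.isIso_morphismRestrict
  let U := complPoint p hp
  let e := (π ∣_ U).homeomorph
  have he : ∀ z, (e z).1 = π z.1 := fun z ↦ morphismRestrict_base_coe π _ z
  let W' : Set (π ⁻¹ᵁ U) := {z | z.1 ∈ W}
  have hW' : IsOpen W' := W.2.preimage continuous_subtype_val
  have hV : IsOpen (Subtype.val '' (e '' W')) :=
    U.2.isOpenMap_subtype_val _ (e.isOpenMap _ hW')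
  refine ⟨⟨_, hV⟩, ⟨e ⟨x, hx⟩, ⟨⟨x, hx⟩, hxW, rfl⟩, he _⟩, ?_, ?_⟩
  · rintro ⟨z, -, hz⟩
    exact z.2 hz
  · rintro x' ⟨_, ⟨z, hz, rfl⟩, hz'⟩
    have hx' : π x' ∈ U := hz' ▸ (e z).2
    obtain rfl : z = ⟨x', hx'⟩ := e.injective (Subtype.ext (hz'.trans (he ⟨x', hx'⟩).symm))
    exact hz

end OffCentre

section FunctionField

variable {X Y : Scheme.{u}} [IsIntegral X] {p : Y} {hp : IsClosed ({p} : Set Y)}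
  {π : X ⟶ Y}

theorem IsBlowUp.genericPoint_ne (hπ : IsBlowUp (pointIdeal p hp) π) (hne : ∃ y, y ≠ p) :
    π (genericPoint X) ≠ p := by
  obtain ⟨y, hy⟩ := hne
  obtain ⟨x, rfl⟩ := hπ.exists_eq hy
  intro h
  have h1 : π (genericPoint X) ⤳ π x :=
    (genericPoint_specializes x).map π.continuous
  rw [h] at h1
  exact hy (h1.mem_closed hp rfl)

theorem IsBlowUp.exists_funFieldEquiv [IsIntegral Y] (hπ : IsBlowUp (pointIdeal p hp) π)
    (hne : ∃ y, y ≠ p) :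
    ∃ φ : FunField Y ≃+* FunField X, ∀ (x : X) (a : Y.presheaf.stalk (π x)),
      φ (algebraMap _ _ a) = algebraMap _ _ (π.stalkMap x a) := by
  have := hπ.isIso_stalkMap (hπ.genericPoint_ne hne)
  let ξ := genericPoint X
  let e : Y.presheaf.stalk (π ξ) ≃+* X.presheaf.stalk ξ :=
    (asIso (π.stalkMap ξ)).commRingCatIsoToRingEquiv
  refine ⟨IsFractionRing.ringEquivOfRingEquiv e, fun x a ↦ ?_⟩
  have hs : ξ ⤳ x := genericPoint_specializes x
  rw [← algebraMap_stalkSpecializes (hs.map π.continuous) a]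
  refine (IsFractionRing.ringEquivOfRingEquiv_algebraMap e _).trans ?_
  rw [← algebraMap_stalkSpecializes hs]
  exact congrArg _ (Scheme.Hom.stalkSpecializes_stalkMap_apply π ξ x hs a)

end FunctionField

section AdicOrder

open IsLocalRing WithZero

variable {A O : Type*} [CommRing A] [IsLocalRing A] [CommRing O] {ψ : A →+* O}
  {v : Valuation O ℤᵐ⁰}

namespace ExtendsAdicOrder

theorem map_le_one (hv : ExtendsAdicOrder ψ v) (a : A) : v (ψ a) ≤ 1 :=
  (hv a 0).mpr (by simp)

theorem mem_pow_succ_of_lt (hv : ExtendsAdicOrder ψ v) {a : A} {i : ℕ}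
    (h : v (ψ a) < exp (-(i : ℤ))) : a ∈ maximalIdeal A ^ (i + 1) := by
  rwa [← hv, ← lt_mul_exp_iff_le exp_ne_zero, ← exp_add,
    show -((i + 1 : ℕ) : ℤ) + 1 = -i by push_cast; ring]

theorem map_eq_exp (hv : ExtendsAdicOrder ψ v) {a : A} {i : ℕ} (ha : a ∈ maximalIdeal A ^ i)
    (ha' : a ∉ maximalIdeal A ^ (i + 1)) : v (ψ a) = exp (-(i : ℤ)) :=
  ((hv a i).mpr ha).eq_of_not_lt fun h ↦ ha' (hv.mem_pow_succ_of_lt h)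

theorem isUnit_of_one_le (hv : ExtendsAdicOrder ψ v) {a : A} (h : 1 ≤ v (ψ a)) : IsUnit a := by
  by_contra ha
  have := h.trans ((hv a 1).mpr (by rwa [pow_one, mem_maximalIdeal]))
  rw [← exp_zero, exp_le_exp] at this
  omega

end ExtendsAdicOrder

section ValuationRing

variable {L : Type*} [Field L] {ψ : A →+* L} {v : Valuation L ℤᵐ⁰}

theorem ExtendsAdicOrder.isLocalHom_codRestrict (hv : ExtendsAdicOrder ψ v) :
    IsLocalHom (ψ.codRestrict v.valuationSubring.toSubring hv.map_le_one) where
  map_nonunit a ha := by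
    obtain ⟨c, hc⟩ := ha.exists_right_inv
    refine hv.isUnit_of_one_le ?_
    have hv1 : v (ψ a * c) = 1 := by rw [show ψ a * c = 1 from congrArg Subtype.val hc, map_one]
    calc 1 = v (ψ a) * v c := by rw [← map_mul, hv1]
      _ ≤ v (ψ a) := mul_le_of_le_one_right' c.2

theorem ExtendsAdicOrder.map_codRestrict (hv : ExtendsAdicOrder ψ v) {x : A}
    (hx : x ∈ maximalIdeal A) (hx' : x ∉ maximalIdeal A ^ 2) :
    (maximalIdeal A).map (ψ.codRestrict v.valuationSubring.toSubring hv.map_le_one) =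
      Ideal.span {ψ.codRestrict v.valuationSubring.toSubring hv.map_le_one x} := by
  have hvx : v (ψ x) = exp (-((1 : ℕ) : ℤ)) := hv.map_eq_exp (by rwa [pow_one]) hx'
  have hψx : ψ x ≠ 0 := (v.ne_zero_iff).mp (hvx ▸ exp_ne_zero)
  refine le_antisymm (Ideal.map_le_iff_le_comap.mpr fun y hy ↦ ?_)
    ((Ideal.span_singleton_le_iff_mem _).mpr (Ideal.mem_map_of_mem _ hx))
  rw [Ideal.mem_comap, Ideal.mem_span_singleton']
  have h : v (ψ y / ψ x) ≤ 1 := by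
    rw [map_div₀, hvx]
    exact div_le_one_of_le₀ ((hv y 1).mpr (by rwa [pow_one])) zero_le
  exact ⟨⟨_, h⟩, Subtype.ext (div_mul_cancel₀ _ hψx)⟩

end ValuationRing

end AdicOrder

section BlowUpSubring

open IsLocalRing

variable {A O : Type*} [CommRing A] [IsLocalRing A] [CommRing O] (ψ : A →+* O) (e : O)

/-- The subring of fractions `ψ y / ψ z` with `y, z ∈ 𝔪ⁱ` and `ψ z` associated to `eⁱ`: when `e`
generates `𝔪O`, these are the elements of `O` that come from the blow-up algebra of `A`. -/
def blowUpSubring : Subring O where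
  carrier := {w | ∃ (i : ℕ) (y z : A), y ∈ maximalIdeal A ^ i ∧ z ∈ maximalIdeal A ^ i ∧
    Associated (ψ z) (e ^ i) ∧ w * ψ z = ψ y}
  zero_mem' := ⟨0, 0, 1, by simp, by simp, by simp, by simp⟩
  one_mem' := ⟨0, 1, 1, by simp, by simp, by simp, by simp⟩
  add_mem' := by
    rintro w w' ⟨i, y, z, hy, hz, h, e₁⟩ ⟨i', y', z', hy', hz', h', e₂⟩
    refine ⟨i + i', y * z' + z * y', z * z', ?_, ?_, ?_, ?_⟩
    · rw [pow_add]
      exact add_mem (Ideal.mul_mem_mul hy hz') (Ideal.mul_mem_mul hz hy')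
    · rw [pow_add]
      exact Ideal.mul_mem_mul hz hz'
    · rw [map_mul, pow_add]
      exact h.mul_mul h'
    · simp only [map_add, map_mul, ← e₁, ← e₂]
      ring
  mul_mem' := by
    rintro w w' ⟨i, y, z, hy, hz, h, e₁⟩ ⟨i', y', z', hy', hz', h', e₂⟩
    refine ⟨i + i', y * y', z * z', ?_, ?_, ?_, ?_⟩
    · rw [pow_add]
      exact Ideal.mul_mem_mul hy hy'
    · rw [pow_add]
      exact Ideal.mul_mem_mul hz hz'
    · rw [map_mul, pow_add]
      exact h.mul_mul h'
    · simp only [map_mul, ← e₁, ← e₂]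
      ring
  neg_mem' := by
    rintro w ⟨i, y, z, hy, hz, h, e₁⟩
    exact ⟨i, -y, z, neg_mem hy, hz, h, by rw [map_neg, ← e₁, neg_mul]⟩

variable {ψ e}

theorem map_mem_blowUpSubring (a : A) : ψ a ∈ blowUpSubring ψ e :=
  ⟨0, a, 1, by simp, by simp, by simp, by simp⟩

theorem isLocalHom_subtype_blowUpSubring : IsLocalHom (blowUpSubring ψ e).subtype where
  map_nonunit := by
    rintro ⟨w, i, y, z, hy, hz, h, e₁⟩ hw
    obtain ⟨u, hu⟩ := hw
    replace hu : (u : O) = w := hu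
    have e₂ : (↑u⁻¹ : O) * ψ y = ψ z := by rw [← e₁, ← hu, Units.inv_mul_cancel_left]
    refine IsUnit.of_mul_eq_one (⟨(↑u⁻¹ : O), i, z, y, hz, hy, ?_, e₂⟩ : blowUpSubring ψ e) ?_
    · refine Associated.trans ?_ h
      exact ⟨u⁻¹, by rw [← e₂, mul_comm]⟩
    · ext
      change w * (↑u⁻¹ : O) = 1
      rw [← hu, Units.mul_inv]

theorem map_codRestrict_blowUpSubring (h : (maximalIdeal A).map ψ = Ideal.span {e}) {a : A}
    (ha : a ∈ maximalIdeal A) (hae : Associated (ψ a) e) :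
    (maximalIdeal A).map (ψ.codRestrict (blowUpSubring ψ e) map_mem_blowUpSubring) =
      Ideal.span {ψ.codRestrict (blowUpSubring ψ e) map_mem_blowUpSubring a} := by
  apply le_antisymm
  · rw [Ideal.map_le_iff_le_comap]
    intro y hy
    have hy' : ψ y ∈ Ideal.span {e} := h ▸ Ideal.mem_map_of_mem ψ hy
    rw [Ideal.mem_span_singleton, ← hae.dvd_iff_dvd_left] at hy'
    obtain ⟨c, hc'⟩ := hy'
    have hc : c * ψ a = ψ y := by rw [hc', mul_comm]
    rw [Ideal.mem_comap, Ideal.mem_span_singleton']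
    exact ⟨⟨c, 1, y, a, by simpa using hy, by simpa using ha, by simpa using hae, hc⟩,
      Subtype.ext hc⟩
  · rw [Ideal.span_singleton_le_iff_mem]
    exact Ideal.mem_map_of_mem _ ha

theorem pow_dvd_of_mem_pow (h : (maximalIdeal A).map ψ = Ideal.span {e}) {y : A} {i : ℕ}
    (hy : y ∈ maximalIdeal A ^ i) : e ^ i ∣ ψ y := by
  have := Ideal.mem_map_of_mem ψ hy
  rwa [Ideal.map_pow, h, Ideal.span_singleton_pow, Ideal.mem_span_singleton] at this

variable [IsDomain O] [IsLocalRing O]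

theorem exists_associated (he : e ≠ 0) (h : (maximalIdeal A).map ψ = Ideal.span {e}) :
    ∃ a ∈ maximalIdeal A, Associated (ψ a) e := by
  by_contra! H
  have hle : (maximalIdeal A).map ψ ≤ maximalIdeal O * Ideal.span {e} := by
    rw [Ideal.map_le_iff_le_comap]
    intro a ha
    have h1 : ψ a ∈ Ideal.span {e} := h ▸ Ideal.mem_map_of_mem ψ ha
    obtain ⟨c, hc⟩ := Ideal.mem_span_singleton'.mp h1
    rw [Ideal.mem_comap, ← hc]
    refine Ideal.mul_mem_mul (fun hu ↦ H a ha ?_) (Ideal.mem_span_singleton_self e)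
    rw [← hc]
    exact (associated_isUnit_mul_left_iff hu).mpr (Associated.refl e)
  rw [h, Ideal.span_singleton_le_iff_mem, Ideal.mem_mul_span_singleton] at hle
  obtain ⟨c, hc, hce⟩ := hle
  obtain rfl : c = 1 := mul_right_cancel₀ he (by rw [hce, one_mul])
  exact hc isUnit_one

section Valuation

open WithZero

variable [IsLocalHom ψ] {v : Valuation O ℤᵐ⁰} (hv : ExtendsAdicOrder ψ v)
include hv

theorem ExtendsAdicOrder.map_eq_exp_of_associated (he : e ≠ 0)
    (h : (maximalIdeal A).map ψ = Ideal.span {e}) {z : A} {i : ℕ}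
    (hz : z ∈ maximalIdeal A ^ i) (hze : Associated (ψ z) (e ^ i)) :
    v (ψ z) = exp (-(i : ℤ)) := by
  refine hv.map_eq_exp hz fun hz' ↦ ?_
  have he' : ¬ IsUnit e := by
    have hle := ((local_hom_TFAE ψ).out 0 2).mp ‹_›
    rwa [h, Ideal.span_singleton_le_iff_mem] at hle
  have hdvd := (pow_dvd_of_mem_pow h hz').trans hze.dvd
  rw [pow_succ] at hdvd
  exact he' (isUnit_of_dvd_one
    ((mul_dvd_mul_iff_left (pow_ne_zero i he)).mp (by rwa [mul_one])))

theorem ExtendsAdicOrder.le_one_of_mem_blowUpSubring (he : e ≠ 0)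
    (h : (maximalIdeal A).map ψ = Ideal.span {e}) {w : O} (hw : w ∈ blowUpSubring ψ e) :
    v w ≤ 1 := by
  obtain ⟨i, y, z, hy, hz, hze, hwz⟩ := hw
  have hle := (hv y i).mpr hy
  rw [← hwz, map_mul, hv.map_eq_exp_of_associated he h hz hze] at hle
  exact le_of_mul_le_mul_right (by rwa [one_mul]) (exp_pos (a := -(i : ℤ)))

theorem ExtendsAdicOrder.dvd_of_mem_blowUpSubring (he : e ≠ 0)
    (h : (maximalIdeal A).map ψ = Ideal.span {e}) {w : O} (hw : w ∈ blowUpSubring ψ e)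
    (hw1 : v w < 1) : e ∣ w := by
  obtain ⟨i, y, z, _, hz, hze, hwz⟩ := hw
  have hlt : v (ψ y) < exp (-(i : ℤ)) := by
    rw [← hwz, map_mul, hv.map_eq_exp_of_associated he h hz hze]
    exact mul_lt_of_lt_one_left exp_pos hw1
  have hdvd := pow_dvd_of_mem_pow h (hv.mem_pow_succ_of_lt hlt)
  rw [← hwz] at hdvd
  have hdvd' : e ^ (i + 1) ∣ w * e ^ i := hdvd.trans (mul_dvd_mul_left w hze.dvd)
  rwa [pow_succ', mul_dvd_mul_iff_right (pow_ne_zero i he)] at hdvd'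

theorem ExtendsAdicOrder.map_generator (he : e ≠ 0)
    (h : (maximalIdeal A).map ψ = Ideal.span {e}) (hle : ∀ w, v w ≤ 1) : v e = exp (-1) := by
  obtain ⟨a, ha, u, hu⟩ := exists_associated he h
  have hva := hv.map_eq_exp_of_associated he h (i := 1) (by rwa [pow_one])
    (by rw [pow_one]; exact ⟨u, hu⟩)
  have hvu : v (u : O) = 1 := by
    refine (hle _).antisymm ?_
    calc 1 = v (u : O) * v (↑u⁻¹ : O) := by rw [← map_mul, Units.mul_inv, map_one]
      _ ≤ v (u : O) := mul_le_of_le_one_right' (hle _)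
  rw [← hu, map_mul, hva, hvu, mul_one]
  rfl

end Valuation

end BlowUpSubring

section LiftSpec

variable {X Y : Scheme.{u}}

theorem eq_top_of_SpecMap_comp_eq_fromSpecStalk {x : X} (B : Subring (X.presheaf.stalk x))
    [IsLocalHom B.subtype] (g : Spec (.of B) ⟶ X)
    (hg : Spec.map (CommRingCat.ofHom B.subtype) ≫ g = X.fromSpecStalk x) : B = ⊤ := by
  have : IsLocalRing B := RingHom.domain_isLocalRing B.subtype
  let ι : CommRingCat.of B ⟶ X.presheaf.stalk x := CommRingCat.ofHom B.subtype
  replace hg : Spec.map ι ≫ g = X.fromSpecStalk x := hg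
  have hgx : g (IsLocalRing.closedPoint B) = x := by
    have h : PrimeSpectrum.comap B.subtype (IsLocalRing.closedPoint (X.presheaf.stalk x)) =
        IsLocalRing.closedPoint B := IsLocalRing.comap_closedPoint B.subtype
    rw [← h]
    refine Eq.trans ?_ (Scheme.fromSpecStalk_closedPoint (x := x))
    rw [← hg]
    rfl
  rw [eq_top_iff]
  rintro a -
  obtain ⟨U, hxU, s, rfl⟩ := X.presheaf.exists_germ_eq a
  have hgU : (⊤ : (Spec (CommRingCat.of B)).Opens) ≤ g ⁻¹ᵁ U :=
    (Scheme.preimage_eq_top_of_closedPoint_mem g (by rwa [hgx])).ge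
  have hι : (⊤ : (Spec (X.presheaf.stalk x)).Opens) ≤ Spec.map ι ⁻¹ᵁ ⊤ := le_of_eq rfl
  have hU : (⊤ : (Spec (X.presheaf.stalk x)).Opens) ≤ X.fromSpecStalk x ⁻¹ᵁ U := by
    rw [← hg]
    exact fun t _ ↦ hgU trivial
  have hcomp : g.appLE U ⊤ hgU ≫ (Spec.map ι).appLE ⊤ ⊤ hι =
      X.presheaf.germ U x hxU ≫ (Scheme.ΓSpecIso _).inv := by
    rw [Scheme.Hom.appLE_comp_appLE, ← fromSpecStalk_appLE hxU hU]
    simp only [hg]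
  have hgerm : g.appLE U ⊤ hgU ≫ (Scheme.ΓSpecIso _).hom ≫ ι = X.presheaf.germ U x hxU := by
    rw [← Scheme.ΓSpecIso_naturality, ← SpecMap_appLE_top ι hι, ← Category.assoc, hcomp,
      Category.assoc, Iso.inv_hom_id, Category.comp_id]
  rw [← hgerm]
  exact ((g.appLE U ⊤ hgU ≫ (Scheme.ΓSpecIso _).hom) s : B).2

variable {π : X ⟶ Y} {p : Y} {hp : IsClosed ({p} : Set Y)}

theorem IsBlowUp.existsUnique_lift_Spec (hπ : IsBlowUp (pointIdeal p hp) π) {B : CommRingCat.{u}}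
    [IsDomain B] (φ : Y.presheaf.stalk p ⟶ B) {b : B} (hb : b ≠ 0)
    (h : (IsLocalRing.maximalIdeal (Y.presheaf.stalk p)).map φ.hom = Ideal.span {b}) :
    ∃! g : Spec B ⟶ X, g ≫ π = Spec.map φ ≫ Y.fromSpecStalk p :=
  hπ.existsUnique_lift _ _ (isInvertibleIdeal_comap_Spec hp φ hb h)

end LiftSpec

section LocalGenerators

variable {X Y : Scheme.{u}} [IsIntegral X] {π : X ⟶ Y}

theorem IsLocalGenerator.exists_open {I : X.IdealSheafData} {x : X} {e : (FunField X)ˣ}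
    (he : IsLocalGenerator I x e) : ∃ U : X.Opens, x ∈ U ∧ ∀ y ∈ U, IsLocalGenerator I y e := by
  obtain ⟨U, hx, g, hg, h⟩ := he
  exact ⟨U.1, hx, fun y hy ↦ ⟨U, hy, g, hg, h.trans (toFunField_eq hx hy g)⟩⟩

theorem IsLocalGenerator.mem_unitsAt {p : Y} {hp : IsClosed ({p} : Set Y)} {x : X}
    {e : (FunField X)ˣ} (he : IsLocalGenerator ((pointIdeal p hp).comap π) x e) (hx : π x ≠ p) :
    e ∈ unitsAt X x := by
  obtain ⟨⟨U, hU⟩, hxU, g, hg, h⟩ := he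
  have hsupp : x ∉ ((pointIdeal p hp).comap π).support := by
    rw [Scheme.IdealSheafData.support_comap]
    exact fun h ↦ hx ((mem_support_pointIdeal hp).mp h)
  rw [Scheme.IdealSheafData.mem_support_iff_of_mem (U := ⟨U, hU⟩) hxU, hg] at hsupp
  have hxg : x ∈ X.basicOpen g := by
    by_contra hxg
    apply hsupp
    rw [Scheme.zeroLocus_span, Scheme.zeroLocus_singleton]
    exact hxg
  obtain ⟨u, hu⟩ := (X.mem_basicOpen g x hxU).mp hxg
  refine ⟨u, ?_⟩
  ext
  rw [h, toFunField, ← hu]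
  rfl

theorem IsLocalGenerator.exists_map_maximalIdeal_eq {x : X} {hp : IsClosed ({π x} : Set Y)}
    {e : (FunField X)ˣ} (he : IsLocalGenerator ((pointIdeal (π x) hp).comap π) x e) :
    ∃ e₀ : X.presheaf.stalk x, algebraMap _ (FunField X) e₀ = e ∧
      (IsLocalRing.maximalIdeal (Y.presheaf.stalk (π x))).map (π.stalkMap x).hom =
        Ideal.span {e₀} := by
  obtain ⟨⟨U, hU⟩, hxU, g, hg, h⟩ := he
  exact ⟨X.presheaf.germ U x hxU g, h.symm, by
    rw [map_stalkMap_maximalIdeal π hp hU hxU, hg, Ideal.map_span, Set.image_singleton]⟩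

end LocalGenerators

section OverCentre

variable {X Y : Scheme.{u}} [IsIntegral X] {π : X ⟶ Y}

-- `Spec B` lifts to the blow-up; composed with `Spec 𝒪_{X,x} ⟶ Spec B` it is the canonical
-- morphism, because lifts are unique. Hence every element of `𝒪_{X,x}` comes from `B`.
theorem IsBlowUp.blowUpSubring_stalkMap_eq_top {x : X} {hp : IsClosed ({π x} : Set Y)}
    (hπ : IsBlowUp (pointIdeal (π x) hp) π) {e : X.presheaf.stalk x} (he : e ≠ 0)
    (h : (IsLocalRing.maximalIdeal (Y.presheaf.stalk (π x))).map (π.stalkMap x).hom =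
      Ideal.span {e}) : blowUpSubring (π.stalkMap x).hom e = ⊤ := by
  let B := blowUpSubring (π.stalkMap x).hom e
  have : IsLocalHom B.subtype := isLocalHom_subtype_blowUpSubring
  let φ : Y.presheaf.stalk (π x) ⟶ CommRingCat.of B :=
    CommRingCat.ofHom ((π.stalkMap x).hom.codRestrict B map_mem_blowUpSubring)
  obtain ⟨a, ha, hae⟩ := exists_associated he h
  obtain ⟨g, hg, -⟩ := hπ.existsUnique_lift_Spec φ (b := φ a)
    (fun h0 ↦ he (hae.eq_zero_iff.mp (congrArg Subtype.val h0)))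
    (map_codRestrict_blowUpSubring h ha hae)
  refine eq_top_of_SpecMap_comp_eq_fromSpecStalk B g
    ((hπ.existsUnique_lift_Spec (π.stalkMap x) he h).unique ?_
      (Scheme.SpecMap_stalkMap_fromSpecStalk π).symm)
  rw [Category.assoc, hg, ← Spec.map_comp_assoc]
  rfl

variable [IsIntegral Y] {p : Y} {hp : IsClosed ({p} : Set Y)} {φ : FunField Y ≃+* FunField X}

theorem exists_ne_of_maximalIdeal_ne_bot (h : IsLocalRing.maximalIdeal (Y.presheaf.stalk p) ≠ ⊥) :
    ∃ y, y ≠ p := by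
  refine ⟨Y.fromSpecStalk p ⟨⊥, Ideal.isPrime_bot⟩, fun hy ↦ h ?_⟩
  have hbot := (primeOfSpecializes_eq_closedPoint_iff (fromSpecStalk_specializes p _)).mpr hy
  rw [primeOfSpecializes_fromSpecStalk] at hbot
  exact (congrArg PrimeSpectrum.asIdeal hbot).symm

open IsLocalRing WithZero

variable {v : Valuation (FunField X) ℤᵐ⁰}

/-- The properties of the blow-up `π` of a regular point `p` that determine its divisors: `I` is
the ideal sheaf of the exceptional divisor, `η` its generic point, `v` the order of vanishing along
it (written multiplicatively), and `φ` identifies the function fields. -/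
structure IsBlowUpModel (π : X ⟶ Y) (p : Y) (I : X.IdealSheafData)
    (φ : FunField Y ≃+* FunField X) (v : Valuation (FunField X) ℤᵐ⁰) (η : X) : Prop where
  map_mem : ∀ {x : X} {f : FunField Y}, f ∈ stalkRange (π x) → φ f ∈ stalkRange x
  mem_of_map_mem : ∀ {x : X} {f : FunField Y}, π x ≠ p → φ f ∈ stalkRange x → f ∈ stalkRange (π x)
  exists_eq : ∀ {y : Y}, y ≠ p → ∃ x, π x = y
  exists_preimage_le : ∀ {x : X}, π x ≠ p → ∀ {W : X.Opens}, x ∈ W →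
    ∃ V : Y.Opens, π x ∈ V ∧ p ∉ V ∧ π ⁻¹ᵁ V ≤ W
  map_center : π η = p
  specializes : ∀ {x : X}, π x = p → η ⤳ x
  generator_mem_unitsAt : ∀ {x : X} {e : (FunField X)ˣ}, IsLocalGenerator I x e → π x ≠ p →
    e ∈ unitsAt X x
  valuation_le_one : ∀ {x : X}, π x = p → ∀ {f : FunField X}, f ∈ stalkRange x → v f ≤ 1
  mul_inv_mem : ∀ {x : X} {e : (FunField X)ˣ}, IsLocalGenerator I x e → π x = p →
    ∀ {f : FunField X}, f ∈ stalkRange x → v f < 1 → f * ↑e⁻¹ ∈ stalkRange x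
  valuation_generator : ∀ {x : X} {e : (FunField X)ˣ}, IsLocalGenerator I x e → π x = p →
    v e = exp (-1)
  generator_mem : ∀ {x : X} {e : (FunField X)ˣ}, IsLocalGenerator I x e → π x = p →
    (e : FunField X) ∈ stalkRange x

theorem ExtendsAdicOrder.comap_algebraMap_stalk
    (hφ : ∀ (x : X) (a : Y.presheaf.stalk (π x)),
      φ (algebraMap _ _ a) = algebraMap _ _ (π.stalkMap x a)) {x : X}
    (hv : ExtendsAdicOrder (φ.toRingHom.comp (algebraMap (Y.presheaf.stalk (π x)) _)) v) :
    ExtendsAdicOrder (π.stalkMap x).hom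
      (v.comap (algebraMap (X.presheaf.stalk x) (FunField X))) := fun a i ↦ by
  rw [← hv a i]
  exact (congrArg (v · ≤ _) (hφ x a).symm).to_iff

theorem IsBlowUp.valuation_le_one_of_mem_stalkRange (hπ : IsBlowUp (pointIdeal p hp) π)
    (hφ : ∀ (x : X) (a : Y.presheaf.stalk (π x)),
      φ (algebraMap _ _ a) = algebraMap _ _ (π.stalkMap x a))
    (hv : ExtendsAdicOrder (φ.toRingHom.comp (algebraMap (Y.presheaf.stalk p) _)) v)
    {x : X} (hx : π x = p) {f : FunField X} (hf : f ∈ stalkRange x) : v f ≤ 1 := by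
  subst hx
  obtain ⟨f, rfl⟩ := hf
  obtain ⟨e, he⟩ := exists_isLocalGenerator hπ.isInvertible x
  obtain ⟨e₀, he₀, h⟩ := he.exists_map_maximalIdeal_eq
  have hne : e₀ ≠ 0 := (map_ne_zero_iff _ (IsFractionRing.injective _ _)).mp (he₀ ▸ e.ne_zero)
  exact (hv.comap_algebraMap_stalk hφ).le_one_of_mem_blowUpSubring hne h
    (hπ.blowUpSubring_stalkMap_eq_top hne h ▸ Subring.mem_top f)

theorem IsBlowUp.mul_inv_mem_stalkRange (hπ : IsBlowUp (pointIdeal p hp) π)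
    (hφ : ∀ (x : X) (a : Y.presheaf.stalk (π x)),
      φ (algebraMap _ _ a) = algebraMap _ _ (π.stalkMap x a))
    (hv : ExtendsAdicOrder (φ.toRingHom.comp (algebraMap (Y.presheaf.stalk p) _)) v)
    {x : X} (hx : π x = p) {e : (FunField X)ˣ}
    (he : IsLocalGenerator ((pointIdeal p hp).comap π) x e)
    {f : FunField X} (hf : f ∈ stalkRange x) (hvf : v f < 1) : f * ↑e⁻¹ ∈ stalkRange x := by
  subst hx
  obtain ⟨f, rfl⟩ := hf
  obtain ⟨e₀, he₀, h⟩ := he.exists_map_maximalIdeal_eq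
  have hne : e₀ ≠ 0 := (map_ne_zero_iff _ (IsFractionRing.injective _ _)).mp (he₀ ▸ e.ne_zero)
  obtain ⟨c, rfl⟩ := (hv.comap_algebraMap_stalk hφ).dvd_of_mem_blowUpSubring hne h
    (hπ.blowUpSubring_stalkMap_eq_top hne h ▸ Subring.mem_top f) hvf
  exact ⟨c, by rw [map_mul, he₀, mul_right_comm, Units.mul_inv, one_mul]⟩

theorem IsBlowUp.valuation_generator (hπ : IsBlowUp (pointIdeal p hp) π)
    (hφ : ∀ (x : X) (a : Y.presheaf.stalk (π x)),
      φ (algebraMap _ _ a) = algebraMap _ _ (π.stalkMap x a))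
    (hv : ExtendsAdicOrder (φ.toRingHom.comp (algebraMap (Y.presheaf.stalk p) _)) v)
    {x : X} (hx : π x = p) {e : (FunField X)ˣ}
    (he : IsLocalGenerator ((pointIdeal p hp).comap π) x e) : v e = exp (-1) := by
  have hle := fun f ↦ hπ.valuation_le_one_of_mem_stalkRange hφ hv hx ⟨f, rfl⟩
  subst hx
  obtain ⟨e₀, he₀, h⟩ := he.exists_map_maximalIdeal_eq
  have hne : e₀ ≠ 0 := (map_ne_zero_iff _ (IsFractionRing.injective _ _)).mp (he₀ ▸ e.ne_zero)
  rw [← he₀]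
  exact (hv.comap_algebraMap_stalk hφ).map_generator hne h hle

-- The generic point of the exceptional divisor is the centre of `v` on the blow-up.
theorem IsBlowUp.exists_forall_specializes (hπ : IsBlowUp (pointIdeal p hp) π)
    (hφ : ∀ (x : X) (a : Y.presheaf.stalk (π x)),
      φ (algebraMap _ _ a) = algebraMap _ _ (π.stalkMap x a))
    (hv : ExtendsAdicOrder (φ.toRingHom.comp (algebraMap (Y.presheaf.stalk p) _)) v)
    {a : Y.presheaf.stalk p} (ha : a ∈ maximalIdeal (Y.presheaf.stalk p))
    (ha' : a ∉ maximalIdeal (Y.presheaf.stalk p) ^ 2) :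
    ∃ η : X, π η = p ∧ ∀ x, π x = p → η ⤳ x := by
  let B := v.valuationSubring.toSubring
  have : IsLocalRing B := inferInstanceAs (IsLocalRing v.valuationSubring)
  let φ' : Y.presheaf.stalk p ⟶ CommRingCat.of B :=
    CommRingCat.ofHom (RingHom.codRestrict _ B hv.map_le_one)
  have : IsLocalHom φ'.hom := hv.isLocalHom_codRestrict
  have hva := hv.map_eq_exp (i := 1) (by rwa [pow_one]) ha'
  have hb : φ' a ≠ 0 := fun h0 ↦ v.ne_zero_iff.mp (hva ▸ exp_ne_zero) (congrArg Subtype.val h0)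
  have hlift := hπ.existsUnique_lift_Spec φ' hb (hv.map_codRestrict ha ha')
  obtain ⟨g, hg, -⟩ := id hlift
  refine ⟨g (closedPoint B), ?_, ?_⟩
  · calc π (g (closedPoint B)) = Y.fromSpecStalk p (PrimeSpectrum.comap φ'.hom (closedPoint B)) :=
          congrArg (fun f ↦ f.base (closedPoint B)) hg
      _ = p := by rw [comap_closedPoint φ'.hom]; exact Scheme.fromSpecStalk_closedPoint
  · rintro x rfl
    let ι : X.presheaf.stalk x ⟶ CommRingCat.of B :=
      CommRingCat.ofHom ((algebraMap (X.presheaf.stalk x) (FunField X)).codRestrict B fun f ↦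
        hπ.valuation_le_one_of_mem_stalkRange hφ hv rfl ⟨f, rfl⟩)
    have hι : π.stalkMap x ≫ ι = φ' := by
      ext a
      exact (hφ x a).symm
    have hgι : Spec.map ι ≫ X.fromSpecStalk x = g := by
      refine hlift.unique ?_ hg
      rw [Category.assoc, ← Scheme.SpecMap_stalkMap_fromSpecStalk, ← Spec.map_comp_assoc, hι]
    rw [← hgι]
    exact fromSpecStalk_specializes x (Spec.map ι (closedPoint B))

theorem IsBlowUp.exists_isBlowUpModel (hπ : IsBlowUp (pointIdeal p hp) π)
    {v₀ : Valuation (FunField Y) ℤᵐ⁰}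
    (hv₀ : ExtendsAdicOrder (algebraMap (Y.presheaf.stalk p) (FunField Y)) v₀)
    {a : Y.presheaf.stalk p} (ha : a ∈ maximalIdeal (Y.presheaf.stalk p))
    (ha' : a ∉ maximalIdeal (Y.presheaf.stalk p) ^ 2) :
    ∃ φ v η, IsBlowUpModel π p ((pointIdeal p hp).comap π) φ v η := by
  have hbot : maximalIdeal (Y.presheaf.stalk p) ≠ ⊥ := fun h ↦ by
    obtain rfl : a = 0 := by rwa [h, Ideal.mem_bot] at ha
    exact ha' (zero_mem _)
  obtain ⟨φ, hφ⟩ := hπ.exists_funFieldEquiv (exists_ne_of_maximalIdeal_ne_bot hbot)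
  let v := v₀.comap φ.symm.toRingHom
  have hv : ExtendsAdicOrder (φ.toRingHom.comp (algebraMap (Y.presheaf.stalk p) _)) v :=
    fun a i ↦ by
      rw [← hv₀ a i]
      exact (congrArg (v₀ · ≤ _) (φ.symm_apply_apply _)).to_iff
  obtain ⟨η, hη, hηs⟩ := hπ.exists_forall_specializes hφ hv ha ha'
  refine ⟨φ, v, η, ?_, ?_, hπ.exists_eq, hπ.exists_preimage_le, hη, hηs _,
    IsLocalGenerator.mem_unitsAt, hπ.valuation_le_one_of_mem_stalkRange hφ hv,
    fun he hz _ ↦ hπ.mul_inv_mem_stalkRange hφ hv hz he,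
    fun he hz ↦ hπ.valuation_generator hφ hv hz he, ?_⟩
  · rintro z _ ⟨a, rfl⟩
    exact ⟨_, (hφ z a).symm⟩
  · rintro z f hz ⟨a, ha⟩
    have := hπ.isIso_stalkMap hz
    refine ⟨inv (π.stalkMap z) a, φ.injective ?_⟩
    rw [hφ, ← ha, ← CommRingCat.comp_apply, IsIso.inv_hom_id]
    rfl
  · rintro x e he rfl
    obtain ⟨e₀, he₀, -⟩ := he.exists_map_maximalIdeal_eq
    exact ⟨e₀, he₀⟩

end OverCentre

/-! ### Divisors on the blow-up -/

section LocalEquations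

variable {X : Scheme.{u}} [IsIntegral X]

theorem CaDiv.ext {D D' : CaDiv X} (h : ∀ x, D.germ x = D'.germ x) : D = D' :=
  Subtype.ext (funext h)

theorem CaDiv.germ_neg (D : CaDiv X) (x : X) : (-D).germ x = (D.germ x)⁻¹ := rfl

theorem CaDiv.germ_zsmul (k : ℤ) (D : CaDiv X) (x : X) : (k • D).germ x = D.germ x ^ k := rfl

/-- The Cartier divisor with local equation `g x` at each point `x`. -/
def CaDiv.mk (g : X → (FunField X)ˣ)
    (h : ∀ x, ∃ U : X.Opens, x ∈ U ∧ ∀ y ∈ U, g x / g y ∈ unitsAt X y) : CaDiv X :=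
  Additive.ofMul (α := cartierSubgroup X) ⟨fun x ↦ QuotientGroup.mk (g x), fun x ↦ by
    obtain ⟨U, hx, hU⟩ := h x
    refine ⟨U, hx, g x, fun y hy ↦ ?_⟩
    rw [QuotientGroup.eq, mul_comm, ← div_eq_mul_inv]
    exact hU y hy⟩

theorem isLocalEq_mk (g : X → (FunField X)ˣ) (h) (x : X) : IsLocalEq (CaDiv.mk g h) x (g x) := rfl

theorem isLocalEq_principal (f : (FunField X)ˣ) (x : X) :
    IsLocalEq (principal X (Additive.ofMul f)) x f := rfl

theorem exists_isLocalEq (D : CaDiv X) (x : X) : ∃ g, IsLocalEq D x g :=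
  (QuotientGroup.mk_surjective (D.germ x)).imp fun _ h ↦ h.symm

variable {D D' : CaDiv X} {x : X} {g g' : (FunField X)ˣ}

theorem IsLocalEq.add (h : IsLocalEq D x g) (h' : IsLocalEq D' x g') :
    IsLocalEq (D + D') x (g * g') := by
  rw [IsLocalEq, CaDiv.germ_add, h, h', QuotientGroup.mk_mul]

theorem IsLocalEq.zsmul (h : IsLocalEq D x g) (k : ℤ) : IsLocalEq (k • D) x (g ^ k) := by
  rw [IsLocalEq, CaDiv.germ_zsmul, h, QuotientGroup.mk_zpow]

theorem IsLocalEq.iff_div_mem (h : IsLocalEq D x g) :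
    IsLocalEq D x g' ↔ g' / g ∈ unitsAt X x := by
  rw [IsLocalEq, h, QuotientGroup.eq, mul_comm, ← div_eq_mul_inv]

theorem IsLocalEq.germ_eq_one_iff (h : IsLocalEq D x g) : D.germ x = 1 ↔ g ∈ unitsAt X x := by
  rw [h, QuotientGroup.eq_one_iff]

theorem exists_open_forall_mem_unitsAt (hg : g ∈ unitsAt X x) :
    ∃ U : X.Opens, x ∈ U ∧ ∀ y ∈ U, g ∈ unitsAt X y := by
  obtain ⟨hg, hg'⟩ := mem_unitsAt.mp hg
  obtain ⟨V, hxV, hV⟩ := exists_open_forall_mem_stalkRange hg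
  obtain ⟨V', hxV', hV'⟩ := exists_open_forall_mem_stalkRange hg'
  exact ⟨V ⊓ V', ⟨hxV, hxV'⟩, fun y hy ↦ mem_unitsAt.mpr ⟨hV y hy.1, hV' y hy.2⟩⟩

theorem IsLocalEq.exists_open (h : IsLocalEq D x g) :
    ∃ U : X.Opens, x ∈ U ∧ ∀ y ∈ U, IsLocalEq D y g := by
  obtain ⟨U, hxU, g₀, (hg₀ : ∀ y ∈ U, IsLocalEq D y g₀)⟩ :=
    (Additive.toMul (α := cartierSubgroup X) D).2 x
  obtain ⟨V, hxV, hV⟩ := exists_open_forall_mem_unitsAt ((hg₀ x hxU).iff_div_mem.mp h)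
  exact ⟨U ⊓ V, ⟨hxU, hxV⟩, fun y hy ↦ (hg₀ y hy.1).iff_div_mem.mpr (hV y hy.2)⟩

theorem isLocalEq_divisorOfIdeal {I : X.IdealSheafData} (hI : IsInvertibleIdeal I)
    (hg : IsLocalGenerator I x g) : IsLocalEq (divisorOfIdeal I hI) x g :=
  (exists_isLocalGenerator hI x).choose_spec.mk_eq hg

theorem mem_H0_iff_exists {f : FunField X} :
    f ∈ H0 D ↔ ∀ x, ∃ g, IsLocalEq D x g ∧ f * g ∈ stalkRange x := by
  refine ⟨fun hf x ↦ (exists_isLocalEq D x).imp fun g hg ↦ ⟨hg, hf x g hg⟩, fun h x g hg ↦ ?_⟩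
  obtain ⟨g', hg', hfg'⟩ := h x
  have hdiv : ((g / g' : (FunField X)ˣ) : FunField X) ∈ stalkRange x :=
    (mem_unitsAt.mp (hg'.iff_div_mem.mp hg)).1
  rw [← mul_div_cancel g' g, Units.val_mul, ← mul_assoc]
  exact mul_mem hfg' hdiv

theorem mul_mem_H0_iff {f : FunField X} (h : (FunField X)ˣ) :
    f * h ∈ H0 D ↔ f ∈ H0 (D + principal X (Additive.ofMul h)) := by
  refine ⟨fun hf ↦ mem_H0_iff_exists.mpr fun x ↦ ?_, fun hf x g hg ↦ ?_⟩
  · obtain ⟨g, hg⟩ := exists_isLocalEq D x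
    refine ⟨g * h, hg.add (isLocalEq_principal h x), ?_⟩
    rw [Units.val_mul, mul_comm (g : FunField X), ← mul_assoc]
    exact hf x g hg
  · have hfg := hf x (g * h) (hg.add (isLocalEq_principal h x))
    rwa [Units.val_mul, mul_comm (g : FunField X), ← mul_assoc] at hfg

end LocalEquations

section Pullback

open WithZero

variable {X Y : Scheme.{u}} [IsIntegral X] [IsIntegral Y] {π : X ⟶ Y} {p : Y}
  {I : X.IdealSheafData} {φ : FunField Y ≃+* FunField X} {v : Valuation (FunField X) ℤᵐ⁰} {η : X}

namespace IsBlowUpModel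

variable (M : IsBlowUpModel π p I φ v η)

include M

theorem map_mem_unitsAt {x : X} {f : (FunField Y)ˣ} (hf : f ∈ unitsAt Y (π x)) :
    Units.mapEquiv φ.toMulEquiv f ∈ unitsAt X x := by
  rw [mem_unitsAt] at hf ⊢
  rw [← map_inv]
  exact ⟨M.map_mem hf.1, M.map_mem hf.2⟩

theorem mem_unitsAt_of_map_mem {x : X} (hx : π x ≠ p) {f : (FunField Y)ˣ}
    (hf : Units.mapEquiv φ.toMulEquiv f ∈ unitsAt X x) : f ∈ unitsAt Y (π x) := by
  rw [mem_unitsAt] at hf ⊢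
  rw [← map_inv] at hf
  exact ⟨M.mem_of_map_mem hx hf.1, M.mem_of_map_mem hx hf.2⟩

/-- The pullback of local equations along the blow-up. -/
def germMap (x : X) : (FunField Y)ˣ ⧸ unitsAt Y (π x) →* (FunField X)ˣ ⧸ unitsAt X x :=
  QuotientGroup.map (unitsAt Y (π x)) (unitsAt X x) (Units.mapEquiv φ.toMulEquiv).toMonoidHom
    fun _ h ↦ M.map_mem_unitsAt h

/-- The pullback of Cartier divisors along the blow-up. -/
def pullback : CaDiv Y →+ CaDiv X where
  toFun D := Additive.ofMul (α := cartierSubgroup X) ⟨fun x ↦ M.germMap x (D.germ (π x)), fun x ↦ by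
    obtain ⟨g, hg⟩ := exists_isLocalEq D (π x)
    obtain ⟨U, hx, hU⟩ := hg.exists_open
    exact ⟨π ⁻¹ᵁ U, hx, Units.mapEquiv φ.toMulEquiv g, fun y hy ↦
      congrArg (M.germMap y) (hU (π y) hy)⟩⟩
  map_zero' := CaDiv.ext fun x ↦ map_one (M.germMap x)
  map_add' D D' := CaDiv.ext fun x ↦ map_mul (M.germMap x) (D.germ (π x)) (D'.germ (π x))

theorem isLocalEq_pullback {D : CaDiv Y} {x : X} {g : (FunField Y)ˣ} (hg : IsLocalEq D (π x) g) :
    IsLocalEq (M.pullback D) x (Units.mapEquiv φ.toMulEquiv g) :=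
  congrArg (M.germMap x) hg

theorem pullback_principal (f : (FunField Y)ˣ) :
    M.pullback (principal Y (Additive.ofMul f)) =
      principal X (Additive.ofMul (Units.mapEquiv φ.toMulEquiv f)) :=
  rfl

theorem valuation_eq_one {x : X} (hx : π x = p) {f : (FunField X)ˣ} (hf : f ∈ unitsAt X x) :
    v f = 1 := by
  rw [mem_unitsAt] at hf
  have hinv : (v f)⁻¹ ≤ 1 := by
    rw [← map_inv₀, ← Units.val_inv_eq_inv_val]
    exact M.valuation_le_one hx hf.2
  exact le_antisymm (M.valuation_le_one hx hf.1)
    ((inv_le_one₀ (zero_lt_iff.mpr ((v.ne_zero_iff).mpr f.ne_zero))).mp hinv)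

theorem mem_stalkRange_of_pow_mul_mem {x : X} (hx : π x = p) {e : (FunField X)ˣ}
    (he : IsLocalGenerator I x e) {f : FunField X} (hf : v f ≤ 1) {N : ℕ}
    (h : (e : FunField X) ^ N * f ∈ stalkRange x) : f ∈ stalkRange x := by
  induction N with
  | zero => simpa only [pow_zero, one_mul] using h
  | succ N ih =>
    apply ih
    have hlt : v ((e : FunField X) ^ (N + 1) * f) < 1 := by
      rw [map_mul, map_pow, M.valuation_generator he hx]
      exact mul_lt_one_of_lt_of_le
        (pow_lt_one₀ zero_le (exp_lt_exp.mpr neg_one_lt_zero) N.succ_ne_zero) hf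
    have hdiv := M.mul_inv_mem he hx h hlt
    rwa [pow_succ, mul_right_comm, mul_assoc _ (e : FunField X), Units.mul_inv, mul_one] at hdiv

theorem mem_stalkRange_of_forall {x : X} (hx : π x = p) {e : (FunField X)ˣ}
    (he : IsLocalGenerator I x e) {f : FunField X} (hf : v f ≤ 1)
    (H : ∀ y, y ⤳ x → π y ≠ p → f ∈ stalkRange y) : f ∈ stalkRange x := by
  have hoff : ∀ y, y ⤳ x → (e : FunField X)⁻¹ ∈ stalkRange y → π y ≠ p := by
    intro y hyx hey hy
    obtain ⟨U, hxU, hU⟩ := he.exists_open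
    have hle := M.valuation_le_one hy hey
    rw [map_inv₀, M.valuation_generator (hU y (hyx.mem_open U.2 hxU)) hy] at hle
    exact absurd hle (by simp [← exp_neg, ← exp_zero])
  obtain ⟨N, hN⟩ := exists_pow_mul_mem_stalkRange (M.generator_mem he hx)
    fun y hyx hey ↦ H y hyx (hoff y hyx hey)
  exact M.mem_stalkRange_of_pow_mul_mem hx he hf hN

theorem mem_unitsAt_of_forall {x : X} (hx : π x = p) {e : (FunField X)ˣ}
    (he : IsLocalGenerator I x e) {f : (FunField X)ˣ} (hf : v f = 1)
    (H : ∀ y, y ⤳ x → π y ≠ p → f ∈ unitsAt X y) : f ∈ unitsAt X x := by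
  have hf' : v ((f⁻¹ : (FunField X)ˣ) : FunField X) = 1 := by
    rw [Units.val_inv_eq_inv_val, map_inv₀, hf, inv_one]
  exact mem_unitsAt.mpr
    ⟨M.mem_stalkRange_of_forall hx he hf.le fun y hyx hy ↦ (mem_unitsAt.mp (H y hyx hy)).1,
      M.mem_stalkRange_of_forall hx he hf'.le fun y hyx hy ↦ (mem_unitsAt.mp (H y hyx hy)).2⟩

theorem valuation_eq_of_isLocalEq {D : CaDiv X} {x : X} (hx : π x = p) {g gη : (FunField X)ˣ}
    (hg : IsLocalEq D x g) (hgη : IsLocalEq D η gη) : v g = v gη := by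
  obtain ⟨U, hxU, hU⟩ := hg.exists_open
  have hdiv := M.valuation_eq_one M.map_center
    (hgη.iff_div_mem.mp (hU η ((M.specializes hx).mem_open U.2 hxU)))
  rw [Units.val_div_eq_div_val, map_div₀] at hdiv
  exact (div_eq_one_iff_eq (v.ne_zero_iff.mpr gη.ne_zero)).mp hdiv

theorem eq_zero_of_forall_germ_eq_one (hI : IsInvertibleIdeal I) {D : CaDiv X}
    (hD : ∀ x, π x ≠ p → D.germ x = 1) {gη : (FunField X)ˣ} (hgη : IsLocalEq D η gη)
    (hv : v gη = 1) : D = 0 := by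
  refine CaDiv.ext fun x ↦ ?_
  by_cases hx : π x = p
  · obtain ⟨g, hg⟩ := exists_isLocalEq D x
    obtain ⟨e, he⟩ := exists_isLocalGenerator hI x
    obtain ⟨U, hxU, hU⟩ := hg.exists_open
    refine hg.germ_eq_one_iff.mpr (M.mem_unitsAt_of_forall hx he ?_ fun y hyx hy ↦ ?_)
    · rw [M.valuation_eq_of_isLocalEq hx hg hgη, hv]
    · exact (hU y (hyx.mem_open U.2 hxU)).germ_eq_one_iff.mp (hD y hy)
  · exact hD x hx

theorem germ_zsmul_divisorOfIdeal (hI : IsInvertibleIdeal I) (k : ℤ) {x : X} (hx : π x ≠ p) :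
    (k • divisorOfIdeal I hI).germ x = 1 := by
  obtain ⟨e, he⟩ := exists_isLocalGenerator hI x
  exact ((isLocalEq_divisorOfIdeal hI he).zsmul k).germ_eq_one_iff.mpr
    (zpow_mem (M.generator_mem_unitsAt he hx) k)

theorem exists_eq_zsmul (hI : IsInvertibleIdeal I) {D : CaDiv X}
    (hD : ∀ x, π x ≠ p → D.germ x = 1) : ∃ k : ℤ, D = k • divisorOfIdeal I hI := by
  obtain ⟨g, hg⟩ := exists_isLocalEq D η
  obtain ⟨e, he⟩ := exists_isLocalGenerator hI η
  let k := log (v g)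
  refine ⟨-k, ?_⟩
  rw [neg_smul, eq_neg_iff_add_eq_zero]
  refine M.eq_zero_of_forall_germ_eq_one hI (fun x hx ↦ ?_)
    (hg.add ((isLocalEq_divisorOfIdeal hI he).zsmul k)) ?_
  · rw [CaDiv.germ_add, hD x hx, M.germ_zsmul_divisorOfIdeal hI k hx]
    exact mul_one (1 : (FunField X)ˣ ⧸ unitsAt X x)
  · have hk : v g = exp k := (exp_log (v.ne_zero_iff.mpr g.ne_zero)).symm
    rw [Units.val_mul, Units.val_zpow_eq_zpow_val, map_mul, map_zpow₀, hk,
      M.valuation_generator he M.map_center, ← exp_zsmul, ← exp_add, ← exp_zero]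
    simp

end IsBlowUpModel

end Pullback

section Topology

open TopologicalSpace

theorem exists_mem_specializes_of_mem_closure_of_noetherianSpace {T : Type*} [TopologicalSpace T]
    [NoetherianSpace T] [QuasiSober T] {Z : Set T} {p : T} (hp : IsClosed ({p} : Set T))
    (hZ : IsClosed (Z ∪ {p})) (hpZ : p ∈ closure Z) : ∃ z ∈ Z, z ⤳ p := by
  by_contra! h
  obtain ⟨S, hS, hSc, hSi, hSZ⟩ := NoetherianSpace.exists_finite_set_isClosed_irreducible hZ
  have hN : IsClosed (⋃ C ∈ {C ∈ S | p ∉ C}, C) :=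
    (hS.subset (Set.sep_subset _ _)).isClosed_biUnion fun C hC ↦ hSc C hC.1
  have hZN : Z ⊆ ⋃ C ∈ {C ∈ S | p ∉ C}, C := by
    intro z hz
    obtain ⟨C, hC, hzC⟩ : z ∈ ⋃₀ S := hSZ ▸ Or.inl hz
    refine Set.mem_biUnion ⟨hC, fun hpC ↦ ?_⟩ hzC
    obtain ⟨c, hc⟩ := QuasiSober.sober (hSi C hC) (hSc C hC)
    have hcZ : c ∈ Z ∪ {p} := hSZ ▸ Set.mem_sUnion_of_mem hc.mem hC
    rcases hcZ with hcZ | rfl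
    · exact h c hcZ (hc.specializes hpC)
    · exact h z hz (specializes_of_eq ((hc.specializes hzC).mem_closed hp rfl))
  obtain ⟨C, hC, hpC⟩ := Set.mem_iUnion₂.mp (closure_minimal hZN hN hpZ)
  exact hC.2 hpC

theorem exists_mem_specializes_of_mem_closure {Y : Scheme.{u}} [IsLocallyNoetherian Y]
    {Z : Set Y} {p : Y} (hp : IsClosed ({p} : Set Y)) (hZ : IsClosed (Z ∪ {p}))
    (hpZ : p ∈ closure Z) : ∃ z ∈ Z, z ⤳ p := by
  obtain ⟨V, hV, hpV, -⟩ := exists_affine_mem_le (show p ∈ (⊤ : Y.Opens) from trivial)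
  have : IsNoetherianRing Γ(Y, V) := IsLocallyNoetherian.component_noetherian ⟨V, hV⟩
  have : NoetherianSpace (V : Set Y) := noetherianSpace_of_isAffineOpen V hV
  have : QuasiSober (V : Set Y) := V.2.isOpenEmbedding_subtypeVal.quasiSober
  have hp' : (Subtype.val : ↥(V : Set Y) → Y) ⁻¹' {p} = {⟨p, hpV⟩} := by
    ext z
    simp only [Set.mem_preimage, Set.mem_singleton_iff, Subtype.ext_iff]
  obtain ⟨z, hz, hzp⟩ := exists_mem_specializes_of_mem_closure_of_noetherianSpace
    (Z := (Subtype.val : ↥(V : Set Y) → Y) ⁻¹' Z) (p := ⟨p, hpV⟩)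
    (hp' ▸ hp.preimage continuous_subtype_val) (hp' ▸ hZ.preimage continuous_subtype_val)
    (V.2.isOpenMap_subtype_val.preimage_closure_eq_closure_preimage continuous_subtype_val Z ▸ hpZ)
  exact ⟨_, hz, hzp.map continuous_subtype_val⟩

end Topology

section Hartogs

variable {Y : Scheme.{u}} [IsIntegral Y] {p : Y} [IsNoetherianRing (Y.presheaf.stalk p)]
  {ι : Type*} [Finite ι] [Nontrivial ι] {x : ι → Y.presheaf.stalk p}

theorem IsRegularSystem.mem_stalkRange_of_forall (hx : IsRegularSystem x) {f : FunField Y}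
    (hf : ∀ y, y ⤳ p → y ≠ p → f ∈ stalkRange y) : f ∈ stalkRange p := by
  have hf' : f ∈ (1 : Submodule (Y.presheaf.stalk p) (FunField Y)) := by
    refine hx.mem_one_of_forall_mem_localSubalgebra fun q hq ↦ ?_
    rw [← primeOfSpecializes_fromSpecStalk p q] at hq ⊢
    rw [mem_localSubalgebra_primeOfSpecializes]
    exact hf _ (fromSpecStalk_specializes p q)
      (mt (primeOfSpecializes_eq_closedPoint_iff _).mpr hq)
  exact Submodule.mem_one.mp hf'

theorem IsRegularSystem.mem_unitsAt_of_forall (hx : IsRegularSystem x) {f : (FunField Y)ˣ}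
    (hf : ∀ y, y ⤳ p → y ≠ p → f ∈ unitsAt Y y) : f ∈ unitsAt Y p :=
  mem_unitsAt.mpr
    ⟨hx.mem_stalkRange_of_forall fun y hyp hy ↦ (mem_unitsAt.mp (hf y hyp hy)).1,
      hx.mem_stalkRange_of_forall fun y hyp hy ↦ (mem_unitsAt.mp (hf y hyp hy)).2⟩

end Hartogs

section Extension

variable {Y : Scheme.{u}} [IsIntegral Y] {p : Y}

/-- The family `g` consists of local equations of a Cartier divisor on the complement of `p`;
the value `g p` is arbitrary. -/
def IsCartierOff (p : Y) (g : Y → (FunField Y)ˣ) : Prop :=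
  ∀ y ≠ p, ∃ U : Y.Opens, y ∈ U ∧ ∀ z ∈ U, z ≠ p → g y / g z ∈ unitsAt Y z

namespace IsCartierOff

variable {g : Y → (FunField Y)ˣ} (hg : IsCartierOff p g)

include hg

theorem isCartierOn : IsCartierOn {IsLocalRing.closedPoint (Y.presheaf.stalk p)}ᶜ
    fun q ↦ g (Y.fromSpecStalk p q) := by
  have hne : ∀ {q : PrimeSpectrum (Y.presheaf.stalk p)}, q ≠ IsLocalRing.closedPoint _ →
      Y.fromSpecStalk p q ≠ p := fun {q} hq ↦ by
    rw [← primeOfSpecializes_fromSpecStalk p q] at hq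
    exact mt (primeOfSpecializes_eq_closedPoint_iff _).mpr hq
  intro q hq
  obtain ⟨U, hqU, hU⟩ := hg _ (hne hq)
  obtain ⟨_, ⟨s, rfl⟩, hqs, hsU⟩ :=
    PrimeSpectrum.isTopologicalBasis_basic_opens.exists_subset_of_mem_open
      (show q ∈ Y.fromSpecStalk p ⁻¹' U from hqU)
      (U.2.preimage (Y.fromSpecStalk p).continuous)
  refine ⟨s, hqs, fun q' hq' hs ↦ ?_⟩
  have hunit := hU _ (hsU hs) (hne hq')
  rwa [← mem_localUnits_primeOfSpecializes (fromSpecStalk_specializes p q'),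
    primeOfSpecializes_fromSpecStalk] at hunit

theorem isClosed_notMem_unitsAt_union (hp : IsClosed ({p} : Set Y)) (f : (FunField Y)ˣ) :
    IsClosed ({y | y ≠ p ∧ f * g y ∉ unitsAt Y y} ∪ {p}) := by
  rw [← isOpen_compl_iff, isOpen_iff_forall_mem_open]
  intro y hy
  simp only [Set.mem_compl_iff, Set.mem_union, Set.mem_ofPred_eq, Set.mem_singleton_iff, not_or,
    not_and, not_not] at hy
  obtain ⟨U, hyU, hU⟩ := hg y hy.2
  obtain ⟨V, hyV, hV⟩ := exists_open_forall_mem_unitsAt (hy.1 hy.2)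
  refine ⟨U ∩ V ∩ {p}ᶜ, ?_, (U.2.inter V.2).inter hp.isOpen_compl, ⟨hyU, hyV⟩, hy.2⟩
  rintro z ⟨⟨hzU, hzV⟩, hzp⟩ (⟨-, hz⟩ | hz)
  · refine hz ?_
    have hdiv := div_mem (hV z hzV) (hU z hzU hzp)
    rwa [mul_div_assoc, div_div_cancel] at hdiv
  · exact hzp hz

variable [IsNoetherianRing (Y.presheaf.stalk p)] {ι : Type*} [Finite ι] [Nontrivial ι]
  {x : ι → Y.presheaf.stalk p}

theorem exists_mul_mem_unitsAt (hx : IsRegularSystem x) :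
    ∃ f : (FunField Y)ˣ, ∀ y, y ⤳ p → y ≠ p → f * g y ∈ unitsAt Y y := by
  obtain ⟨f, hf⟩ := hx.exists_mul_mem_localUnits hg.isCartierOn
  refine ⟨f, fun y hyp hy ↦ ?_⟩
  have hunit := hf (primeOfSpecializes hyp)
    (mt (primeOfSpecializes_eq_closedPoint_iff hyp).mp hy)
  rwa [mem_localUnits_primeOfSpecializes, fromSpecStalk_primeOfSpecializes] at hunit

theorem exists_open_forall_mul_mem_unitsAt [IsLocallyNoetherian Y] (hp : IsClosed ({p} : Set Y))
    (hx : IsRegularSystem x) : ∃ (f : (FunField Y)ˣ) (W : Y.Opens), p ∈ W ∧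
      ∀ z ∈ W, z ≠ p → f * g z ∈ unitsAt Y z := by
  obtain ⟨f, hf⟩ := hg.exists_mul_mem_unitsAt hx
  refine ⟨f, ⟨(closure {y | y ≠ p ∧ f * g y ∉ unitsAt Y y})ᶜ, isClosed_closure.isOpen_compl⟩,
    fun hpZ ↦ ?_, fun z hz hzp ↦ ?_⟩
  · obtain ⟨z, ⟨hzp, hz⟩, hzs⟩ := exists_mem_specializes_of_mem_closure hp
      (hg.isClosed_notMem_unitsAt_union hp f) hpZ
    exact hz (hf z hzs hzp)
  · by_contra h
    exact hz (subset_closure ⟨hzp, h⟩)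

theorem exists_caDiv [IsLocallyNoetherian Y] (hp : IsClosed ({p} : Set Y))
    (hx : IsRegularSystem x) : ∃ D : CaDiv Y, ∀ y ≠ p, IsLocalEq D y (g y) := by
  classical
  obtain ⟨f, W, hpW, hW⟩ := hg.exists_open_forall_mul_mem_unitsAt hp hx
  have hcartier : ∀ y, ∃ U : Y.Opens, y ∈ U ∧
      ∀ z ∈ U, Function.update g p f⁻¹ y / Function.update g p f⁻¹ z ∈ unitsAt Y z := by
    intro y
    by_cases hy : y = p
    · subst hy
      refine ⟨W, hpW, fun z hz ↦ ?_⟩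
      by_cases hzy : z = y
      · rw [hzy, div_self']
        exact one_mem _
      · rw [Function.update_self, Function.update_of_ne hzy, div_eq_mul_inv, ← mul_inv]
        exact inv_mem (hW z hz hzy)
    · obtain ⟨U, hyU, hU⟩ := hg y hy
      refine ⟨U ⊓ ⟨{p}ᶜ, hp.isOpen_compl⟩, ⟨hyU, hy⟩, fun z hz ↦ ?_⟩
      rw [Function.update_of_ne hy, Function.update_of_ne hz.2]
      exact hU z hz.1 hz.2
  refine ⟨CaDiv.mk _ hcartier, fun y hy ↦ ?_⟩
  have hmk := isLocalEq_mk _ hcartier y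
  rwa [Function.update_of_ne hy] at hmk

end IsCartierOff

end Extension

section Decomposition

open WithZero

variable {X Y : Scheme.{u}} [IsIntegral X] [IsIntegral Y] {π : X ⟶ Y} {p : Y}
  {I : X.IdealSheafData} {φ : FunField Y ≃+* FunField X} {v : Valuation (FunField X) ℤᵐ⁰} {η : X}

namespace IsBlowUpModel

variable (M : IsBlowUpModel π p I φ v η)

include M

theorem eq_of_map_eq {z z' : X} (h : π z = π z') (hz' : π z' ≠ p) : z = z' := by
  have hspec : ∀ {a b : X}, π a = π b → π b ≠ p → a ⤳ b := fun {a b} hab hb ↦ by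
    rw [specializes_iff_forall_open]
    intro W hW hbW
    obtain ⟨V, hbV, -, hV⟩ := M.exists_preimage_le hb (W := ⟨W, hW⟩) hbW
    exact hV (show π a ∈ V from hab ▸ hbV)
  exact ((hspec h hz').antisymm (hspec h.symm (h ▸ hz'))).eq

theorem isLocalEq_pullback_add (hI : IsInvertibleIdeal I) {D' : CaDiv Y} {k : ℤ} {z : X}
    {g : (FunField Y)ˣ} (hg : IsLocalEq D' (π z) g) {e : (FunField X)ˣ}
    (he : IsLocalGenerator I z e) :
    IsLocalEq (M.pullback D' + k • divisorOfIdeal I hI) z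
      (Units.mapEquiv φ.toMulEquiv g * e ^ k) :=
  (M.isLocalEq_pullback hg).add ((isLocalEq_divisorOfIdeal hI he).zsmul k)

theorem map_mem_H0 (hI : IsInvertibleIdeal I) {D' : CaDiv Y} {k : ℤ} (hk : 0 ≤ k) {f : FunField Y}
    (hf : f ∈ H0 D') : φ f ∈ H0 (M.pullback D' + k • divisorOfIdeal I hI) := by
  refine mem_H0_iff_exists.mpr fun z ↦ ?_
  obtain ⟨g, hg⟩ := exists_isLocalEq D' (π z)
  obtain ⟨e, he⟩ := exists_isLocalGenerator hI z
  have hez : (e : FunField X) ∈ stalkRange z := by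
    by_cases hz : π z = p
    · exact M.generator_mem he hz
    · exact (mem_unitsAt.mp (M.generator_mem_unitsAt he hz)).1
  have hfg := M.map_mem (hf _ g hg)
  rw [map_mul] at hfg
  refine ⟨_, M.isLocalEq_pullback_add hI hg he, ?_⟩
  lift k to ℕ using hk
  rw [Units.val_mul, ← mul_assoc, zpow_natCast, Units.val_pow_eq_pow_val]
  exact mul_mem hfg (pow_mem hez k)

theorem mul_mem_of_mem_H0 (hI : IsInvertibleIdeal I) {D' : CaDiv Y} {k : ℤ} {f : FunField X}
    (hf : f ∈ H0 (M.pullback D' + k • divisorOfIdeal I hI)) {y : Y} (hy : y ≠ p)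
    {g : (FunField Y)ˣ} (hg : IsLocalEq D' y g) : φ.symm f * g ∈ stalkRange y := by
  obtain ⟨z, rfl⟩ := M.exists_eq hy
  obtain ⟨e, he⟩ := exists_isLocalGenerator hI z
  have hfg := mul_mem (hf z _ (M.isLocalEq_pullback_add hI hg he))
    (mem_unitsAt.mp (zpow_mem (M.generator_mem_unitsAt he hy) k)).2
  rw [mul_assoc, ← Units.val_mul, mul_inv_cancel_right] at hfg
  apply M.mem_of_map_mem hy
  rw [map_mul, φ.apply_symm_apply]
  exact hfg

theorem germ_eq_one_of_germ_pullback_eq_one {D' : CaDiv Y} {z : X} (hz : π z ≠ p)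
    (h : (M.pullback D').germ z = 1) : D'.germ (π z) = 1 := by
  obtain ⟨g, hg⟩ := exists_isLocalEq D' (π z)
  exact hg.germ_eq_one_iff.mpr
    (M.mem_unitsAt_of_map_mem hz ((M.isLocalEq_pullback hg).germ_eq_one_iff.mp h))

variable [IsNoetherianRing (Y.presheaf.stalk p)] {ι : Type*} [Finite ι] [Nontrivial ι]
  {x : ι → Y.presheaf.stalk p}

theorem symm_mem_H0 (hI : IsInvertibleIdeal I) (hx : IsRegularSystem x) {D' : CaDiv Y} {k : ℤ}
    {f : FunField X} (hf : f ∈ H0 (M.pullback D' + k • divisorOfIdeal I hI)) :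
    φ.symm f ∈ H0 D' := by
  intro y g hg
  by_cases hy : y = p
  · subst hy
    obtain ⟨U, hyU, hU⟩ := hg.exists_open
    exact hx.mem_stalkRange_of_forall fun z hz hzy ↦
      M.mul_mem_of_mem_H0 hI hf hzy (hU z (hz.mem_open U.2 hyU))
  · exact M.mul_mem_of_mem_H0 hI hf hy hg

theorem eq_zero_of_pullback_add_eq_zero (hI : IsInvertibleIdeal I) (hx : IsRegularSystem x)
    {D' : CaDiv Y} {k : ℤ} (h : M.pullback D' + k • divisorOfIdeal I hI = 0) :
    D' = 0 ∧ k = 0 := by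
  have hoff : ∀ y, y ≠ p → D'.germ y = 1 := by
    intro y hy
    obtain ⟨z, rfl⟩ := M.exists_eq hy
    refine M.germ_eq_one_of_germ_pullback_eq_one hy ?_
    rw [eq_neg_of_add_eq_zero_left h, ← neg_smul, M.germ_zsmul_divisorOfIdeal hI _ hy]
  have hD' : D' = 0 := by
    refine CaDiv.ext fun y ↦ ?_
    by_cases hy : y = p
    · subst hy
      obtain ⟨g, hg⟩ := exists_isLocalEq D' y
      obtain ⟨U, hyU, hU⟩ := hg.exists_open
      exact hg.germ_eq_one_iff.mpr <| hx.mem_unitsAt_of_forall fun z hz hzy ↦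
        (hU z (hz.mem_open U.2 hyU)).germ_eq_one_iff.mp (hoff z hzy)
    · exact hoff y hy
  refine ⟨hD', ?_⟩
  rw [hD', map_zero, zero_add] at h
  obtain ⟨e, he⟩ := exists_isLocalGenerator hI η
  have hek := (isLocalEq_divisorOfIdeal hI he).zsmul k
  rw [h] at hek
  have hv := M.valuation_eq_one M.map_center (hek.germ_eq_one_iff.mp rfl)
  rw [Units.val_zpow_eq_zpow_val, map_zpow₀, M.valuation_generator he M.map_center, ← exp_zsmul,
    ← exp_zero, exp_inj] at hv
  simpa using hv

variable [IsLocallyNoetherian Y]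

theorem exists_germ_pullback_eq (hp : IsClosed ({p} : Set Y)) (hx : IsRegularSystem x)
    (D : CaDiv X) : ∃ D' : CaDiv Y, ∀ z, π z ≠ p → (M.pullback D').germ z = D.germ z := by
  let ψ := Units.mapEquiv φ.toMulEquiv
  choose g hg using exists_isLocalEq D
  choose! σ hσ using fun (y : Y) (hy : y ≠ p) ↦ M.exists_eq hy
  let g' : Y → (FunField Y)ˣ := fun y ↦ ψ.symm (g (σ y))
  have hg' : ∀ z, π z ≠ p → IsLocalEq D z (ψ (g' (π z))) := by
    intro z hz
    rw [MulEquiv.apply_symm_apply, M.eq_of_map_eq (hσ (π z) hz) hz]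
    exact hg z
  have hcartier : IsCartierOff p g' := by
    intro y hy
    obtain ⟨z, rfl⟩ := M.exists_eq hy
    obtain ⟨W, hzW, hW⟩ := (hg' z hy).exists_open
    obtain ⟨V, hzV, -, hV⟩ := M.exists_preimage_le hy hzW
    refine ⟨V, hzV, fun y' hy'V hy' ↦ ?_⟩
    obtain ⟨z', rfl⟩ := M.exists_eq hy'
    apply M.mem_unitsAt_of_map_mem hy'
    rw [map_div]
    exact (hg' z' hy').iff_div_mem.mp (hW z' (hV hy'V))
  obtain ⟨D', hD'⟩ := hcartier.exists_caDiv hp hx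
  exact ⟨D', fun z hz ↦ (M.isLocalEq_pullback (hD' _ hz)).trans (hg' z hz).symm⟩

theorem exists_eq_pullback_add (hI : IsInvertibleIdeal I) (hp : IsClosed ({p} : Set Y))
    (hx : IsRegularSystem x) (D : CaDiv X) :
    ∃ (D' : CaDiv Y) (k : ℤ), D = M.pullback D' + k • divisorOfIdeal I hI := by
  obtain ⟨D', hD'⟩ := M.exists_germ_pullback_eq hp hx D
  obtain ⟨k, hk⟩ := M.exists_eq_zsmul hI (D := -M.pullback D' + D) fun z hz ↦ by
    rw [CaDiv.germ_add, CaDiv.germ_neg, hD' z hz, inv_mul_cancel]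
  exact ⟨D', k, eq_add_of_neg_add_eq hk⟩

end IsBlowUpModel

end Decomposition

/-! ### Comparison of the Cox rings -/

section GradedComparison

open DirectSum AddMonoidAlgebra

variable {ι ι' K K' : Type*} [AddCommGroup ι] [DecidableEq ι] [AddCommGroup ι'] [DecidableEq ι']
  [Field K] [Field K'] {𝒜 : ι → AddSubgroup K} {ℬ : ι' → AddSubgroup K'} [SetLike.GradedMonoid 𝒜]
  [SetLike.GradedMonoid ℬ] {φ : K →+* K'} {h : Multiplicative ι →* Kˣ} {θ : ι ≃+ ι' × ℤ}

theorem single_of_congr {b b' : ι'} {j j' : ℤ} {g : ℬ b} {g' : ℬ b'} (hb : b = b') (hj : j = j')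
    (hg : (g : K') = g') :
    (single j (of (ℬ ·) b g) : LaurentPolynomial (⨁ b, ℬ b)) = single j' (of (ℬ ·) b' g') := by
  subst hb hj
  rw [Subtype.ext hg]

variable (hφ : ∀ n, ∀ f ∈ 𝒜 n, φ (f * h (.ofAdd n)) ∈ ℬ (θ n).1)

/-- The component of degree `n` of `gradedComparison`. -/
def gradedComparisonPiece (n : ι) : 𝒜 n →+ ℬ (θ n).1 where
  toFun f := ⟨φ (f * h (.ofAdd n)), hφ n f f.2⟩
  map_zero' := Subtype.ext (by simp)
  map_add' f g := Subtype.ext (by simp [add_mul])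

/-- A regrading `θ : ι ≃+ ι' × ℤ` together with a twist by a character `h` defines a homomorphism
from a graded subring of `K[ι]` to the Laurent polynomials over a graded subring of `K'[ι']`; the
exponent of the variable is the component of the degree in `ℤ`. -/
def gradedComparison : (⨁ n, 𝒜 n) →+* LaurentPolynomial (⨁ b, ℬ b) :=
  DirectSum.toSemiring
    (fun n ↦ (singleAddHom (θ n).2).comp <| (of (ℬ ·) (θ n).1).comp (gradedComparisonPiece hφ n))
    (single_of_congr (g' := (⟨1, SetLike.GradedOne.one_mem⟩ : ℬ 0)) (by simp) (by simp) <| by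
      change φ ((1 : K) * _) = 1
      simp)
    (fun {i j} f g ↦ by
      refine Eq.trans ?_ (single_mul_single _ _ _ _).symm
      refine .trans ?_ (congrArg (single _) (of_mul_of _ _).symm)
      refine single_of_congr (by simp) (by simp) ?_
      change φ ((f * g : K) * _) = φ _ * φ _
      rw [← map_mul, ofAdd_add, map_mul h, Units.val_mul]
      exact congrArg φ (mul_mul_mul_comm _ _ _ _))

theorem gradedComparison_of (n : ι) (f : 𝒜 n) : gradedComparison hφ (of (𝒜 ·) n f) =
    single (θ n).2 (of (ℬ ·) (θ n).1 (gradedComparisonPiece hφ n f)) :=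
  DirectSum.toSemiring_of _ _ _ _ _

theorem coeff_gradedComparison (a : ⨁ n, 𝒜 n) (n : ι) :
    (((gradedComparison hφ a).coeff (θ n).2 (θ n).1 : ℬ (θ n).1) : K') =
      φ (a n * h (.ofAdd n)) := by
  induction a using DirectSum.induction_on with
  | zero => simp
  | add a b ha hb =>
    rw [map_add, coeff_add, Finsupp.add_apply, DirectSum.add_apply, AddSubgroup.coe_add, ha, hb,
      DirectSum.add_apply, AddSubgroup.coe_add, add_mul, map_add]
  | of k f =>
    rw [gradedComparison_of, coeff_single]
    by_cases hk : k = n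
    · subst hk
      rw [Finsupp.single_eq_same, of_eq_same, of_eq_same]
      rfl
    · rw [of_eq_of_ne _ _ _ (Ne.symm hk), ZeroMemClass.coe_zero, zero_mul, map_zero]
      by_cases hk₂ : (θ n).2 = (θ k).2
      · have hk₁ : (θ n).1 ≠ (θ k).1 := fun hk₁ ↦ hk (θ.injective (Prod.ext hk₁ hk₂)).symm
        rw [hk₂, Finsupp.single_eq_same, of_eq_of_ne _ _ _ hk₁]
        rfl
      · rw [Finsupp.single_eq_of_ne hk₂]
        rfl

theorem gradedComparison_injective : Function.Injective (gradedComparison hφ) := by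
  rw [injective_iff_map_eq_zero]
  intro a ha
  refine DFinsupp.ext fun n ↦ Subtype.ext ?_
  have hcoeff := coeff_gradedComparison hφ a n
  rw [ha] at hcoeff
  have hzero : φ (a n * h (.ofAdd n)) = 0 := hcoeff.symm
  rw [map_eq_zero, mul_eq_zero] at hzero
  exact hzero.resolve_right (Units.ne_zero _)

section Range

variable (hsurj : ∀ n, 0 ≤ (θ n).2 → ∀ g ∈ ℬ (θ n).1, ∃ f ∈ 𝒜 n, φ (f * h (.ofAdd n)) = g)

include hsurj

theorem single_mem_range_gradedComparison {j : ℤ} (hj : 0 ≤ j) (a : ⨁ b, ℬ b) :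
    single j a ∈ (gradedComparison hφ).range := by
  induction a using DirectSum.induction_on with
  | zero => rw [single_zero]; exact zero_mem _
  | add a b ha hb => rw [single_add]; exact add_mem ha hb
  | of b g =>
    obtain ⟨n, hn⟩ := θ.surjective (b, j)
    obtain ⟨f, hf, hfg⟩ := hsurj n (by rwa [hn]) g (by rw [hn]; exact g.2)
    refine ⟨of (𝒜 ·) n ⟨f, hf⟩, ?_⟩
    rw [gradedComparison_of]
    exact single_of_congr (congrArg Prod.fst hn) (congrArg Prod.snd hn) hfg

theorem toLaurent_mem_range_gradedComparison (q : Polynomial (⨁ b, ℬ b)) :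
    Polynomial.toLaurent q ∈ (gradedComparison hφ).range := by
  induction q using Polynomial.induction_on' with
  | add q q' hq hq' => rw [map_add]; exact add_mem hq hq'
  | monomial k a =>
    rw [Polynomial.toLaurent_C_mul_T, ← LaurentPolynomial.single_eq_C_mul_T]
    exact single_mem_range_gradedComparison hφ hsurj (Int.natCast_nonneg k) a

end Range

theorem exists_isUnit_gradedComparison_of_eq {m : ι} (hm : θ m = (0, 1)) (s : 𝒜 m)
    (hs : (φ (s * h (.ofAdd m)))⁻¹ ∈ ℬ 0) (hs₀ : (s : K) ≠ 0) :
    ∃ u : ⨁ b, ℬ b, IsUnit u ∧ gradedComparison hφ (of (𝒜 ·) m s) = single 1 u := by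
  have hne : φ (s * h (.ofAdd m)) ≠ 0 := (map_ne_zero φ).mpr (mul_ne_zero hs₀ (Units.ne_zero _))
  have hmem : φ (s * h (.ofAdd m)) ∈ ℬ 0 := by
    have := hφ m s s.2
    rwa [hm] at this
  have hinv : of (ℬ ·) 0 ⟨_, hmem⟩ * of (ℬ ·) 0 ⟨_, hs⟩ = 1 := by
    rw [of_mul_of]
    exact of_eq_of_gradedMonoid_eq (Sigma.subtype_ext (zero_add 0) (mul_inv_cancel₀ hne))
  refine ⟨of (ℬ ·) 0 ⟨_, hmem⟩, .of_mul_eq_one _ hinv, ?_⟩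
  rw [gradedComparison_of]
  exact single_of_congr (congrArg Prod.fst hm) (congrArg Prod.snd hm) rfl

include hφ in
theorem nonempty_localizationAway_equiv
    (hsurj : ∀ n, 0 ≤ (θ n).2 → ∀ g ∈ ℬ (θ n).1, ∃ f ∈ 𝒜 n, φ (f * h (.ofAdd n)) = g)
    {m : ι} (hm : θ m = (0, 1)) (s : 𝒜 m) (hs : (φ (s * h (.ofAdd m)))⁻¹ ∈ ℬ 0)
    (hs₀ : (s : K) ≠ 0) :
    Nonempty (Localization.Away (of (𝒜 ·) m s) ≃+* LaurentPolynomial (⨁ b, ℬ b)) := by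
  let Ψ := gradedComparison hφ
  let := Ψ.toAlgebra
  obtain ⟨u, hu, hΨ⟩ := exists_isUnit_gradedComparison_of_eq hφ hm s hs hs₀
  have hΨs : Ψ (of (𝒜 ·) m s) = LaurentPolynomial.C u * LaurentPolynomial.T 1 :=
    hΨ.trans (LaurentPolynomial.single_eq_C_mul_T u 1)
  have hunit : IsUnit (Ψ (of (𝒜 ·) m s)) := by
    rw [hΨs]
    exact (hu.map LaurentPolynomial.C).mul (LaurentPolynomial.isUnit_T 1)
  have hloc : IsLocalization.Away (of (𝒜 ·) m s) (LaurentPolynomial (⨁ b, ℬ b)) := by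
    refine IsLocalization.Away.mk _ hunit (fun z ↦ ?_) fun a b hab ↦
      ⟨0, by rw [gradedComparison_injective hφ hab]⟩
    obtain ⟨N, q, hq⟩ := z.exists_T_pow
    obtain ⟨a, ha⟩ := toLaurent_mem_range_gradedComparison hφ hsurj (q * Polynomial.C (u ^ N))
    refine ⟨N, a, ?_⟩
    change z * Ψ (of (𝒜 ·) m s) ^ N = gradedComparison hφ a
    rw [hΨs, ha, map_mul, hq, Polynomial.toLaurent_C, mul_pow, ← map_pow, LaurentPolynomial.T_pow,
      mul_one, mul_left_comm, mul_comm]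
  exact ⟨(IsLocalization.algEquiv (Submonoid.powers (of (𝒜 ·) m s))
    (Localization.Away (of (𝒜 ·) m s)) (LaurentPolynomial (⨁ b, ℬ b))).toRingEquiv⟩

end GradedComparison

section FreelyGenerates

variable {X : Scheme.{u}} [IsIntegral X] {r : ℕ} {D : Fin r → CaDiv X}

/-- The homomorphism `m ↦ m₁D₁ + … + m_rD_r`, which is the grading of the Cox ring. -/
def comb (D : Fin r → CaDiv X) : (Fin r → ℤ) →+ CaDiv X :=
  (Fintype.linearCombination ℤ D).toAddMonoidHom

theorem comb_apply (m : Fin r → ℤ) : comb D m = ∑ i, m i • D i :=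
  Fintype.linearCombination_apply ℤ D m

theorem mk_comb (m : Fin r → ℤ) : (QuotientAddGroup.mk (comb D m) : Pic X) =
    ∑ i, m i • (QuotientAddGroup.mk (D i) : Pic X) := by
  rw [comb_apply]
  exact map_sum (QuotientAddGroup.mk' (principal X).range) _ _

theorem mem_H0_zero_of_principal_eq_zero {f : (FunField X)ˣ}
    (hf : principal X (Additive.ofMul f) = 0) : (f : FunField X) ∈ H0 (0 : CaDiv X) := by
  rw [← one_mul (f : FunField X), mul_mem_H0_iff, hf, add_zero]
  exact one_mem_H0_zero

namespace FreelyGeneratesPic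

theorem eq_zero (hD : FreelyGeneratesPic D) {m : Fin r → ℤ} {f : Additive (FunField X)ˣ}
    (h : comb D m + principal X f = 0) : m = 0 := by
  refine funext (Fintype.linearIndependent_iff.mp hD.1 m ?_)
  rw [← mk_comb, QuotientAddGroup.eq_zero_iff, eq_neg_of_add_eq_zero_left h, ← map_neg]
  exact ⟨-f, rfl⟩

theorem exists_eq (hD : FreelyGeneratesPic D) (D₀ : CaDiv X) :
    ∃ (m : Fin r → ℤ) (f : Additive (FunField X)ˣ), D₀ = comb D m + principal X f := by
  have hD₀ : (QuotientAddGroup.mk D₀ : Pic X) ∈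
      Submodule.span ℤ (Set.range fun i ↦ (QuotientAddGroup.mk (D i) : Pic X)) :=
    hD.2 ▸ Submodule.mem_top
  obtain ⟨m, hm⟩ := (Submodule.mem_span_range_iff_exists_fun ℤ).mp hD₀
  rw [← mk_comb, QuotientAddGroup.eq] at hm
  obtain ⟨f, hf⟩ := hm
  exact ⟨m, f, by rw [hf, add_neg_cancel_left]⟩

theorem exists_addEquiv (hD : FreelyGeneratesPic D) {B : Type*} [AddCommGroup B]
    (F : B →+ CaDiv X) (hgen : ∀ D₀, ∃ b f, D₀ = F b + principal X f)
    (hinj : ∀ b f, F b + principal X f = 0 → b = 0) :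
    ∃ (θ : (Fin r → ℤ) ≃+ B) (h : Multiplicative (Fin r → ℤ) →* (FunField X)ˣ),
      ∀ m, comb D m = F (θ m) + principal X (Additive.ofMul (h (.ofAdd m))) := by
  choose b f hbf using fun i ↦ hgen (D i)
  let θ := Fintype.linearCombination ℤ b
  let h := Fintype.linearCombination ℤ f
  have hθ : ∀ m, comb D m = F (θ m) + principal X (h m) := by
    intro m
    rw [comb_apply, show θ m = _ from Fintype.linearCombination_apply ℤ b m,
      show h m = _ from Fintype.linearCombination_apply ℤ f m, map_sum, map_sum,
      ← Finset.sum_add_distrib]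
    refine Finset.sum_congr rfl fun i _ ↦ ?_
    rw [map_zsmul, map_zsmul, ← zsmul_add, ← hbf]
  have hinjective : Function.Injective θ := by
    rw [injective_iff_map_eq_zero]
    intro m hm
    exact hD.eq_zero (f := -h m) (by rw [hθ m, hm]; simp)
  have hsurjective : Function.Surjective θ := by
    intro c
    obtain ⟨m, g, hm⟩ := hD.exists_eq (F c)
    rw [hθ m] at hm
    have hc := hinj (c - θ m) (-(h m + g)) (by rw [map_sub, hm, map_neg, map_add]; abel)
    exact ⟨m, (sub_eq_zero.mp hc).symm⟩
  exact ⟨.ofBijective θ.toAddMonoidHom ⟨hinjective, hsurjective⟩,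
    AddMonoidHom.toMultiplicativeLeft h.toAddMonoidHom, hθ⟩

end FreelyGeneratesPic

end FreelyGenerates

section Regrading

open WithZero

variable {X Y : Scheme.{u}} [IsIntegral X] [IsIntegral Y] {π : X ⟶ Y} {p : Y}
  {I : X.IdealSheafData} {φ : FunField Y ≃+* FunField X} {v : Valuation (FunField X) ℤᵐ⁰} {η : X}
  [IsNoetherianRing (Y.presheaf.stalk p)] {ι : Type*} [Finite ι] [Nontrivial ι]
  {x : ι → Y.presheaf.stalk p} {r r' : ℕ} {D : Fin r → CaDiv X} {D' : Fin r' → CaDiv Y}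

namespace IsBlowUpModel

theorem eq_zero_of_pullback_comb_add_principal_eq_zero (M : IsBlowUpModel π p I φ v η)
    (hI : IsInvertibleIdeal I) (hx : IsRegularSystem x) (hD' : FreelyGeneratesPic D')
    {a : Fin r' → ℤ} {k : ℤ} {f : (FunField X)ˣ}
    (h : M.pullback (comb D' a) + k • divisorOfIdeal I hI + principal X (Additive.ofMul f) = 0) :
    a = 0 ∧ k = 0 ∧ principal Y (Additive.ofMul ((Units.mapEquiv φ.toMulEquiv).symm f)) = 0 := by
  have hf := M.pullback_principal ((Units.mapEquiv φ.toMulEquiv).symm f)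
  rw [MulEquiv.apply_symm_apply] at hf
  rw [← hf, add_right_comm, ← map_add] at h
  obtain ⟨hzero, rfl⟩ := M.eq_zero_of_pullback_add_eq_zero hI hx h
  obtain rfl := hD'.eq_zero hzero
  rw [map_zero, zero_add] at hzero
  exact ⟨rfl, rfl, hzero⟩

variable [IsLocallyNoetherian Y]

theorem exists_regrading (M : IsBlowUpModel π p I φ v η)
    (hI : IsInvertibleIdeal I) (hp : IsClosed ({p} : Set Y)) (hx : IsRegularSystem x)
    (hD : FreelyGeneratesPic D) (hD' : FreelyGeneratesPic D') :
    ∃ (θ : (Fin r → ℤ) ≃+ (Fin r' → ℤ) × ℤ) (h : Multiplicative (Fin r → ℤ) →* (FunField X)ˣ),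
      ∀ m, comb D m = M.pullback (comb D' (θ m).1) + (θ m).2 • divisorOfIdeal I hI +
        principal X (Additive.ofMul (h (.ofAdd m))) := by
  refine hD.exists_addEquiv
    ((M.pullback.comp (comb D')).coprod (zmultiplesHom (CaDiv X) (divisorOfIdeal I hI)))
    (fun D₀ ↦ ?_) fun b f h ↦ ?_
  · obtain ⟨D₁, k, rfl⟩ := M.exists_eq_pullback_add hI hp hx D₀
    obtain ⟨a, f, rfl⟩ := hD'.exists_eq D₁
    refine ⟨(a, k), Additive.ofMul (Units.mapEquiv φ.toMulEquiv f.toMul), ?_⟩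
    rw [map_add, ← M.pullback_principal, ofMul_toMul]
    exact add_right_comm _ _ _
  · obtain ⟨hb₁, hb₂, -⟩ :=
      M.eq_zero_of_pullback_comb_add_principal_eq_zero hI hx hD' (f := f.toMul) h
    exact Prod.ext hb₁ hb₂

theorem nonempty_cox_equiv (M : IsBlowUpModel π p I φ v η)
    (hI : IsInvertibleIdeal I) (hp : IsClosed ({p} : Set Y)) (hx : IsRegularSystem x)
    (hD : FreelyGeneratesPic D) (hD' : FreelyGeneratesPic D') (m : Fin r → ℤ)
    (s : H0 (∑ i, m i • D i)) (hs : HasZeroDivisor s (divisorOfIdeal I hI)) :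
    Nonempty (Localization.Away (Cox.ofSection D m s) ≃+* LaurentPolynomial (Cox D')) := by
  obtain ⟨θ, h, hθ⟩ := M.exists_regrading hI hp hx hD hD'
  obtain ⟨f, hfs, hf⟩ := hs
  rw [← comb_apply, hθ m, add_assoc, ← map_add, ← ofMul_mul] at hf
  obtain ⟨hm₁, hm₂, hunit⟩ := M.eq_zero_of_pullback_comb_add_principal_eq_zero hI hx hD'
    (a := (θ m).1) (k := (θ m).2 - 1) (f := h (.ofAdd m) * f) (by
      rw [sub_smul, one_smul, ← add_sub_assoc, sub_add_eq_add_sub, hf, sub_self])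
  refine nonempty_localizationAway_equiv (𝒜 := coxPiece D) (ℬ := coxPiece D')
    (φ := φ.symm.toRingHom) (h := h) (θ := θ) (fun k g hg ↦ ?_) (fun k hk g hg ↦ ?_)
    (m := m) (Prod.ext hm₁ (sub_eq_zero.mp hm₂)) s ?_ (hfs ▸ f.ne_zero)
  · rw [coxPiece, ← comb_apply, hθ k, ← mul_mem_H0_iff] at hg
    rw [coxPiece, ← comb_apply]
    exact M.symm_mem_H0 hI hx hg
  · rw [coxPiece, ← comb_apply] at hg
    refine ⟨φ g * ↑(h (.ofAdd k))⁻¹, ?_, ?_⟩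
    · rw [coxPiece, ← comb_apply, hθ k, ← mul_mem_H0_iff, mul_assoc, Units.inv_mul, mul_one]
      exact M.map_mem_H0 hI hk hg
    · rw [mul_assoc, Units.inv_mul, mul_one]
      exact φ.symm_apply_apply g
  · rw [coxPiece, ← comb_apply, map_zero, ← hfs, ← Units.val_mul, mul_comm f]
    have hmem := mem_H0_zero_of_principal_eq_zero
      (f := ((Units.mapEquiv φ.toMulEquiv).symm (h (.ofAdd m) * f))⁻¹)
      (by rw [ofMul_inv, map_neg, hunit, neg_zero])
    rwa [Units.val_inv_eq_inv_val] at hmem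

end IsBlowUpModel

end Regrading

section Projective

instance (n : ℕ) : Algebra.FiniteType (MvPolynomial.homogeneousSubmodule (Fin (n + 1)) ℂ 0)
    (MvPolynomial (Fin (n + 1)) ℂ) :=
  have : IsScalarTower ℂ (MvPolynomial.homogeneousSubmodule (Fin (n + 1)) ℂ 0)
      (MvPolynomial (Fin (n + 1)) ℂ) :=
    ⟨fun c a f ↦ smul_mul_assoc c (a : MvPolynomial (Fin (n + 1)) ℂ) f⟩
  Algebra.FiniteType.of_restrictScalars_finiteType ℂ _ _

theorem isNoetherianRing_homogeneousSubmodule_zero (n : ℕ) :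
    IsNoetherianRing (MvPolynomial.homogeneousSubmodule (Fin (n + 1)) ℂ 0) := by
  refine isNoetherianRing_of_surjective ℂ _
    (algebraMap ℂ (MvPolynomial.homogeneousSubmodule (Fin (n + 1)) ℂ 0)) ?_
  rintro ⟨f, hf⟩
  rw [MvPolynomial.mem_homogeneousSubmodule, ← MvPolynomial.totalDegree_zero_iff_isHomogeneous,
    MvPolynomial.totalDegree_eq_zero_iff_eq_C] at hf
  exact ⟨_, Subtype.ext hf.symm⟩

theorem IsProjective.isLocallyNoetherian {X : Scheme.{0}} {s : X ⟶ Spec (.of ℂ)}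
    (h : IsProjective s) : IsLocallyNoetherian X := by
  obtain ⟨n, i, hi, -⟩ := h
  let 𝒜 := MvPolynomial.homogeneousSubmodule (Fin (n + 1)) ℂ
  have : IsNoetherianRing (CommRingCat.of (𝒜 0)) := isNoetherianRing_homogeneousSubmodule_zero n
  let i' : X ⟶ Proj 𝒜 := i
  have : IsClosedImmersion i' := hi
  exact LocallyOfFiniteType.isLocallyNoetherian (i' ≫ Proj.toSpecZero 𝒜)

end Projective

end CoxRing

end

open CoxRing in
theorem proposition3p1_general.{u} {X X' : Scheme.{u}} [IsIntegral X] [IsIntegral X']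
    [IsLocallyNoetherian X'] {p : X'} (hp : IsClosed ({p} : Set X'))
    [IsRegularLocalRing (X'.presheaf.stalk p)] (hdim : 2 ≤ ringKrullDim (X'.presheaf.stalk p))
    {π : X ⟶ X'} (hπ : IsBlowUp (pointIdeal p hp) π)
    {r r' : ℕ} {D : Fin r → CaDiv X} (hD : FreelyGeneratesPic D)
    {D' : Fin r' → CaDiv X'} (hD' : FreelyGeneratesPic D')
    (m : Fin r → ℤ) (xE : H0 (∑ i, m i • D i))
    (hxE : HasZeroDivisor xE (exceptionalDivisor hπ)) :
    Nonempty (Localization.Away (Cox.ofSection D m xE) ≃+* LaurentPolynomial (Cox D')) := by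
  obtain ⟨n, x, hx⟩ := exists_isRegularSystem (X'.presheaf.stalk p)
  have : Nontrivial (Fin n) := by
    rw [hx.ringKrullDim_eq, Nat.card_fin] at hdim
    exact Fin.nontrivial_iff_two_le.mpr (by exact_mod_cast hdim)
  obtain ⟨v₀, hv₀⟩ := hx.exists_extendsAdicOrder (FunField X')
  obtain ⟨a, ha, ha'⟩ := hx.exists_mem_notMem_maximalIdeal_sq
  obtain ⟨φ, v, η, M⟩ := hπ.exists_isBlowUpModel hv₀ ha ha'
  exact M.nonempty_cox_equiv hπ.isInvertible hp hx hD hD' m xE hxE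

open CoxRing in
theorem proposition3p1
    {X X' : Scheme.{0}} [IsIntegral X] [IsIntegral X']
    -- `X'` is a projective variety over `ℂ` of dimension at least 2, and `p` is a smooth point of it
    (s : X' ⟶ Spec (.of ℂ)) (hX' : IsProjective s)
    (p : X') (hp : IsSmoothPoint X' p) (hdim : 2 ≤ ringKrullDim (X'.presheaf.stalk p))
    -- `π` is the blow-up of `p`
    (π : X ⟶ X') (hπ : IsBlowUp (pointIdeal p hp.isClosed) π)
    -- the bases of the Picard groups that define the Cox rings
    {r r' : ℕ} (D : Fin r → CaDiv X) (hD : FreelyGeneratesPic D)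
    (D' : Fin r' → CaDiv X') (hD' : FreelyGeneratesPic D')
    -- the section `x_E` with divisor `E`, in the degree `m` of the class of `E`
    (m : Fin r → ℤ) (xE : H0 (∑ i, m i • D i))
    (hxE : HasZeroDivisor xE (exceptionalDivisor hπ)) :
    Nonempty (Localization.Away (Cox.ofSection D m xE) ≃+* LaurentPolynomial (Cox D')) := by
  have := hX'.isLocallyNoetherian
  have := hp.isRegular
  exact proposition3p1_general hp.isClosed hdim hπ hD hD' m xE hxE
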